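/- **Theorem 5.1.** A signature of length $N$ is an $N$-tuple of integers $\lambda=(\lambda_1\ge\lambda_2\ge\dots\ge\lambda_N)$; let $\widehat U(N)$ be the set of all of them. The counting measure of $\lambda\in\widehat U(N)$ is the probability measure $$m[\lambda]=\frac1N\sum_{i=1}^N\delta\!\left(\frac{\lambda_i+N-i}{N}\right)$$ on $\mathbb R$, and the character of the corresponding irreducible representation of $U(N)$ is the symmetric Laurent polynomial $$\chi_\lambda(u_1,\dots,u_N)=\frac{\det\big[u_i^{\lambda_j+N-j}\big]_{i,j=1}^N}{\prod_{1\le i<j\le N}(u_i-u_j)},$$ whose values at points with coinciding coordinates are defined by continuity. For a probability measure $\rho$ on $\widehat U(N)$ the character generating function is $$\mathcal S_\rho(u_1,\dots,u_N)=\sum_{\lambda\in\widehat U(N)}\rho(\lambda)\,\frac{\chi_\lambda(u_1,\dots,u_N)}{\chi_\lambda(1,\dots,1)},$$ and $m[\rho]$ denotes the random probability measure $m[\lambda]$ with $\lambda$ distributed according to $\rho$. For each $N=1,2,\dots$ let $\rho(N)$ be a probability measure on $\widehat U(N)$ such that the series defining $\mathcal S_{\rho(N)}$ converges uniformly in an open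 neighbourhood of $(1,\dots,1)$ in $\mathbb C^N$. Let $Q$ be a complex function that is analytic in a neighbourhood of $1$, and suppose that for every $k=1,2,\dots$ $$\lim_{N\to\infty}\frac1N\ln\mathcal S_{\rho(N)}(u_1,\dots,u_k,\underbrace{1,\dots,1}_{N-k})=Q(u_1)+\dots+Q(u_k)$$ uniformly in an open neighbourhood of $(1,\dots,1)$ in $\mathbb C^k$ (which may depend on $k$, but not on $N$), where for all large $N$ the function $\ln\mathcal S_{\rho(N)}(u_1,\dots,u_k,1^{N-k})$ is a holomorphic branch of the logarithm on this neighbourhood that vanishes at $(1,\dots,1)$. Then there is a (deterministic) probability measure $\mathbf m$ on $\mathbb R$ with finite moments of all orders such that $m[\rho(N)]$ converges to $\mathbf m$ as $N\to\infty$ in probability, in the sense of moments: for every $n=0,1,2,\dots$ the random variable $\int_{\mathbb R}x^n\,m[\rho(N)](dx)$ converges in probability to $\int_{\mathbb R}x^n\,\mathbf m(dx)$. Moreover, for every $k=0,1,2,\dots$ $$\int_{\mathbb R}x^k\,\mathbf m(dx)=\sum_{\ell=0}^k\frac{k!}{\ell!\,(\ell+1)!\,(k-\ell)!}\,\frac{\partial^\ell}{\partial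 u^\ell}\Big(u^k\,Q'(u)^{k-\ell}\Big)\Big|_{u=1}.$$ -/

import Mathlib

open Filter Topology MeasureTheory

noncomputable section

namespace UnitarySignature

/-- Signatures of length `N` (highest weights of the irreducible representations of `U(N)`):
tuples of integers `lam 0 ≥ lam 1 ≥ ⋯ ≥ lam (N-1)`.  This is a countable discrete measurable
space. -/
abbrev Signature (N : ℕ) : Type := {lam : Fin N → ℤ // Antitone lam}

/-- The shifted coordinate `λ_i + N - i`, where `i` runs over `1, …, N` (so the element
`i : Fin N` stands for the index `i + 1`). -/
def shifted {N : ℕ} (lam : Signature N) (i : Fin N) : ℤ :=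
  lam.1 i + (N : ℤ) - ((i : ℕ) + 1 : ℤ)

/-- The counting measure `m[λ] = (1/N) ∑ᵢ δ((λ_i + N - i)/N)`. -/
def countingMeasure {N : ℕ} (lam : Signature N) : Measure ℝ :=
  (N : ENNReal)⁻¹ • ∑ i : Fin N, Measure.dirac ((shifted lam i : ℝ) / (N : ℝ))

/-- The right-hand side of Weyl's formula,
`det [u_i ^ (λ_j + N - j)] / ∏_{i<j} (u_i - u_j)`,
meaningful when the `u_i` are nonzero and pairwise distinct. -/
def weylRatio {N : ℕ} (lam : Signature N) (u : Fin N → ℂ) : ℂ :=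
  (Matrix.of fun i j : Fin N => u i ^ shifted lam j).det /
    ∏ i : Fin N, ∏ j ∈ Finset.Ioi i, (u i - u j)

/-- The character `χ_λ(u_1, …, u_N)` of `U(N)`, i.e. the rational Schur function.  On points with
nonzero pairwise distinct coordinates it is Weyl's ratio; the ratio is a symmetric Laurent
polynomial, and its value at points where coordinates coincide is obtained by continuous extension
from the (dense) set of points with nonzero pairwise distinct coordinates. -/
def character {N : ℕ} (lam : Signature N) : (Fin N → ℂ) → ℂ :=
  extendFrom {v : Fin N → ℂ | Function.Injective v ∧ ∀ i, v i ≠ 0} (weylRatio lam)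

/-- The term `ρ(λ) χ_λ(u) / χ_λ(1^N)` of the character generating function. -/
def charGenTerm {N : ℕ} (ρ : Measure (Signature N)) (lam : Signature N) (u : Fin N → ℂ) : ℂ :=
  (ρ.real {lam} : ℂ) * (character lam u / character lam 1)

/-- The character generating function
`S_ρ(u_1, …, u_N) = ∑_λ ρ(λ) χ_λ(u_1, …, u_N) / χ_λ(1^N)`. -/
def charGenFun {N : ℕ} (ρ : Measure (Signature N)) (u : Fin N → ℂ) : ℂ :=
  ∑' lam : Signature N, charGenTerm ρ lam u

/-- The series defining the character generating function converges uniformly in some open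
neighbourhood of `(1, …, 1)` in `ℂ^N`. -/
def CharGenConverges {N : ℕ} (ρ : Measure (Signature N)) : Prop :=
  ∃ V : Set (Fin N → ℂ), IsOpen V ∧ 1 ∈ V ∧ SummableUniformlyOn (charGenTerm ρ) V

/-- The point `(u_1, …, u_k, 1^{N-k})` (used for `N ≥ k`). -/
def padOne {k : ℕ} (N : ℕ) (u : Fin k → ℂ) : Fin N → ℂ :=
  fun i => if h : (i : ℕ) < k then u ⟨i, h⟩ else 1

/-- `(1/N) ln S_{ρ(N)}(u_1, …, u_k, 1^{N-k}) → Q(u_1) + ⋯ + Q(u_k)`, uniformly in an open complex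
neighbourhood `U` of `(1, …, 1) ∈ ℂ^k`.  Here `ln S_{ρ(N)}` is the holomorphic branch `L N` of the
logarithm on `U` which vanishes at `(1, …, 1)`; it is required to exist for all large `N`.  (As
`exp` never vanishes, the equation for `exp (L N u)` forces the series for `S_{ρ(N)}` to converge on
`U`.) -/
def LogCharGenTendsto (ρ : (N : ℕ) → Measure (Signature N)) (Q : ℂ → ℂ) (k : ℕ) : Prop :=
  ∃ U : Set (Fin k → ℂ), IsOpen U ∧ 1 ∈ U ∧
    ∃ L : ℕ → (Fin k → ℂ) → ℂ,
      (∀ᶠ N in atTop, DifferentiableOn ℂ (L N) U ∧ L N 1 = 0 ∧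
        ∀ u ∈ U, Complex.exp (L N u) = charGenFun (ρ N) (padOne N u)) ∧
      TendstoUniformlyOn (fun (N : ℕ) u => (1 / (N : ℂ)) * L N u) (fun u => ∑ i, Q (u i)) atTop U

/-- The random measures `m[ρ(N)]` (the law of `countingMeasure lam` for `lam` distributed according
to `ρ(N)`) converge in probability, in the sense of moments, to the deterministic measure `m`: all
moments of `m` are finite, and for each `n` the `n`-th moment of the random measure converges in
probability to the `n`-th moment of `m`. -/
def TendstoInProbabilityInMoments (ρ : (N : ℕ) → Measure (Signature N)) (m : Measure ℝ) : Prop :=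
  ∀ n : ℕ, Integrable (fun x : ℝ => x ^ n) m ∧
    ∀ ε : ℝ, 0 < ε →
      Tendsto (fun N : ℕ => ρ N {lam | ε ≤ |∫ x, x ^ n ∂(countingMeasure lam) - ∫ x, x ^ n ∂m|})
        atTop (𝓝 0)

end UnitarySignature

end

/-! In Weyl's formula the numerator is a determinant whose `i`-th row consists of powers of `u_i`,
so `∑ u_i ^ k ∂_i ^ k` multiplies it by the sum of the `k`-th falling factorials of the shifted
coordinates. Let `V` be the Vandermonde product. The operator `D_k = V⁻¹ ∑ u_i ^ k ∂_i ^ k V` then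
has every normalized character as an eigenfunction with eigenvalue `fallingSum k`. Applied to the
character generating function `S` and evaluated at `1`, it computes expectations of `fallingSum k`;
composing two such operators computes expectations of products.

By the Leibniz rule, `D_k f` is the sum over `l ≤ k` of `C(k,l) l!` times the sum, over sets `I` of
`l + 1` variables, of the divided difference over `I` of `u_i ^ k ∂_i ^ (k-l) f`
(`fallingSum_mul_normChar`). For symmetric `f` these divided differences extend holomorphically
across the diagonals (`exists_isDivDiffExt`). On a smaller ball the extension is bounded by the size
of `f` (`exists_norm_divDiffExt_derivFamily_le`), so it commutes with uniformly convergent series.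

Put all variables except the first `n` equal to `1`. The term of `I` then depends only on its
`pattern` among `n + k + 1` variables, so the number of functions involved does not grow with `N`
(`fallingSum_mul_fewChar`). Since `S = exp L` with `L / N → ∑ Q(u_i)`, the quotient `N ^ (-m) ∂_i ^
m S / S` tends to `Q'(u_i) ^ m`. Of the roughly `N ^ (l+1) / (l+1)!` sets `I`, all but a vanishing
proportion avoid the first `n` variables. For those the limiting divided difference is taken at
coinciding points `1`, hence is the `l`-th Taylor coefficient of `u ^ k Q'(u) ^ (k-l)`. The powers
of `N` add up to `k + 1`, and the result is `limitMoment`.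

The argument works for any `f` with `f / S` tending uniformly to a constant, and returns a function
of the same kind (`HasWeightedLimit.fallingSum`), so it can be iterated. Two applications show that
second moments converge to products of first moments, and Chebyshev's inequality gives convergence
in probability. Powers and falling factorials agree to leading order in `N`. The limit measure is a
weak limit point of counting measures of well-chosen deterministic signatures
(`exists_measure_of_tendsto_measure_moment`). -/

noncomputable section

namespace UnitarySignature

/-! ### Several complex variables: Cauchy integrals, partial derivatives, division by `u_i - u_j`.
-/

section ComplexAnalysis

set_option linter.unusedSectionVars false

open Metric Set

/-- A bound for the Fréchet derivative of a bounded holomorphic function. -/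
lemma norm_fderiv_le_of_forall_mem_ball {E : Type*} [NormedAddCommGroup E] [NormedSpace ℂ E]
    {f : E → ℂ} {x : E} {δ M : ℝ} (hδ : 0 < δ) (hf : DifferentiableOn ℂ f (ball x δ))
    (hM : ∀ y ∈ ball x δ, ‖f y‖ ≤ M) : ‖fderiv ℂ f x‖ ≤ 2 * M / δ := by
  refine Complex.norm_fderiv_le_div_of_mapsTo_ball hf (fun y hy => ?_) hδ
  rw [mem_closedBall, dist_eq_norm]
  calc ‖f y - f x‖ ≤ ‖f y‖ + ‖f x‖ := norm_sub_le _ _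
    _ ≤ 2 * M := by linarith [hM y hy, hM x (mem_ball_self hδ)]

/-- A circle integral depending holomorphically on a parameter is a holomorphic function of the
parameter. -/
theorem differentiableOn_circleIntegral_param {E : Type*} [NormedAddCommGroup E]
    [NormedSpace ℂ E] [ProperSpace E] {O : Set E} (hO : IsOpen O) {K : ℂ → E → ℂ} {c : ℂ} {R : ℝ}
    (hR : 0 ≤ R) (hd : ∀ w ∈ sphere c R, DifferentiableOn ℂ (K w) O)
    (hc : ContinuousOn (fun p : ℂ × E => K p.1 p.2) (sphere c R ×ˢ O)) :
    DifferentiableOn ℂ (fun u => ∮ w in C(c, R), K w u) O := by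
  intro x hx
  obtain ⟨δ₀, hδ₀, hball⟩ := Metric.isOpen_iff.1 hO x hx
  set δ := δ₀ / 3 with hδdef
  have hδ : 0 < δ := by positivity
  have hsub : closedBall x (2 * δ) ⊆ O :=
    (closedBall_subset_ball (by linarith)).trans hball
  have hcomp : IsCompact (sphere c R ×ˢ closedBall x (2 * δ)) :=
    (isCompact_sphere c R).prod (isCompact_closedBall x _)
  have hc' : ContinuousOn (fun p : ℂ × E => K p.1 p.2) (sphere c R ×ˢ closedBall x (2 * δ)) :=
    hc.mono (prod_mono_right hsub)
  obtain ⟨M, hM⟩ := hcomp.exists_bound_of_continuousOn hc'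
  have hcirc : ∀ t, circleMap c R t ∈ sphere c R := fun t => circleMap_mem_sphere c hR t
  have hKx : ∀ y ∈ O, Continuous fun t : ℝ => deriv (circleMap c R) t • K (circleMap c R t) y := by
    intro y hy
    have h1 : Continuous fun t : ℝ => deriv (circleMap c R) t := by
      simp only [deriv_circleMap]
      exact (continuous_circleMap 0 R).mul continuous_const
    refine h1.smul (hc.comp_continuous (f := fun t : ℝ => (circleMap c R t, y)) ?_ ?_)
    · exact (continuous_circleMap c R).prodMk continuous_const
    · exact fun t => ⟨hcirc t, hy⟩
  have hbd : ∀ t, ∀ y ∈ ball x δ, ‖fderiv ℂ (K (circleMap c R t)) y‖ ≤ 2 * M / δ := by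
    intro t y hy
    have hyb : ball y δ ⊆ closedBall x (2 * δ) := by
      intro z hz
      rw [mem_ball] at hz hy
      rw [mem_closedBall]
      linarith [dist_triangle z y x]
    exact norm_fderiv_le_of_forall_mem_ball hδ ((hd _ (hcirc t)).mono (hyb.trans hsub))
      fun z hz => hM (circleMap c R t, z) ⟨hcirc t, hyb hz⟩
  -- Uniform continuity on the compact set makes the difference of two kernels small on a whole ball
  -- around `x`; the Cauchy estimate then makes the difference of their derivatives small.
  have hcontF : Continuous fun t : ℝ => fderiv ℂ (K (circleMap c R t)) x := by
    have huc := hcomp.uniformContinuousOn_of_continuous hc'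
    rw [Metric.uniformContinuousOn_iff] at huc
    rw [Metric.continuous_iff]
    intro t₀ ε hε
    obtain ⟨η, hη, H⟩ := huc (ε * δ / 4) (by positivity)
    obtain ⟨η', hη', H'⟩ := Metric.continuous_iff.1 (continuous_circleMap c R) t₀ η hη
    refine ⟨η', hη', fun t ht => ?_⟩
    have hxb : ball x δ ⊆ closedBall x (2 * δ) :=
      ball_subset_closedBall.trans (closedBall_subset_closedBall (by linarith))
    have hdx : ∀ s, DifferentiableAt ℂ (K (circleMap c R s)) x := fun s =>
      (hd _ (hcirc s)).differentiableAt (hO.mem_nhds hx)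
    rw [dist_eq_norm, ← fderiv_sub (hdx t) (hdx t₀)]
    refine (norm_fderiv_le_of_forall_mem_ball (M := ε * δ / 4) hδ
      (((hd _ (hcirc t)).sub (hd _ (hcirc t₀))).mono (hxb.trans hsub)) fun y hy => ?_).trans_lt ?_
    · have := H (circleMap c R t, y) ⟨hcirc t, hxb hy⟩ (circleMap c R t₀, y) ⟨hcirc t₀, hxb hy⟩
        (by simpa [Prod.dist_eq, hη] using H' t ht)
      rw [dist_eq_norm] at this
      simpa using this.le
    · rw [div_lt_iff₀ hδ]; nlinarith
  have hderivc : Continuous fun t : ℝ => deriv (circleMap c R) t := by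
    simp only [deriv_circleMap]
    exact (continuous_circleMap 0 R).mul continuous_const
  have key := intervalIntegral.hasFDerivAt_integral_of_dominated_of_fderiv_le (𝕜 := ℂ)
    (μ := volume) (a := 0) (b := 2 * Real.pi) (x₀ := x) (s := ball x δ)
    (F := fun y t => deriv (circleMap c R) t • K (circleMap c R t) y)
    (F' := fun y t => deriv (circleMap c R) t • fderiv ℂ (K (circleMap c R t)) y)
    (bound := fun _ => R * (2 * M / δ)) (ball_mem_nhds x hδ)
    (by
      filter_upwards [hO.mem_nhds hx] with y hy
      exact (hKx y hy).aestronglyMeasurable)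
    ((hKx x hx).intervalIntegrable _ _)
    ((hderivc.smul hcontF).aestronglyMeasurable)
    (by
      refine Eventually.of_forall fun t _ y hy => ?_
      rw [norm_smul]
      refine mul_le_mul ?_ (hbd t y hy) (norm_nonneg _) hR
      simp [abs_of_nonneg hR])
    (by simp)
    (by
      refine Eventually.of_forall fun t _ y hy => ?_
      have hyO : y ∈ O := hsub (ball_subset_closedBall (ball_subset_ball (by linarith) hy))
      exact (((hd _ (hcirc t)).differentiableAt (hO.mem_nhds hyO)).hasFDerivAt).fun_const_smul
        (deriv (circleMap c R) t))
  exact key.differentiableAt.differentiableWithinAt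

variable {ι : Type*} [Fintype ι] [DecidableEq ι]

/-- The partial derivative of a function of several complex variables. -/
def partialDeriv (i : ι) (f : (ι → ℂ) → ℂ) (u : ι → ℂ) : ℂ :=
  deriv (fun w => f (Function.update u i w)) (u i)

lemma differentiable_update (u : ι → ℂ) (i : ι) :
    Differentiable ℂ fun w : ℂ => Function.update u i w := by
  rw [differentiable_pi]
  intro j
  rcases eq_or_ne j i with rfl | h
  · simp [differentiable_fun_id]
  · simp [h]

lemma differentiable_update_left (i : ι) (w : ℂ) :
    Differentiable ℂ fun u : ι → ℂ => Function.update u i w := by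
  rw [differentiable_pi]
  intro j
  rcases eq_or_ne j i with rfl | h
  · simp
  · simpa [h] using differentiable_apply j

lemma continuous_update_uncurry (i : ι) :
    Continuous fun p : ℂ × (ι → ℂ) => Function.update p.2 i p.1 :=
  continuous_snd.update i continuous_fst

lemma update_mem_closedBall {x u : ι → ℂ} {i : ι} {δ : ℝ} (hu : u ∈ ball x δ) {w : ℂ}
    (hw : w ∈ closedBall (x i) δ) : Function.update u i w ∈ closedBall x δ := by
  rw [mem_closedBall, dist_pi_le_iff (dist_nonneg.trans (mem_ball.1 hu).le)]
  intro j
  rcases eq_or_ne j i with rfl | h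
  · simpa using hw
  · simpa [h] using (dist_le_pi_dist u x j).trans (mem_ball.1 hu).le

/-- Holomorphy of an integral of Cauchy type in the `i`-th variable. -/
lemma differentiableOn_circleIntegral_update {O : Set (ι → ℂ)} {f : (ι → ℂ) → ℂ}
    (hf : DifferentiableOn ℂ f O) {x : ι → ℂ} {i : ι} {δ : ℝ} (hδ : 0 < δ)
    (hsub : closedBall x δ ⊆ O) {k : ℂ → (ι → ℂ) → ℂ}
    (hk : ∀ w ∈ sphere (x i) δ, DifferentiableOn ℂ (k w) (ball x δ))
    (hkc : ContinuousOn (fun p : ℂ × (ι → ℂ) => k p.1 p.2) (sphere (x i) δ ×ˢ ball x δ)) :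
    DifferentiableOn ℂ (fun u => ∮ w in C(x i, δ), k w u • f (Function.update u i w))
      (ball x δ) := by
  refine differentiableOn_circleIntegral_param isOpen_ball hδ.le (fun w hw => ?_) ?_
  · refine (hk w hw).smul (hf.comp (differentiable_update_left i w).differentiableOn ?_)
    exact fun u hu => hsub (update_mem_closedBall hu (sphere_subset_closedBall hw))
  · refine hkc.smul (hf.continuousOn.comp (continuous_update_uncurry i).continuousOn ?_)
    exact fun p hp => hsub (update_mem_closedBall hp.2 (sphere_subset_closedBall hp.1))

lemma sub_ne_zero_of_mem_sphere {x u : ι → ℂ} {δ : ℝ} {i j : ι} (hij : x j = x i)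
    (hu : u ∈ ball x δ) {w : ℂ} (hw : w ∈ sphere (x i) δ) : w - u j ≠ 0 := by
  intro h
  rw [sub_eq_zero] at h
  have h1 := (dist_le_pi_dist u x j).trans_lt (mem_ball.1 hu)
  rw [hij, ← h, mem_sphere.1 hw] at h1
  exact lt_irrefl _ h1

lemma differentiableOn_slice {O : Set (ι → ℂ)} {f : (ι → ℂ) → ℂ} (hf : DifferentiableOn ℂ f O)
    (u : ι → ℂ) (i : ι) :
    DifferentiableOn ℂ (fun w => f (Function.update u i w)) {w | Function.update u i w ∈ O} :=
  hf.comp (differentiable_update u i).differentiableOn fun _ hw => hw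

lemma isOpen_slice {O : Set (ι → ℂ)} (hO : IsOpen O) (u : ι → ℂ) (i : ι) :
    IsOpen {w | Function.update u i w ∈ O} :=
  hO.preimage (differentiable_update u i).continuous

/-- Partial derivatives of holomorphic functions are holomorphic. -/
theorem differentiableOn_partialDeriv {O : Set (ι → ℂ)} (hO : IsOpen O) {f : (ι → ℂ) → ℂ}
    (hf : DifferentiableOn ℂ f O) (i : ι) : DifferentiableOn ℂ (partialDeriv i f) O := by
  intro x hx
  obtain ⟨δ₀, hδ₀, hball⟩ := Metric.isOpen_iff.1 hO x hx
  set δ := δ₀ / 2 with hδdef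
  have hδ : 0 < δ := by positivity
  have hsub : closedBall x δ ⊆ O := (closedBall_subset_ball (by linarith)).trans hball
  -- Cauchy's formula for the derivative in the `i`-th variable has a kernel holomorphic in all
  -- variables jointly, hence so is the integral.
  have hint := differentiableOn_circleIntegral_update hf (i := i) hδ hsub
    (k := fun w u => ((w - u i) ^ 2)⁻¹)
    (fun w hw => by
      refine DifferentiableOn.inv (by fun_prop) fun u hu => ?_
      exact pow_ne_zero 2 (sub_ne_zero_of_mem_sphere rfl hu hw))
    (by
      refine ContinuousOn.inv₀ (by fun_prop) fun p hp => ?_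
      exact pow_ne_zero 2 (sub_ne_zero_of_mem_sphere rfl hp.2 hp.1))
  refine (((hint.const_smul ((2 * Real.pi * Complex.I : ℂ)⁻¹)).congr fun u hu => ?_)
    |>.differentiableAt (ball_mem_nhds x hδ)).differentiableWithinAt
  have := Complex.two_pi_I_inv_smul_circleIntegral_sub_sq_inv_smul_of_differentiable
    (isOpen_slice hO u i) (c := x i) (R := δ) (w₀ := u i)
    (fun w hw => hsub (update_mem_closedBall hu hw))
    (differentiableOn_slice hf u i) ((dist_le_pi_dist u x i).trans_lt (mem_ball.1 hu))
  exact this.symm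

/-- The quotient of `h` by `u i - u j`, extended by the partial derivative to the hyperplane
`u i = u j`. -/
def quotSub (i j : ι) (h : (ι → ℂ) → ℂ) (u : ι → ℂ) : ℂ :=
  if u i = u j then partialDeriv i h u else h u / (u i - u j)

lemma sub_mul_quotSub {i j : ι} {h : (ι → ℂ) → ℂ} {u : ι → ℂ} (h0 : u i = u j → h u = 0) :
    (u i - u j) * quotSub i j h u = h u := by
  unfold quotSub
  split_ifs with hu
  · rw [h0 hu, hu, sub_self, zero_mul]
  · rw [mul_div_cancel₀ _ (sub_ne_zero.2 hu)]

/-- **Division theorem**: a holomorphic function vanishing on the hyperplane `u i = u j` is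
divisible by `u i - u j`. -/
theorem differentiableOn_quotSub {O : Set (ι → ℂ)} (hO : IsOpen O) {h : (ι → ℂ) → ℂ}
    (hh : DifferentiableOn ℂ h O) {i j : ι} (hij : i ≠ j)
    (h0 : ∀ u ∈ O, u i = u j → h u = 0) : DifferentiableOn ℂ (quotSub i j h) O := by
  intro x hx
  by_cases hxij : x i = x j
  swap
  · have hev : quotSub i j h =ᶠ[𝓝 x] fun u => h u / (u i - u j) := by
      have : ∀ᶠ u : ι → ℂ in 𝓝 x, u i - u j ≠ 0 :=
        ContinuousAt.eventually_ne (by fun_prop) (sub_ne_zero.2 hxij)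
      filter_upwards [this] with u hu
      simp [quotSub, sub_ne_zero.1 hu]
    refine DifferentiableAt.differentiableWithinAt (hev.differentiableAt_iff.2 ?_)
    simp only [div_eq_mul_inv]
    exact (hh.differentiableAt (hO.mem_nhds hx)).fun_mul
      (DifferentiableAt.fun_inv (by fun_prop) (sub_ne_zero.2 hxij))
  obtain ⟨δ₀, hδ₀, hball⟩ := Metric.isOpen_iff.1 hO x hx
  set δ := δ₀ / 2 with hδdef
  have hδ : 0 < δ := by positivity
  have hsub : closedBall x δ ⊆ O := (closedBall_subset_ball (by linarith)).trans hball
  -- One Cauchy integral, with kernel `1 / ((w - u_i)(w - u_j))`, represents the quotient both on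
  -- and off the hyperplane. Where `u_i = u_j` it is the formula for the derivative. Elsewhere
  -- partial fractions give `(h(u) - h(u with u_i replaced by u_j)) / (u_i - u_j)`, whose second
  -- term vanishes.
  have hint := differentiableOn_circleIntegral_update hh (i := i) hδ hsub
    (k := fun w u => ((w - u i) * (w - u j))⁻¹)
    (fun w hw => by
      refine DifferentiableOn.inv (by fun_prop) fun u hu => ?_
      exact mul_ne_zero (sub_ne_zero_of_mem_sphere rfl hu hw)
        (sub_ne_zero_of_mem_sphere hxij.symm hu hw))
    (by
      refine ContinuousOn.inv₀ (by fun_prop) fun p hp => ?_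
      exact mul_ne_zero (sub_ne_zero_of_mem_sphere rfl hp.2 hp.1)
        (sub_ne_zero_of_mem_sphere hxij.symm hp.2 hp.1))
  refine (((hint.const_smul ((2 * Real.pi * Complex.I : ℂ)⁻¹)).congr fun u hu => ?_)
    |>.differentiableAt (ball_mem_nhds x hδ)).differentiableWithinAt
  have hui : u i ∈ ball (x i) δ := (dist_le_pi_dist u x i).trans_lt (mem_ball.1 hu)
  have huj : u j ∈ ball (x i) δ := by
    rw [hxij]; exact (dist_le_pi_dist u x j).trans_lt (mem_ball.1 hu)
  have hslice : closedBall (x i) δ ⊆ {w | Function.update u i w ∈ O} :=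
    fun w hw => hsub (update_mem_closedBall hu hw)
  have hd := differentiableOn_slice hh u i
  unfold quotSub
  split_ifs with huij
  · have := Complex.two_pi_I_inv_smul_circleIntegral_sub_sq_inv_smul_of_differentiable
      (isOpen_slice hO u i) hslice hd hui
    rw [partialDeriv, ← this]
    simp only [Pi.smul_apply, ← huij, sq]
  · have hcl : DiffContOnCl ℂ (fun w => h (Function.update u i w)) (ball (x i) δ) :=
      hd.diffContOnCl_ball hslice
    have e1 := hcl.two_pi_i_inv_smul_circleIntegral_sub_inv_smul hui
    have e2 := hcl.two_pi_i_inv_smul_circleIntegral_sub_inv_smul huj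
    have hz : h (Function.update u i (u j)) = 0 := by
      refine h0 _ (hslice (ball_subset_closedBall huj)) ?_
      simp [hij.symm]
    rw [hz] at e2
    rw [Function.update_eq_self] at e1
    have hci : ∀ a ∈ ball (x i) δ, CircleIntegrable
        (fun w => (w - a)⁻¹ • h (Function.update u i w)) (x i) δ := by
      intro a ha
      refine ContinuousOn.circleIntegrable hδ.le (ContinuousOn.fun_smul ?_ ?_)
      · refine ContinuousOn.inv₀ (by fun_prop) fun w hw hwa => ?_
        rw [sub_eq_zero] at hwa
        rw [mem_ball, ← hwa, mem_sphere.1 hw] at ha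
        exact lt_irrefl _ ha
      · exact hd.continuousOn.mono (sphere_subset_closedBall.trans hslice)
    have hne : u i - u j ≠ 0 := sub_ne_zero.2 huij
    have e3 : (∮ w in C(x i, δ), ((w - u i) * (w - u j))⁻¹ • h (Function.update u i w)) =
        (u i - u j)⁻¹ • ((∮ w in C(x i, δ), (w - u i)⁻¹ • h (Function.update u i w)) -
          ∮ w in C(x i, δ), (w - u j)⁻¹ • h (Function.update u i w)) := by
      rw [← circleIntegral.integral_sub (hci _ hui) (hci _ huj), ← circleIntegral.integral_smul]
      refine circleIntegral.integral_congr hδ.le fun w hw => ?_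
      have n1 := sub_ne_zero_of_mem_sphere (i := i) rfl hu hw
      have n2 := sub_ne_zero_of_mem_sphere hxij.symm hu hw
      simp only [smul_eq_mul]
      field_simp
      ring
    simp only [Pi.smul_apply]
    rw [e3, smul_comm, smul_sub, e1, e2, sub_zero, smul_eq_mul, div_eq_inv_mul]

end ComplexAnalysis

/-! ### Divided differences in several variables: extension across diagonals, bounds, values at
coinciding points. -/

section DividedDifferences

open Metric Set

set_option linter.unusedSectionVars false

variable {ι : Type*} [Fintype ι] [DecidableEq ι]

/-- Points with pairwise distinct coordinates are reached along generic lines. -/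
lemma eventually_add_smul_ne (x c : ι → ℂ) :
    ∀ᶠ t : ℂ in 𝓝[≠] 0, ∀ i j, c i ≠ c j → (x + t • c) i ≠ (x + t • c) j := by
  simp only [eventually_all]
  intro i j hc
  by_cases hx : x i = x j
  · filter_upwards [self_mem_nhdsWithin] with t ht h
    simp only [Pi.add_apply, Pi.smul_apply, smul_eq_mul, hx, add_right_inj] at h
    exact hc (mul_left_cancel₀ ht h)
  · have h1 : ContinuousAt (fun t : ℂ => (x + t • c) i) 0 := by
      simp only [Pi.add_apply, Pi.smul_apply, smul_eq_mul]; fun_prop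
    have h2 : ContinuousAt (fun t : ℂ => (x + t • c) j) 0 := by
      simp only [Pi.add_apply, Pi.smul_apply, smul_eq_mul]; fun_prop
    have h3 := (h1.sub h2).eventually_ne (y := 0) (by simpa [sub_eq_zero] using hx)
    filter_upwards [nhdsWithin_le_nhds h3] with t ht
    exact sub_ne_zero.1 ht

/-- Equally spaced coordinates in the unit interval serve. The uniform gap `s` is what later makes
bounds on divided differences quantitative; the bound by `1` keeps the line inside the ball. -/
lemma exists_injective_direction (ι : Type*) [Fintype ι] :
    ∃ (c : ι → ℂ) (s : ℝ), 0 < s ∧ (∀ i, ‖c i‖ ≤ 1) ∧ ∀ i j, i ≠ j → s ≤ ‖c i - c j‖ := by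
  set N := Fintype.card ι
  let e := Fintype.equivFin ι
  have hN : (0 : ℝ) < N + 1 := by positivity
  have hnorm : ‖((N : ℂ) + 1)‖ = N + 1 := by
    rw [← Nat.cast_one, ← Nat.cast_add, Complex.norm_natCast]; push_cast; rfl
  refine ⟨fun i => ((e i : ℕ) : ℂ) / (N + 1), 1 / (N + 1), by positivity, fun i => ?_,
    fun i j hij => ?_⟩
  · rw [norm_div, hnorm, Complex.norm_natCast, div_le_one hN]
    have : ((e i : ℕ) : ℝ) ≤ N := by exact_mod_cast (e i).2.le
    linarith
  · rw [← sub_div, norm_div, hnorm]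
    gcongr
    have h : ((e i : ℕ) : ℤ) - (e j : ℕ) ≠ 0 := by
      intro h
      apply hij
      apply e.injective
      apply Fin.ext
      omega
    have h2 : ((e i : ℕ) : ℂ) - ((e j : ℕ) : ℂ) = (((e i : ℕ) : ℤ) - (e j : ℕ) : ℤ) := by
      push_cast; rfl
    rw [h2, Complex.norm_intCast]
    exact_mod_cast Int.one_le_abs h

/-- Two continuous functions agreeing on a set which is reached along a generic line agree. -/
lemma eqOn_of_eq_along_line {O P : Set (ι → ℂ)} (hO : IsOpen O) {f g : (ι → ℂ) → ℂ}
    (c : ι → ℂ) {x : ι → ℂ} (hx : x ∈ O) (hf : ContinuousOn f O) (hg : ContinuousOn g O)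
    (hP : ∀ᶠ t : ℂ in 𝓝[≠] 0, x + t • c ∈ P) (hfg : ∀ u ∈ O, u ∈ P → f u = g u) :
    f x = g x := by
  have hline : Tendsto (fun t : ℂ => x + t • c) (𝓝[≠] 0) (𝓝 x) := by
    have : ContinuousAt (fun t : ℂ => x + t • c) 0 := by fun_prop
    have h := this.tendsto
    simp only [zero_smul, add_zero] at h
    exact h.mono_left nhdsWithin_le_nhds
  have h1 := (hf.continuousAt (hO.mem_nhds hx)).tendsto.comp hline
  have h2 := (hg.continuousAt (hO.mem_nhds hx)).tendsto.comp hline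
  refine tendsto_nhds_unique_of_eventuallyEq h1 h2 ?_
  filter_upwards [hP, hline.eventually (hO.mem_nhds hx)] with t ht1 ht2
  exact hfg _ ht2 ht1

/-- Points with distinct coordinates over `A` are dense. All identities between extended divided
differences are checked at such points and transferred by this lemma. -/
lemma eqOn_of_eq_of_injOn {O : Set (ι → ℂ)} (hO : IsOpen O) {f g : (ι → ℂ) → ℂ}
    (A : Finset ι) (hf : ContinuousOn f O) (hg : ContinuousOn g O)
    (hfg : ∀ u ∈ O, InjOn u A → f u = g u) : EqOn f g O := by
  intro x hx
  obtain ⟨c, s, hs, -, hc⟩ := exists_injective_direction ι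
  refine eqOn_of_eq_along_line (P := {u : ι → ℂ | InjOn u (A : Set ι)}) hO c hx hf hg ?_
    fun u hu hP => hfg u hu hP
  filter_upwards [eventually_add_smul_ne x c] with t ht i _ j _ hij
  by_contra hne
  refine ht i j (fun h => ?_) hij
  have := hc i j hne
  rw [h, sub_self, norm_zero] at this
  linarith

/-- The divided difference `∑_{i ∈ A} g_i(u) / ∏_{j ∈ A, j ≠ i} (u_i - u_j)` of a family of
functions. -/
def divDiff (A : Finset ι) (g : ι → (ι → ℂ) → ℂ) (u : ι → ℂ) : ℂ :=
  ∑ i ∈ A, Lagrange.nodalWeight A u i * g i u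

lemma sub_mul_nodalWeight {A : Finset ι} {u : ι → ℂ} {b i : ι} (hb : b ∈ A) (hib : i ≠ b)
    (hu : u i ≠ u b) :
    (u i - u b) * Lagrange.nodalWeight A u i = Lagrange.nodalWeight (A.erase b) u i := by
  unfold Lagrange.nodalWeight
  have h : b ∈ A.erase i := Finset.mem_erase.2 ⟨hib.symm, hb⟩
  rw [← Finset.mul_prod_erase _ _ h, ← mul_assoc, mul_inv_cancel₀ (sub_ne_zero.2 hu), one_mul,
    Finset.erase_right_comm]

lemma divDiff_erase {A : Finset ι} (g : ι → (ι → ℂ) → ℂ) {u : ι → ℂ} (hu : InjOn u A) {b : ι}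
    (hb : b ∈ A) :
    divDiff (A.erase b) g u = ∑ i ∈ A, (u i - u b) * Lagrange.nodalWeight A u i * g i u := by
  rw [divDiff, ← Finset.sum_erase A (a := b) (by simp)]
  refine Finset.sum_congr rfl fun i hi => ?_
  obtain ⟨hib, hi⟩ := Finset.mem_erase.1 hi
  rw [sub_mul_nodalWeight hb hib fun h => hib (hu hi hb h)]

/-- The recursion for divided differences. -/
lemma sub_mul_divDiff {A : Finset ι} (g : ι → (ι → ℂ) → ℂ) {u : ι → ℂ} (hu : InjOn u A) {a b : ι}
    (ha : a ∈ A) (hb : b ∈ A) :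
    (u a - u b) * divDiff A g u = divDiff (A.erase b) g u - divDiff (A.erase a) g u := by
  rw [divDiff_erase g hu ha, divDiff_erase g hu hb, ← Finset.sum_sub_distrib, divDiff,
    Finset.mul_sum]
  exact Finset.sum_congr rfl fun i _ => by ring

lemma divDiff_map {κ : Type*} [DecidableEq κ] (e : κ ↪ ι) (A : Finset κ)
    (g : ι → (ι → ℂ) → ℂ) (u : ι → ℂ) :
    divDiff (A.map e) g u = ∑ i ∈ A, Lagrange.nodalWeight A (u ∘ e) i * g (e i) u := by
  rw [divDiff, Finset.sum_map]
  refine Finset.sum_congr rfl fun i _ => ?_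
  rw [Lagrange.nodalWeight, ← Finset.map_erase, Finset.prod_map]
  rfl

/-- A family `g` indexed by the variables is equivariant on `O` if exchanging two variables
exchanges the corresponding functions. -/
def Equivariant (O : Set (ι → ℂ)) (g : ι → (ι → ℂ) → ℂ) : Prop :=
  ∀ a b c, ∀ u ∈ O, g (Equiv.swap a b c) (u ∘ Equiv.swap a b) = g c u

/-- The transposition of `a` and `b` carries `A \ {a}` to `A \ {b}`. So the two terms in the
recursion for divided differences agree where `u_a = u_b`, which is what permits the division. -/
lemma Equivariant.divDiff_erase {O : Set (ι → ℂ)} {g : ι → (ι → ℂ) → ℂ} (hg : Equivariant O g)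
    {A : Finset ι} {a b : ι} (ha : a ∈ A) (hb : b ∈ A) {u : ι → ℂ} (hu : u ∈ O) :
    divDiff (A.erase b) g (u ∘ Equiv.swap a b) = divDiff (A.erase a) g u := by
  have h : A.erase b = (A.erase a).map (Equiv.swap a b).toEmbedding := by
    ext i
    simp only [Finset.mem_erase, Finset.mem_map_equiv, Equiv.symm_swap]
    rcases eq_or_ne i a with rfl | hia
    · rw [Equiv.swap_apply_left]; simp [ha, hb, eq_comm]
    rcases eq_or_ne i b with rfl | hib
    · simp
    · simp [Equiv.swap_apply_of_ne_of_ne hia hib, hia, hib]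
  rw [h, divDiff_map, divDiff]
  refine Finset.sum_congr rfl fun i _ => ?_
  congr 1
  · congr 1
    funext j
    exact congrArg u (Equiv.swap_apply_self a b j)
  · exact hg a b i u hu

/-- `e` is a holomorphic extension to `O` of the divided difference of `g` over `A`. -/
structure IsDivDiffExt (O : Set (ι → ℂ)) (A : Finset ι) (g : ι → (ι → ℂ) → ℂ)
    (e : (ι → ℂ) → ℂ) : Prop where
  differentiableOn : DifferentiableOn ℂ e O
  eq_divDiff : ∀ u ∈ O, InjOn u A → e u = divDiff A g u

lemma IsDivDiffExt.eqOn {O : Set (ι → ℂ)} (hO : IsOpen O) {A : Finset ι} {g : ι → (ι → ℂ) → ℂ}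
    {e e' : (ι → ℂ) → ℂ} (h : IsDivDiffExt O A g e) (h' : IsDivDiffExt O A g e') :
    EqOn e e' O :=
  eqOn_of_eq_of_injOn hO A h.differentiableOn.continuousOn h'.differentiableOn.continuousOn
    fun u hu hi => (h.eq_divDiff u hu hi).trans (h'.eq_divDiff u hu hi).symm

lemma IsDivDiffExt.mono {O O' : Set (ι → ℂ)} (hO : O' ⊆ O) {A : Finset ι}
    {g : ι → (ι → ℂ) → ℂ} {e : (ι → ℂ) → ℂ} (h : IsDivDiffExt O A g e) :
    IsDivDiffExt O' A g e :=
  ⟨h.differentiableOn.mono hO, fun u hu => h.eq_divDiff u (hO hu)⟩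

/-- Divided differences of equivariant families of holomorphic functions extend holomorphically
across the diagonals. -/
theorem exists_isDivDiffExt {O : Set (ι → ℂ)} (hO : IsOpen O)
    (hsymm : ∀ a b, ∀ u ∈ O, u ∘ Equiv.swap a b ∈ O) {g : ι → (ι → ℂ) → ℂ}
    (hg : ∀ i, DifferentiableOn ℂ (g i) O) (heq : Equivariant O g) (A : Finset ι) :
    ∃ e, IsDivDiffExt O A g e := by
  induction A using Finset.strongInduction with
  | H A ih =>
    by_cases hA : ∃ a ∈ A, ∃ b ∈ A, a ≠ b
    · obtain ⟨a, ha, b, hb, hab⟩ := hA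
      obtain ⟨ea, hea⟩ := ih _ (Finset.erase_ssubset ha)
      obtain ⟨eb, heb⟩ := ih _ (Finset.erase_ssubset hb)
      have hinj : ∀ {u : ι → ℂ} {c : ι}, InjOn u A → InjOn u (A.erase c) := fun h =>
        h.mono (Finset.coe_subset.2 (Finset.erase_subset _ _))
      have hswap : DifferentiableOn ℂ (fun u => eb (u ∘ Equiv.swap a b)) O := by
        refine heb.differentiableOn.comp (Differentiable.differentiableOn ?_)
          fun u hu => hsymm a b u hu
        rw [differentiable_pi]
        exact fun i => differentiable_apply _
      -- The exchange symmetry, known at injective points, passes to the extensions by density. On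
      -- `u_a = u_b` the transposition fixes `u`, so the numerator `eb - ea` of the recursion
      -- vanishes there.
      have hE : EqOn (fun u => eb (u ∘ Equiv.swap a b)) ea O := by
        refine eqOn_of_eq_of_injOn hO Finset.univ hswap.continuousOn
          hea.differentiableOn.continuousOn fun u hu hi => ?_
        rw [Finset.coe_univ, injOn_univ] at hi
        rw [heb.eq_divDiff _ (hsymm a b u hu) (hi.comp (Equiv.injective _)).injOn,
          hea.eq_divDiff _ hu hi.injOn, heq.divDiff_erase ha hb hu]
      have hvan : ∀ u ∈ O, u a = u b → eb u - ea u = 0 := by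
        intro u hu huab
        have : u ∘ Equiv.swap a b = u := by
          ext i
          rw [Function.comp_apply, Equiv.swap_apply_def]
          split_ifs with h1 h2
          · rw [h1, huab]
          · rw [h2, huab]
          · rfl
        have h := hE hu
        simp only [this] at h
        rw [h, sub_self]
      refine ⟨quotSub a b (fun u => eb u - ea u), ?_, fun u hu hi => ?_⟩
      · exact differentiableOn_quotSub hO (heb.differentiableOn.sub hea.differentiableOn) hab hvan
      · have hne : u a - u b ≠ 0 := sub_ne_zero.2 fun h => hab (hi ha hb h)
        refine mul_left_cancel₀ hne ?_
        rw [sub_mul_quotSub (hvan u hu), sub_mul_divDiff g hi ha hb,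
          hea.eq_divDiff u hu (hinj hi), heb.eq_divDiff u hu (hinj hi)]
    -- Base case: `A` has at most one element, so all nodal weights are empty products.
    · push Not at hA
      refine ⟨divDiff A g, ?_, fun _ _ _ => rfl⟩
      unfold divDiff
      refine DifferentiableOn.fun_sum fun i hi => ?_
      have : A.erase i = ∅ := by
        ext j
        simp only [Finset.mem_erase, Finset.notMem_empty, iff_false, not_and]
        exact fun hj hjA => hj (hA j hjA i hi)
      simp only [Lagrange.nodalWeight, this, Finset.prod_empty, one_mul]
      exact hg i

lemma norm_nodalWeight_le {A : Finset ι} {u : ι → ℂ} {i : ι} {s : ℝ} (hs : 0 < s)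
    (h : ∀ j, i ≠ j → s ≤ ‖u i - u j‖) :
    ‖Lagrange.nodalWeight A u i‖ ≤ (max 1 s⁻¹) ^ Fintype.card ι := by
  unfold Lagrange.nodalWeight
  rw [norm_prod]
  calc ∏ j ∈ A.erase i, ‖(u i - u j)⁻¹‖ ≤ ∏ j ∈ A.erase i, max 1 s⁻¹ := by
        refine Finset.prod_le_prod (fun _ _ => norm_nonneg _) fun j hj => ?_
        rw [norm_inv]
        exact le_max_of_le_right (inv_anti₀ hs (h j (Finset.ne_of_mem_erase hj).symm))
    _ = (max 1 s⁻¹) ^ (A.erase i).card := by rw [Finset.prod_const]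
    _ ≤ _ := pow_le_pow_right₀ (le_max_left _ _) (Finset.card_le_univ _)

/-- Extended divided differences are bounded on a smaller ball in terms of the given functions. -/
theorem exists_norm_divDiffExt_le (ι : Type*) [Fintype ι] [DecidableEq ι] {r : ℝ} (hr : 0 < r) :
    ∃ r' C : ℝ, 0 < r' ∧ r' ≤ r ∧ 0 ≤ C ∧ ∀ (A : Finset ι) (g : ι → (ι → ℂ) → ℂ)
      (e : (ι → ℂ) → ℂ) (M : ℝ), 0 ≤ M → IsDivDiffExt (ball 1 r) A g e →
      (∀ i ∈ A, ∀ u ∈ ball (1 : ι → ℂ) r, ‖g i u‖ ≤ M) → ∀ u ∈ ball (1 : ι → ℂ) r',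
        ‖e u‖ ≤ C * M := by
  obtain ⟨c, s, hs, hc1, hc⟩ := exists_injective_direction ι
  -- On the circle `|z| = r / 2` the coordinates of `u + z c` are at distance at least `rs/2 - 2‖u -
  -- 1‖`, which is at least `σ` when `‖u - 1‖ < sr/8`.
  set σ := s * r / 4 with hσ
  have hσ0 : 0 < σ := by positivity
  set B := (max 1 σ⁻¹) ^ Fintype.card ι
  refine ⟨min (r / 4) (s * r / 8), Fintype.card ι * B, by positivity,
    (min_le_left _ _).trans (by linarith), by positivity, ?_⟩
  intro A g e M hM0 he hM u hu
  have hu1 : ‖u - 1‖ < r / 4 := (mem_ball_iff_norm.1 hu).trans_le (min_le_left _ _)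
  have hu2 : ‖u - 1‖ < s * r / 8 := (mem_ball_iff_norm.1 hu).trans_le (min_le_right _ _)
  have hcn : ‖c‖ ≤ 1 := (pi_norm_le_iff_of_nonneg zero_le_one).2 hc1
  have hmem : ∀ z : ℂ, ‖z‖ ≤ r / 2 → u + z • c ∈ ball (1 : ι → ℂ) r := by
    intro z hz
    rw [mem_ball_iff_norm]
    calc ‖u + z • c - 1‖ = ‖(u - 1) + z • c‖ := by congr 1; abel
      _ ≤ ‖u - 1‖ + ‖z‖ * ‖c‖ := (norm_add_le _ _).trans (by rw [norm_smul])
      _ ≤ ‖u - 1‖ + r / 2 * 1 := by gcongr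
      _ < r := by linarith
  have hline : DiffContOnCl ℂ (fun z : ℂ => e (u + z • c)) (ball 0 (r / 2)) := by
    refine DifferentiableOn.diffContOnCl ?_
    rw [closure_ball _ (by positivity)]
    refine he.differentiableOn.comp (by fun_prop) fun z hz => hmem z ?_
    simpa using hz
  -- The maximum principle on a complex line through `u`: on the boundary circle the nodes are
  -- separated, so the explicit formula bounds `e`.
  have h0 : ‖e (u + (0 : ℂ) • c)‖ ≤ Fintype.card ι * B * M := by
    refine Complex.norm_le_of_forall_mem_frontier_norm_le isBounded_ball hline (z := 0)
      (fun z hz => ?_) (subset_closure (mem_ball_self (by positivity)))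
    rw [frontier_ball _ (by positivity), mem_sphere_zero_iff_norm] at hz
    have hsep : ∀ i j, i ≠ j → σ ≤ ‖(u + z • c) i - (u + z • c) j‖ := by
      intro i j hij
      have e1 : (u + z • c) i - (u + z • c) j
          = z * (c i - c j) - (((u - 1) j) - ((u - 1) i)) := by
        simp only [Pi.add_apply, Pi.smul_apply, smul_eq_mul, Pi.sub_apply, Pi.one_apply]; ring
      rw [e1]
      have e2 : ‖z * (c i - c j)‖ ≥ r / 2 * s := by
        rw [norm_mul, hz]
        gcongr
        exact hc i j hij
      have e3 : ‖(u - 1) j - (u - 1) i‖ ≤ 2 * ‖u - 1‖ := by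
        calc _ ≤ ‖(u - 1) j‖ + ‖(u - 1) i‖ := norm_sub_le _ _
          _ ≤ _ := by linarith [norm_le_pi_norm (u - 1) i, norm_le_pi_norm (u - 1) j]
      have e4 := norm_sub_norm_le (z * (c i - c j)) ((u - 1) j - (u - 1) i)
      rw [hσ]
      nlinarith
    have hinj : InjOn (u + z • c) A := by
      intro i _ j _ hij
      by_contra hne
      have := hsep i j hne
      rw [hij, sub_self, norm_zero] at this
      linarith
    have hz' : u + z • c ∈ ball (1 : ι → ℂ) r := hmem z hz.le
    rw [he.eq_divDiff _ hz' hinj, divDiff]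
    calc ‖∑ i ∈ A, Lagrange.nodalWeight A (u + z • c) i * g i (u + z • c)‖
        ≤ ∑ i ∈ A, B * M := by
          refine norm_sum_le_of_le _ fun i hi => ?_
          rw [norm_mul]
          exact mul_le_mul (norm_nodalWeight_le hσ0 (hsep i)) (hM i hi _ hz') (norm_nonneg _)
            (by positivity)
      _ = A.card * (B * M) := by rw [Finset.sum_const, nsmul_eq_mul]
      _ ≤ Fintype.card ι * (B * M) := by
          gcongr
          exact Finset.card_le_univ A
      _ = _ := by ring
  simpa using h0

/-- The sum is the coefficient of degree `l` of the polynomial interpolating `X ^ d` at the `l + 1`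
nodes, which is `X ^ d` itself. -/
lemma sum_nodalWeight_mul_pow {A : Finset ι} {c : ι → ℂ} (hc : InjOn c A) {l d : ℕ}
    (hA : A.card = l + 1) (hd : d ≤ l) :
    ∑ i ∈ A, Lagrange.nodalWeight A c i * c i ^ d = if d = l then 1 else 0 := by
  have h := Lagrange.coeff_eq_sum hc (P := Polynomial.X ^ d) (by
    rw [Polynomial.degree_X_pow, hA]; exact_mod_cast Nat.lt_succ_of_le hd)
  rw [hA, Nat.add_sub_cancel, Polynomial.coeff_X_pow] at h
  rw [show (if d = l then (1 : ℂ) else 0) = if l = d then 1 else 0 by simp [eq_comm], h]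
  refine Finset.sum_congr rfl fun i _ => ?_
  rw [Lagrange.nodalWeight, Finset.prod_inv_distrib, Polynomial.eval_pow, Polynomial.eval_X,
    div_eq_inv_mul]

/-- At a point whose coordinates over `A` all equal `1`, the extended divided difference of a
function of one variable is its Taylor coefficient. -/
theorem divDiffExt_eq_iteratedDeriv {r : ℝ} {q : ℂ → ℂ} (hq : AnalyticAt ℂ q 1)
    {A : Finset ι} {l : ℕ} (hA : A.card = l + 1) {e : (ι → ℂ) → ℂ}
    (he : IsDivDiffExt (ball 1 r) A (fun i u => q (u i)) e) {y : ι → ℂ} (hy : y ∈ ball 1 r)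
    (hy1 : ∀ a ∈ A, y a = 1) : e y = iteratedDeriv l q 1 / l.factorial := by
  obtain ⟨c, s, hs, hc1, hc⟩ := exists_injective_direction ι
  have hinj : InjOn c A := by
    intro i _ j _ hij
    by_contra hne
    have := hc i j hne
    rw [hij, sub_self, norm_zero] at this
    linarith
  have hline : Tendsto (fun t : ℂ => y + t • c) (𝓝[≠] 0) (𝓝 y) := by
    have : ContinuousAt (fun t : ℂ => y + t • c) 0 := by fun_prop
    have h := this.tendsto
    simp only [zero_smul, add_zero] at h
    exact h.mono_left nhdsWithin_le_nhds
  have h1 := (he.differentiableOn.continuousOn.continuousAt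
    (isOpen_ball.mem_nhds hy)).tendsto.comp hline
  set p : ℕ → ℂ := fun n => iteratedDeriv n q 1 / n.factorial with hp
  have hR := hq.hasFPowerSeriesAt.isBigO_sub_partialSum_pow (l + 1)
  have hpart : ∀ x : ℂ, (FormalMultilinearSeries.ofScalars ℂ
      (fun n => iteratedDeriv n q 1 / n.factorial)).partialSum (l + 1) x =
        ∑ d ∈ Finset.range (l + 1), p d * x ^ d := by
    intro x
    simp [FormalMultilinearSeries.partialSum, hp, mul_comm]
  -- Approach `y` along `y + z c`. The Taylor remainder of order `l + 1` beats the factor `z ^ (-l)`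
  -- of the nodal weights.
  have h2 : ∀ i ∈ A, Tendsto (fun z : ℂ => (z ^ l)⁻¹ * (q (1 + z * c i) -
      ∑ d ∈ Finset.range (l + 1), p d * (z * c i) ^ d)) (𝓝[≠] 0) (𝓝 0) := by
    intro i _
    have hz : Tendsto (fun z : ℂ => z * c i) (𝓝[≠] 0) (𝓝 0) := by
      have : ContinuousAt (fun z : ℂ => z * c i) 0 := by fun_prop
      have h := this.tendsto
      rw [zero_mul] at h
      exact h.mono_left nhdsWithin_le_nhds
    have hO := hR.comp_tendsto hz
    have hO2 : (fun z : ℂ => (z ^ l)⁻¹ * (q (1 + z * c i) -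
        ∑ d ∈ Finset.range (l + 1), p d * (z * c i) ^ d)) =O[𝓝[≠] 0] fun z : ℂ => ‖z‖ := by
      have hO' := hO.trans (k := fun z : ℂ => (z * c i) ^ (l + 1))
        (Asymptotics.isBigO_of_le _ fun z => by simp [mul_pow])
      have hO3 := (Asymptotics.isBigO_refl (fun z : ℂ => (z ^ l)⁻¹) (𝓝[≠] 0)).mul hO'
      refine (hO3.congr_left fun z => ?_).trans ?_
      · simp only [Function.comp, hpart]
      · refine Asymptotics.IsBigO.of_bound (‖c i‖ ^ (l + 1)) ?_
        filter_upwards [self_mem_nhdsWithin] with z hz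
        have hz0 : ‖z‖ ≠ 0 := norm_ne_zero_iff.2 hz
        simp only [norm_mul, norm_inv, norm_pow, norm_norm]
        rw [mul_pow, pow_succ ‖z‖]
        field_simp
        exact le_rfl
    have h0 : Tendsto (fun z : ℂ => ‖z‖) (𝓝[≠] 0) (𝓝 0) := by
      have := (continuous_norm (E := ℂ)).tendsto 0
      rw [norm_zero] at this
      exact this.mono_left nhdsWithin_le_nhds
    exact hO2.trans_tendsto h0
  have h3 : Tendsto (fun z : ℂ => ∑ i ∈ A, Lagrange.nodalWeight A c i * ((z ^ l)⁻¹ *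
      (q (1 + z * c i) - ∑ d ∈ Finset.range (l + 1), p d * (z * c i) ^ d)) + p l)
      (𝓝[≠] 0) (𝓝 (p l)) := by
    have := tendsto_finsetSum A fun i hi => (h2 i hi).const_mul (Lagrange.nodalWeight A c i)
    simpa using this.add_const (p l)
  refine tendsto_nhds_unique_of_eventuallyEq h1 h3 ?_
  filter_upwards [self_mem_nhdsWithin, hline.eventually (isOpen_ball.mem_nhds hy),
    eventually_add_smul_ne y c] with z hz hzb hzne
  have hz0 : z ≠ 0 := hz
  have hinj' : InjOn (y + z • c) A := fun i hi j hj hij => by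
    by_contra hne
    exact hzne i j (fun h => hne (hinj hi hj h)) hij
  -- As `y` is constant over `A`, differences of coordinates are `z (c_i - c_j)`, and each weight
  -- has `l` such factors. Against these weights the Taylor polynomial contributes only its term of
  -- degree `l`.
  have hnw : ∀ i ∈ A, Lagrange.nodalWeight A (y + z • c) i =
      (z ^ l)⁻¹ * Lagrange.nodalWeight A c i := by
    intro i hi
    have hcard : (A.erase i).card = l := by rw [Finset.card_erase_of_mem hi, hA]; rfl
    rw [Lagrange.nodalWeight, Lagrange.nodalWeight, ← hcard, ← inv_pow, ← Finset.prod_const,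
      ← Finset.prod_mul_distrib]
    refine Finset.prod_congr rfl fun j hj => ?_
    rw [← mul_inv]
    congr 1
    simp only [Pi.add_apply, Pi.smul_apply, smul_eq_mul, hy1 i hi,
      hy1 j (Finset.mem_of_mem_erase hj)]
    ring
  rw [Function.comp_apply, he.eq_divDiff _ hzb hinj', divDiff]
  have h4 : ∑ i ∈ A, Lagrange.nodalWeight A c i *
      ((z ^ l)⁻¹ * ∑ d ∈ Finset.range (l + 1), p d * (z * c i) ^ d) = p l := by
    calc _ = ∑ d ∈ Finset.range (l + 1), p d * ((z ^ l)⁻¹ * z ^ d) *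
          ∑ i ∈ A, Lagrange.nodalWeight A c i * c i ^ d := by
          simp only [Finset.mul_sum]
          rw [Finset.sum_comm]
          refine Finset.sum_congr rfl fun d _ => Finset.sum_congr rfl fun i _ => ?_
          rw [mul_pow]; ring
      _ = ∑ d ∈ Finset.range (l + 1), if d = l then p l else 0 := by
          refine Finset.sum_congr rfl fun d hd => ?_
          rw [sum_nodalWeight_mul_pow hinj hA (Nat.lt_succ_iff.1 (Finset.mem_range.1 hd))]
          split_ifs with h
          · rw [h, inv_mul_cancel₀ (pow_ne_zero _ hz0)]; ring
          · ring
      _ = p l := by simp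
  rw [show ∀ x : ℂ, x + p l = x + ∑ i ∈ A, Lagrange.nodalWeight A c i *
    ((z ^ l)⁻¹ * ∑ d ∈ Finset.range (l + 1), p d * (z * c i) ^ d) from fun x => by rw [h4],
    ← Finset.sum_add_distrib]
  refine Finset.sum_congr rfl fun i hi => ?_
  rw [hnw i hi]
  simp only [Pi.add_apply, Pi.smul_apply, smul_eq_mul, hy1 i hi]
  ring

/-- The identity theorem on balls. -/
theorem eqOn_ball_of_eventuallyEq {r : ℝ} {f g : (ι → ℂ) → ℂ}
    (hf : DifferentiableOn ℂ f (ball 1 r)) (hg : DifferentiableOn ℂ g (ball 1 r))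
    (hfg : f =ᶠ[𝓝 1] g) : EqOn f g (ball 1 r) := by
  intro u hu
  -- On the complex line through `1` and `u` the ball cuts out a convex set, so the one-variable
  -- identity theorem applies.
  let φ : ℂ → ι → ℂ := fun z => 1 + z • (u - 1)
  have hφ : Differentiable ℂ φ := by fun_prop
  have h0 : φ 0 = 1 := by simp [φ]
  have h1 : φ 1 = u := by simp [φ]
  have hD : IsOpen (φ ⁻¹' ball 1 r) := isOpen_ball.preimage hφ.continuous
  have hconn : IsPreconnected (φ ⁻¹' ball (1 : ι → ℂ) r) := by
    have : φ ⁻¹' ball (1 : ι → ℂ) r = {z : ℂ | ‖z‖ * ‖u - 1‖ < r} := by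
      ext z
      simp [φ, norm_smul]
    rw [this]
    refine Convex.isPreconnected (s := {z : ℂ | ‖z‖ * ‖u - 1‖ < r}) ?_
    have hconv : ConvexOn ℝ univ fun z : ℂ => ‖u - 1‖ * ‖z‖ :=
      (convexOn_univ_norm (E := ℂ)).smul (norm_nonneg (u - 1))
    have := hconv.convex_lt r
    simpa [mul_comm] using this
  have hr : 0 < r := pos_of_mem_ball hu
  have key := AnalyticOnNhd.eqOn_of_preconnected_of_eventuallyEq
    ((hf.comp hφ.differentiableOn (mapsTo_preimage φ _)).analyticOnNhd hD)
    ((hg.comp hφ.differentiableOn (mapsTo_preimage φ _)).analyticOnNhd hD) hconn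
    (z₀ := 0) (by rw [mem_preimage, h0]; exact mem_ball_self hr)
    ((hφ.continuous.tendsto 0).eventually (p := fun v => f v = g v) (by rw [h0]; exact hfg))
  have := key (x := 1) (by rwa [mem_preimage, h1])
  simpa [h1] using this

/-- Cauchy's estimate for partial derivatives. -/
lemma norm_partialDeriv_le {f : (ι → ℂ) → ℂ} {u : ι → ℂ} {δ M : ℝ} (hδ : 0 < δ)
    (hf : DifferentiableOn ℂ f (ball u δ)) (hM : ∀ v ∈ ball u δ, ‖f v‖ ≤ M) (i : ι) :
    ‖partialDeriv i f u‖ ≤ M / (δ / 2) := by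
  have hmem : ∀ w ∈ closedBall (u i) (δ / 2), Function.update u i w ∈ ball u δ := fun w hw =>
    closedBall_subset_ball (by linarith)
      (update_mem_closedBall (mem_ball_self (by positivity : 0 < δ / 2)) hw)
  refine Complex.norm_deriv_le_of_forall_mem_sphere_norm_le (by positivity) ?_ fun w hw =>
    hM _ (hmem w (sphere_subset_closedBall hw))
  refine DifferentiableOn.diffContOnCl ?_
  rw [closure_ball _ (by positivity)]
  exact (differentiableOn_slice hf u i).mono hmem

lemma differentiableOn_iterate_partialDeriv {O : Set (ι → ℂ)} (hO : IsOpen O)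
    {f : (ι → ℂ) → ℂ} (hf : DifferentiableOn ℂ f O) (i : ι) (m : ℕ) :
    DifferentiableOn ℂ ((partialDeriv i)^[m] f) O := by
  induction m with
  | zero => exact hf
  | succ m ih =>
    rw [Function.iterate_succ_apply']
    exact differentiableOn_partialDeriv hO ih i

/-- Gives access to the one-variable calculus, in particular the Leibniz rule, with the other
variables frozen. -/
lemma iterate_partialDeriv_eq_iteratedDeriv (f : (ι → ℂ) → ℂ) (i : ι) (m : ℕ) (u : ι → ℂ)
    (w : ℂ) : (partialDeriv i)^[m] f (Function.update u i w) =
      iteratedDeriv m (fun w => f (Function.update u i w)) w := by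
  induction m generalizing w with
  | zero => simp
  | succ m ih =>
    rw [Function.iterate_succ_apply', iteratedDeriv_succ, partialDeriv]
    simp only [Function.update_self, Function.update_idem]
    congr 1
    ext w'
    exact ih w'

lemma exists_norm_iterate_partialDeriv_le (ι : Type*) [Fintype ι] [DecidableEq ι] (m : ℕ) {r : ℝ}
    (hr : 0 < r) : ∃ r' C : ℝ, 0 < r' ∧ r' ≤ r ∧ 0 ≤ C ∧ ∀ (f : (ι → ℂ) → ℂ) (M : ℝ) (i : ι),
      DifferentiableOn ℂ f (ball 1 r) → (∀ u ∈ ball (1 : ι → ℂ) r, ‖f u‖ ≤ M) →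
        ∀ u ∈ ball (1 : ι → ℂ) r', ‖(partialDeriv i)^[m] f u‖ ≤ C * M := by
  induction m with
  | zero => exact ⟨r, 1, hr, le_rfl, zero_le_one, fun f M i _ h u hu => by simpa using h u hu⟩
  | succ m ih =>
    obtain ⟨r', C, hr', hle, hC, H⟩ := ih
    refine ⟨r' / 2, C / (r' / 4), by positivity, by linarith, by positivity, ?_⟩
    intro f M i hf hM u hu
    have hsub : ball u (r' / 2) ⊆ ball 1 r' := by
      refine ball_subset_ball' ?_
      rw [mem_ball] at hu
      linarith
    have h := norm_partialDeriv_le (δ := r' / 2) (by positivity)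
      ((differentiableOn_iterate_partialDeriv isOpen_ball hf i m).mono
        (hsub.trans (ball_subset_ball hle))) (fun v hv => H f M i hf hM v (hsub hv)) i
    rw [Function.iterate_succ_apply']
    refine h.trans (le_of_eq ?_)
    field_simp
    ring

lemma differentiableAt_slice {O : Set (ι → ℂ)} (hO : IsOpen O) {f : (ι → ℂ) → ℂ}
    (hf : DifferentiableOn ℂ f O) {u : ι → ℂ} (hu : u ∈ O) (i : ι) :
    DifferentiableAt ℂ (fun w => f (Function.update u i w)) (u i) :=
  (differentiableOn_slice hf u i).differentiableAt ((isOpen_slice hO u i).mem_nhds (by simpa))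

lemma partialDeriv_congr {O : Set (ι → ℂ)} (hO : IsOpen O) {f g : (ι → ℂ) → ℂ}
    (hfg : EqOn f g O) (i : ι) : EqOn (partialDeriv i f) (partialDeriv i g) O := by
  intro u hu
  refine Filter.EventuallyEq.deriv_eq ?_
  filter_upwards [(isOpen_slice hO u i).mem_nhds (show u i ∈ _ by simpa)] with w hw
  exact hfg hw

lemma partialDeriv_sub {O : Set (ι → ℂ)} (hO : IsOpen O) {f g : (ι → ℂ) → ℂ}
    (hf : DifferentiableOn ℂ f O) (hg : DifferentiableOn ℂ g O) (i : ι) {u : ι → ℂ} (hu : u ∈ O) :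
    partialDeriv i (fun v => f v - g v) u = partialDeriv i f u - partialDeriv i g u :=
  deriv_fun_sub (differentiableAt_slice hO hf hu i) (differentiableAt_slice hO hg hu i)

lemma partialDeriv_mul {O : Set (ι → ℂ)} (hO : IsOpen O) {f g : (ι → ℂ) → ℂ}
    (hf : DifferentiableOn ℂ f O) (hg : DifferentiableOn ℂ g O) (i : ι) {u : ι → ℂ} (hu : u ∈ O) :
    partialDeriv i (fun v => f v * g v) u = partialDeriv i f u * g u + f u * partialDeriv i g u := by
  have := deriv_fun_mul (differentiableAt_slice hO hf hu i) (differentiableAt_slice hO hg hu i)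
  simpa [partialDeriv] using this

lemma partialDeriv_const_mul (a : ℂ) (f : (ι → ℂ) → ℂ) (i : ι) :
    partialDeriv i (fun v => a * f v) = fun u => a * partialDeriv i f u :=
  funext fun _ => deriv_const_mul_field a

lemma partialDeriv_sum {O : Set (ι → ℂ)} (hO : IsOpen O) {α : Type*} (s : Finset α)
    {f : α → (ι → ℂ) → ℂ} (hf : ∀ a ∈ s, DifferentiableOn ℂ (f a) O) (i : ι) {u : ι → ℂ}
    (hu : u ∈ O) :
    partialDeriv i (fun v => ∑ a ∈ s, f a v) u = ∑ a ∈ s, partialDeriv i (f a) u :=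
  deriv_fun_sum fun a ha => differentiableAt_slice hO (hf a ha) hu i

lemma iterate_partialDeriv_const_mul (a : ℂ) (f : (ι → ℂ) → ℂ) (i : ι) (m : ℕ) :
    (partialDeriv i)^[m] (fun v => a * f v) = fun u => a * (partialDeriv i)^[m] f u := by
  induction m with
  | zero => rfl
  | succ m ih => simp only [Function.iterate_succ_apply', ih, partialDeriv_const_mul]

lemma iterate_partialDeriv_sub {O : Set (ι → ℂ)} (hO : IsOpen O) {f g : (ι → ℂ) → ℂ}
    (hf : DifferentiableOn ℂ f O) (hg : DifferentiableOn ℂ g O) (i : ι) (m : ℕ) :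
    EqOn ((partialDeriv i)^[m] fun v => f v - g v)
      (fun u => (partialDeriv i)^[m] f u - (partialDeriv i)^[m] g u) O := by
  induction m with
  | zero => exact fun _ _ => rfl
  | succ m ih =>
    intro u hu
    simp only [Function.iterate_succ_apply']
    rw [partialDeriv_congr hO ih i hu, partialDeriv_sub hO
      (differentiableOn_iterate_partialDeriv hO hf i m)
      (differentiableOn_iterate_partialDeriv hO hg i m) i hu]

lemma iterate_partialDeriv_sum {O : Set (ι → ℂ)} (hO : IsOpen O) {α : Type*} (s : Finset α)
    {f : α → (ι → ℂ) → ℂ} (hf : ∀ a ∈ s, DifferentiableOn ℂ (f a) O) (i : ι) (m : ℕ) :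
    EqOn ((partialDeriv i)^[m] fun v => ∑ a ∈ s, f a v)
      (fun u => ∑ a ∈ s, (partialDeriv i)^[m] (f a) u) O := by
  induction m with
  | zero => exact fun _ _ => rfl
  | succ m ih =>
    intro u hu
    simp only [Function.iterate_succ_apply']
    rw [partialDeriv_congr hO ih i hu, partialDeriv_sum hO s
      (fun a ha => differentiableOn_iterate_partialDeriv hO (hf a ha) i m) i hu]

lemma partialDeriv_comp_perm {O : Set (ι → ℂ)} (hO : IsOpen O) {F G : (ι → ℂ) → ℂ}
    (σ : Equiv.Perm ι) (h : ∀ v ∈ O, F (v ∘ σ.symm) = G v) (i : ι) :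
    ∀ u ∈ O, partialDeriv (σ i) F (u ∘ σ.symm) = partialDeriv i G u := by
  intro u hu
  simp only [partialDeriv, Function.comp_apply, Equiv.symm_apply_apply]
  refine Filter.EventuallyEq.deriv_eq ?_
  filter_upwards [(isOpen_slice hO u i).mem_nhds (show u i ∈ _ by simpa)] with w hw
  rw [← h _ hw, Function.update_comp_equiv, Equiv.symm_symm]

lemma iterate_partialDeriv_comp_perm {O : Set (ι → ℂ)} (hO : IsOpen O) {F G : (ι → ℂ) → ℂ}
    (σ : Equiv.Perm ι) (h : ∀ v ∈ O, F (v ∘ σ.symm) = G v) (i : ι) (m : ℕ) :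
    ∀ u ∈ O, (partialDeriv (σ i))^[m] F (u ∘ σ.symm) = (partialDeriv i)^[m] G u := by
  induction m with
  | zero => exact h
  | succ m ih =>
    simp only [Function.iterate_succ_apply']
    exact partialDeriv_comp_perm hO σ ih i

/-- The family `u_i ^ k ∂_i ^ m f`. -/
def derivFamily (k m : ℕ) (f : (ι → ℂ) → ℂ) (i : ι) (u : ι → ℂ) : ℂ :=
  u i ^ k * (partialDeriv i)^[m] f u

/-- Invariance under exchanging variables. -/
def SymmetricOn (f : (ι → ℂ) → ℂ) (O : Set (ι → ℂ)) : Prop :=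
  ∀ a b, ∀ u ∈ O, f (u ∘ Equiv.swap a b) = f u

/-- Symmetry of `f` is used only here: it supplies the hypothesis of the extension theorem for
divided differences. -/
lemma SymmetricOn.equivariant {O : Set (ι → ℂ)} (hO : IsOpen O) {f : (ι → ℂ) → ℂ}
    (hf : SymmetricOn f O) (k m : ℕ) : Equivariant O (derivFamily k m f) := by
  intro a b c u hu
  have h := iterate_partialDeriv_comp_perm hO (F := f) (G := f) (Equiv.swap a b)
    (fun v hv => by rw [Equiv.symm_swap]; exact hf a b v hv) c m u hu
  rw [Equiv.symm_swap] at h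
  simp [derivFamily, h]

lemma differentiableOn_derivFamily {O : Set (ι → ℂ)} (hO : IsOpen O) {f : (ι → ℂ) → ℂ}
    (hf : DifferentiableOn ℂ f O) (k m : ℕ) (i : ι) :
    DifferentiableOn ℂ (derivFamily k m f i) O :=
  (((differentiable_apply i).pow k).differentiableOn).mul
    (differentiableOn_iterate_partialDeriv hO hf i m)

lemma comp_swap_mem_ball {r : ℝ} (a b : ι) {u : ι → ℂ} (hu : u ∈ ball (1 : ι → ℂ) r) :
    u ∘ Equiv.swap a b ∈ ball (1 : ι → ℂ) r := by
  have hr := pos_of_mem_ball hu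
  rw [mem_ball, dist_pi_lt_iff hr] at hu ⊢
  exact fun i => hu _

lemma exists_isDivDiffExt_derivFamily {r : ℝ} {f : (ι → ℂ) → ℂ}
    (hf : DifferentiableOn ℂ f (ball 1 r)) (hs : SymmetricOn f (ball 1 r)) (k m : ℕ)
    (A : Finset ι) : ∃ e, IsDivDiffExt (ball 1 r) A (derivFamily k m f) e :=
  exists_isDivDiffExt isOpen_ball (fun a b _ hu => comp_swap_mem_ball a b hu)
    (differentiableOn_derivFamily isOpen_ball hf k m) (hs.equivariant isOpen_ball k m) A

/-- The operator `f ↦ ext (divDiff A (u_i ^ k ∂_i ^ m f))` is bounded. -/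
theorem exists_norm_divDiffExt_derivFamily_le (ι : Type*) [Fintype ι] [DecidableEq ι] (k m : ℕ)
    {r : ℝ} (hr : 0 < r) : ∃ r' C : ℝ, 0 < r' ∧ r' ≤ r ∧ 0 ≤ C ∧ ∀ (A : Finset ι)
      (f e : (ι → ℂ) → ℂ) (M : ℝ), 0 ≤ M → DifferentiableOn ℂ f (ball 1 r) →
      IsDivDiffExt (ball 1 r) A (derivFamily k m f) e →
      (∀ u ∈ ball (1 : ι → ℂ) r, ‖f u‖ ≤ M) → ∀ u ∈ ball (1 : ι → ℂ) r', ‖e u‖ ≤ C * M := by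
  obtain ⟨r₁, C₁, hr₁, hle₁, hC₁, H₁⟩ := exists_norm_iterate_partialDeriv_le ι m hr
  obtain ⟨r₂, C₂, hr₂, hle₂, hC₂, H₂⟩ := exists_norm_divDiffExt_le ι hr₁
  refine ⟨r₂, C₂ * ((1 + r) ^ k * C₁), hr₂, hle₂.trans hle₁, by positivity, ?_⟩
  intro A f e M hM hf he hfM u hu
  rw [mul_assoc]
  refine H₂ A _ e _ (by positivity) (he.mono (ball_subset_ball hle₁)) (fun i _ v hv => ?_) u hu
  rw [derivFamily, norm_mul, norm_pow, mul_assoc]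
  have hvi : ‖v i‖ ≤ 1 + r := by
    have h1 : dist (v i) 1 ≤ r := (dist_le_pi_dist v 1 i).trans
      ((mem_ball.1 hv).le.trans hle₁)
    rw [dist_eq_norm] at h1
    calc ‖v i‖ = ‖1 + (v i - 1)‖ := by congr 1; ring
      _ ≤ ‖(1 : ℂ)‖ + ‖v i - 1‖ := norm_add_le _ _
      _ ≤ 1 + r := by rw [norm_one]; linarith
  gcongr
  exact H₁ f M i hf hfM v hv

/-- Partial derivatives of locally uniformly convergent holomorphic functions converge locally
uniformly. -/
theorem TendstoLocallyUniformlyOn.partialDeriv {α : Type*} {l : Filter α} {O : Set (ι → ℂ)}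
    (hO : IsOpen O) {F : α → (ι → ℂ) → ℂ} {f : (ι → ℂ) → ℂ}
    (h : TendstoLocallyUniformlyOn F f l O) (hF : ∀ᶠ n in l, DifferentiableOn ℂ (F n) O)
    (hf : DifferentiableOn ℂ f O) (i : ι) :
    TendstoLocallyUniformlyOn (fun n => UnitarySignature.partialDeriv i (F n))
      (UnitarySignature.partialDeriv i f) l O := by
  rw [tendstoLocallyUniformlyOn_iff_forall_isCompact hO] at h
  rw [Metric.tendstoLocallyUniformlyOn_iff]
  intro ε hε x hx
  obtain ⟨δ, hδ, hball⟩ := Metric.isOpen_iff.1 hO x hx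
  have hsub : closedBall x (δ / 2) ⊆ O := (closedBall_subset_ball (by linarith)).trans hball
  have hu := Metric.tendstoUniformlyOn_iff.1 (h _ hsub (isCompact_closedBall x _)) (ε * δ / 16)
    (by positivity)
  refine ⟨ball x (δ / 4), mem_nhdsWithin_of_mem_nhds (ball_mem_nhds x (by positivity)), ?_⟩
  filter_upwards [hu, hF] with n hn hFn y hy
  have hyb : ball y (δ / 4) ⊆ closedBall x (δ / 2) := by
    refine (ball_subset_ball' ?_).trans ball_subset_closedBall
    rw [mem_ball] at hy
    linarith
  have hyO : y ∈ O := hsub (hyb (mem_ball_self (by positivity)))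
  rw [dist_eq_norm, ← partialDeriv_sub hO hf hFn i hyO]
  refine (norm_partialDeriv_le (δ := δ / 4) (M := ε * δ / 16) (by positivity)
    ((hf.sub hFn).mono (hyb.trans hsub)) (fun v hv => ?_) i).trans_lt ?_
  · rw [Pi.sub_apply, ← dist_eq_norm]
    exact (hn v (hyb hv)).le
  · rw [div_lt_iff₀ (by positivity)]
    nlinarith

end DividedDifferences

/-! ### Characters near the identity and the differential operators that diagonalize them. -/

section Characters

open Metric Set

variable {N : ℕ}

/-- The Vandermonde product `∏_{i<j} (u_i - u_j)`. -/
def vandermondeProd (u : Fin N → ℂ) : ℂ := ∏ i : Fin N, ∏ j ∈ Finset.Ioi i, (u i - u j)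

/-- The numerator of Weyl's formula. -/
def alternant (lam : Signature N) (u : Fin N → ℂ) : ℂ :=
  (Matrix.of fun i j : Fin N => u i ^ shifted lam j).det

/-- The radius `1` that recurs below keeps the coordinates away from `0`, where negative powers are
singular. -/
lemma ne_zero_of_mem_ball_one {z : ℂ} (h : dist z 1 < 1) : z ≠ 0 := by
  rintro rfl
  simp at h

lemma apply_ne_zero_of_mem_ball {ι : Type*} [Fintype ι] {u : ι → ℂ} (hu : u ∈ ball 1 1) (i : ι) :
    u i ≠ 0 :=
  ne_zero_of_mem_ball_one ((dist_le_pi_dist u 1 i).trans_lt (mem_ball.1 hu))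

lemma vandermondeProd_ne_zero {u : Fin N → ℂ} (hu : Function.Injective u) :
    vandermondeProd u ≠ 0 := by
  refine Finset.prod_ne_zero_iff.2 fun i _ => Finset.prod_ne_zero_iff.2 fun j hj => ?_
  exact sub_ne_zero.2 fun h => (Finset.mem_Ioi.1 hj).ne (hu h)

lemma differentiableOn_prod {E κ : Type*} [NormedAddCommGroup E] [NormedSpace ℂ E] {O : Set E}
    {s : Finset κ} {f : κ → E → ℂ} (h : ∀ i ∈ s, DifferentiableOn ℂ (f i) O) :
    DifferentiableOn ℂ (fun u => ∏ i ∈ s, f i u) O := by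
  classical
  induction s using Finset.induction_on with
  | empty => simp
  | insert a s ha ih =>
    simp only [Finset.prod_insert ha]
    exact (h a (Finset.mem_insert_self _ _)).fun_mul
      (ih fun i hi => h i (Finset.mem_insert_of_mem hi))

lemma differentiableOn_alternant (lam : Signature N) :
    DifferentiableOn ℂ (alternant lam) (ball 1 1) := by
  unfold alternant
  simp only [Matrix.det_apply]
  refine DifferentiableOn.fun_sum fun σ _ => DifferentiableOn.fun_const_smul ?_ _
  have h : ∀ i ∈ (Finset.univ : Finset (Fin N)), DifferentiableOn ℂ
      (fun u : Fin N → ℂ => u (σ i) ^ shifted lam i) (ball 1 1) := fun i _ u hu =>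
    ((differentiableAt_apply (σ i) u).zpow
      (Or.inl (apply_ne_zero_of_mem_ball hu _))).differentiableWithinAt
  exact differentiableOn_prod h

lemma alternant_eq_zero (lam : Signature N) {u : Fin N → ℂ} {i j : Fin N} (hij : i ≠ j)
    (h : u i = u j) : alternant lam u = 0 :=
  Matrix.det_zero_of_row_eq hij (by ext k; simp [h])

/-- A holomorphic function vanishing on all the hyperplanes `u_i = u_j` is divisible by the
Vandermonde product. -/
theorem exists_eq_vandermondeProd_mul {O : Set (Fin N → ℂ)} (hO : IsOpen O)
    {h : (Fin N → ℂ) → ℂ} (hh : DifferentiableOn ℂ h O)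
    (h0 : ∀ i j, i ≠ j → ∀ u ∈ O, u i = u j → h u = 0) :
    ∃ χ : (Fin N → ℂ) → ℂ, DifferentiableOn ℂ χ O ∧ ∀ u ∈ O, h u = vandermondeProd u * χ u := by
  have key : ∀ T : Finset (Σ _ : Fin N, Fin N), (∀ x ∈ T, x.1 < x.2) →
      ∃ χ : (Fin N → ℂ) → ℂ, DifferentiableOn ℂ χ O ∧
        ∀ u ∈ O, h u = (∏ x ∈ T, (u x.1 - u x.2)) * χ u := by
    intro T
    induction T using Finset.induction_on with
    | empty => exact fun _ => ⟨h, hh, fun u _ => by simp⟩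
    | insert x T hx ih =>
      intro hT
      obtain ⟨χ, hχ, hχe⟩ := ih fun y hy => hT y (Finset.mem_insert_of_mem hy)
      have hlt : x.1 < x.2 := hT x (Finset.mem_insert_self _ _)
      -- Making two coordinates of a generic direction equal gives a line inside the hyperplane of
      -- `x` that leaves the hyperplanes already divided out. On it `h` vanishes and the earlier
      -- factors do not, so `χ` does.
      have hvan : ∀ u ∈ O, u x.1 = u x.2 → χ u = 0 := by
        intro u hu hux
        obtain ⟨c, s, hs, -, hc⟩ := exists_injective_direction (Fin N)
        have hcne : ∀ i j, i ≠ j → c i ≠ c j := by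
          intro i j hij h
          have := hc i j hij
          rw [h, sub_self, norm_zero] at this
          linarith
        refine eqOn_of_eq_along_line (g := fun _ => 0)
          (P := {v : Fin N → ℂ | v x.1 = v x.2 ∧ ∀ y ∈ T, v y.1 ≠ v y.2}) hO
          (Function.update c x.1 (c x.2)) hu hχ.continuousOn continuousOn_const ?_ ?_
        · filter_upwards [eventually_add_smul_ne u (Function.update c x.1 (c x.2))] with t ht
          refine ⟨by simp [hux, hlt.ne'], fun y hy => ht _ _ ?_⟩
          have hylt : y.1 < y.2 := hT y (Finset.mem_insert_of_mem hy)
          have hyx : y ≠ x := fun h => hx (h ▸ hy)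
          rcases eq_or_ne y.1 x.1 with h1 | h1
          · have h2 : y.2 ≠ x.2 := fun h2 => hyx (Sigma.ext h1 (heq_of_eq h2))
            rw [h1, Function.update_self, Function.update_of_ne (by rw [← h1]; exact hylt.ne')]
            exact hcne _ _ h2.symm
          · rw [Function.update_of_ne h1]
            rcases eq_or_ne y.2 x.1 with h2 | h2
            · rw [h2, Function.update_self]
              refine hcne _ _ (ne_of_lt ?_)
              exact (hylt.trans_eq h2).trans hlt
            · rw [Function.update_of_ne h2]
              exact hcne _ _ hylt.ne
        · intro v hv hP
          have h1 := hχe v hv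
          rw [h0 x.1 x.2 hlt.ne v hv hP.1] at h1
          refine (mul_eq_zero.1 h1.symm).resolve_left (Finset.prod_ne_zero_iff.2 fun y hy => ?_)
          exact sub_ne_zero.2 (hP.2 y hy)
      refine ⟨quotSub x.1 x.2 χ, differentiableOn_quotSub hO hχ hlt.ne hvan, fun u hu => ?_⟩
      rw [Finset.prod_insert hx, mul_comm (u x.1 - u x.2), mul_assoc, sub_mul_quotSub (hvan u hu)]
      exact hχe u hu
  obtain ⟨χ, hχ, hχe⟩ := key (Finset.univ.sigma fun i => Finset.Ioi i) (by simp)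
  refine ⟨χ, hχ, fun u hu => ?_⟩
  rw [hχe u hu, Finset.prod_sigma]
  rfl

lemma mem_closure_injective_ne_zero {u : Fin N → ℂ} (hu : u ∈ ball 1 1) :
    u ∈ closure {v : Fin N → ℂ | Function.Injective v ∧ ∀ i, v i ≠ 0} := by
  obtain ⟨c, s, hs, -, hc⟩ := exists_injective_direction (Fin N)
  have hline : Tendsto (fun t : ℂ => u + t • c) (𝓝[≠] 0) (𝓝 u) := by
    have : ContinuousAt (fun t : ℂ => u + t • c) 0 := by fun_prop
    have h := this.tendsto
    simp only [zero_smul, add_zero] at h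
    exact h.mono_left nhdsWithin_le_nhds
  refine mem_closure_of_tendsto hline ?_
  filter_upwards [eventually_add_smul_ne u c, hline.eventually (isOpen_ball.mem_nhds hu)]
    with t ht htb
  refine ⟨fun i j hij => ?_, apply_ne_zero_of_mem_ball htb⟩
  by_contra hne
  refine ht i j (fun h => ?_) hij
  have := hc i j hne
  rw [h, sub_self, norm_zero] at this
  linarith

/-- Near `(1, …, 1)` the character is a holomorphic function whose product with the Vandermonde
product is the alternant. -/
theorem character_spec (lam : Signature N) : DifferentiableOn ℂ (character lam) (ball 1 1) ∧
    ∀ u ∈ ball (1 : Fin N → ℂ) 1, alternant lam u = vandermondeProd u * character lam u := by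
  obtain ⟨χ, hχ, he⟩ := exists_eq_vandermondeProd_mul isOpen_ball (differentiableOn_alternant lam)
    fun i j hij u _ h => alternant_eq_zero lam hij h
  have heq : EqOn (character lam) χ (ball 1 1) := by
    intro u hu
    -- The quotient `χ` is continuous and equals Weyl's ratio at nearby points with distinct nonzero
    -- coordinates, so it is the limit that defines the character.
    refine extendFrom_eq (mem_closure_injective_ne_zero hu) ?_
    have hc : Tendsto χ (𝓝[{v : Fin N → ℂ | Function.Injective v ∧ ∀ i, v i ≠ 0}] u) (𝓝 (χ u)) :=
      (hχ.continuousOn.continuousAt (isOpen_ball.mem_nhds hu)).tendsto.mono_left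
        nhdsWithin_le_nhds
    refine hc.congr' ?_
    filter_upwards [self_mem_nhdsWithin, nhdsWithin_le_nhds (isOpen_ball.mem_nhds hu)]
      with v hv hvb
    have := he v hvb
    rw [alternant, vandermondeProd] at this
    rw [weylRatio, this, mul_div_cancel_left₀]
    exact vandermondeProd_ne_zero hv.1
  exact ⟨hχ.congr heq, fun u hu => by rw [he u hu, heq hu]⟩

lemma vandermondeProd_eq_det (u : Fin N → ℂ) :
    vandermondeProd u = (Matrix.vandermonde fun i => -u i).det := by
  rw [Matrix.det_vandermonde, vandermondeProd]
  refine Finset.prod_congr rfl fun i _ => Finset.prod_congr rfl fun j _ => by ring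

lemma comp_perm_mem_ball {ι : Type*} [Fintype ι] {r : ℝ} (σ : Equiv.Perm ι) {u : ι → ℂ}
    (hu : u ∈ ball (1 : ι → ℂ) r) : u ∘ σ ∈ ball (1 : ι → ℂ) r := by
  have hr := pos_of_mem_ball hu
  rw [mem_ball, dist_pi_lt_iff hr] at hu ⊢
  exact fun i => hu _

/-- Characters are symmetric. -/
theorem character_comp_perm (lam : Signature N) (σ : Equiv.Perm (Fin N)) {u : Fin N → ℂ}
    (hu : u ∈ ball 1 1) : character lam (u ∘ σ) = character lam u := by
  obtain ⟨hd, he⟩ := character_spec lam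
  have hd' : DifferentiableOn ℂ (fun v => character lam (v ∘ σ)) (ball 1 1) :=
    hd.comp (Differentiable.differentiableOn (by fun_prop)) fun v hv => comp_perm_mem_ball σ hv
  refine eqOn_of_eq_of_injOn isOpen_ball Finset.univ hd'.continuousOn hd.continuousOn
    (fun v hv hi => ?_) hu
  rw [Finset.coe_univ, injOn_univ] at hi
  have h1 := he v hv
  have h2 := he (v ∘ σ) (comp_perm_mem_ball σ hv)
  -- Alternant and Vandermonde product are both antisymmetric, so the sign cancels in the quotient.
  have ha : alternant lam (v ∘ σ) = Equiv.Perm.sign σ * alternant lam v :=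
    Matrix.det_permute σ (Matrix.of fun i j : Fin N => v i ^ shifted lam j)
  have hv' : vandermondeProd (v ∘ σ) = Equiv.Perm.sign σ * vandermondeProd v := by
    rw [vandermondeProd_eq_det, vandermondeProd_eq_det, ← Matrix.det_permute]
    rfl
  rw [ha, hv', h1, mul_assoc] at h2
  have hs : ((Equiv.Perm.sign σ : ℤ) : ℂ) ≠ 0 := by
    exact_mod_cast (Equiv.Perm.sign σ).ne_zero
  exact (mul_left_cancel₀ (vandermondeProd_ne_zero hi) (mul_left_cancel₀ hs h2)).symm

/-- The sum over the shifted coordinates of their `k`-th falling factorials. -/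
def fallingSum (k : ℕ) (lam : Signature N) : ℝ :=
  ∑ i, ∏ t ∈ Finset.range k, ((shifted lam i : ℝ) - t)

/-- The alternant is an eigenfunction of `∑ u_i ^ k ∂_i ^ k`. -/
theorem sum_pow_mul_iterate_partialDeriv_alternant (lam : Signature N) (k : ℕ) {u : Fin N → ℂ}
    (hu : ∀ i, u i ≠ 0) :
    ∑ i, u i ^ k * (partialDeriv i)^[k] (alternant lam) u =
      (fallingSum k lam : ℂ) * alternant lam u := by
  set M : Matrix (Fin N) (Fin N) ℂ := Matrix.of fun i j : Fin N => u i ^ shifted lam j with hM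
  -- The variable `u_i` occurs in row `i` only. Expanding along that row gives a combination of
  -- powers, each an eigenfunction of `w ^ k ∂ ^ k`.
  have hrow : ∀ i w, alternant lam (Function.update u i w) =
      ∑ j, M.adjugate j i * w ^ shifted lam j := by
    intro i w
    have h1 : (Matrix.of fun a j : Fin N => Function.update u i w a ^ shifted lam j) =
        M.updateRow i fun j => w ^ shifted lam j := by
      ext a j
      rcases eq_or_ne a i with rfl | h
      · simp
      · simp [h, hM]
    rw [alternant, h1, Matrix.det_eq_sum_mul_adjugate_row _ i]
    refine Finset.sum_congr rfl fun j _ => ?_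
    rw [Matrix.updateRow_self, Matrix.adjugate_apply, Matrix.adjugate_apply,
      Matrix.updateRow_idem, mul_comm]
  have hder : ∀ i, u i ^ k * (partialDeriv i)^[k] (alternant lam) u =
      ∑ j, (∏ t ∈ Finset.range k, ((shifted lam j : ℂ) - t)) * (M.adjugate j i * M i j) := by
    intro i
    have h1 := iterate_partialDeriv_eq_iteratedDeriv (alternant lam) i k u (u i)
    rw [Function.update_eq_self] at h1
    simp only [hrow] at h1
    have hcd : ∀ j ∈ (Finset.univ : Finset (Fin N)), ContDiffAt ℂ k
        (fun w : ℂ => M.adjugate j i * w ^ shifted lam j) (u i) := fun j _ =>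
      contDiffAt_const.mul ((analyticAt_id (𝕜 := ℂ)).fun_zpow (hu i)).contDiffAt
    rw [h1, iteratedDeriv_fun_sum hcd, Finset.mul_sum]
    refine Finset.sum_congr rfl fun j _ => ?_
    rw [iteratedDeriv_const_mul_field, iteratedDeriv_eq_iterate, iter_deriv_zpow,
      zpow_sub₀ (hu i), zpow_natCast, hM, Matrix.of_apply]
    field_simp [hu i]
  simp only [hder]
  rw [Finset.sum_comm]
  -- The eigenvalue depends on the column `j` alone; summing over rows first restores the
  -- determinant.
  have hadj : ∀ j, ∑ i, M.adjugate j i * M i j = M.det := by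
    intro j
    have := congrFun (congrFun (Matrix.adjugate_mul M) j) j
    simpa [Matrix.mul_apply] using this
  simp only [← Finset.mul_sum, hadj]
  rw [← Finset.sum_mul, fallingSum, alternant]
  push_cast
  rfl

/-- Dependence of the Vandermonde product on one variable. -/
lemma vandermondeProd_update (u : Fin N → ℂ) (i : Fin N) (w : ℂ) :
    vandermondeProd (Function.update u i w) * ∏ j ∈ Finset.univ.erase i, (u i - u j) =
      vandermondeProd u * ∏ j ∈ Finset.univ.erase i, (w - u j) := by
  -- Distributes `∏ (x - u_j)` over the ordered pairs containing `i`, so the identity can be checked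
  -- pair by pair. The sign from pairs with `i` second is the same on both sides.
  let D : ℂ → Fin N → Fin N → ℂ := fun x p q =>
    if p = i then x - u q else if q = i then x - u p else 1
  have hD : ∀ x, ∏ j ∈ Finset.univ.erase i, (x - u j) = ∏ p, ∏ q ∈ Finset.Ioi p, D x p q := by
    intro x
    have h1 : ∀ p, ∏ q ∈ Finset.Ioi p, D x p q =
        (if p = i then ∏ q ∈ Finset.Ioi i, (x - u q) else 1) *
          if p ∈ Finset.Iio i then x - u p else 1 := by
      intro p
      by_cases hp : p = i
      · subst hp; simp [D]
      · simp only [D, hp, if_false, one_mul]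
        rw [Finset.prod_ite_eq']
        simp
    have h2 : Finset.univ.erase i = Finset.Ioi i ∪ Finset.Iio i := by
      ext j
      simp [lt_or_lt_iff_ne, ne_comm]
    simp only [h1]
    rw [Finset.prod_mul_distrib, Finset.prod_ite_eq', if_pos (Finset.mem_univ _),
      Finset.prod_ite_mem, Finset.univ_inter, h2, Finset.prod_union]
    rw [Finset.disjoint_left]
    intro j hj hj'
    exact lt_asymm (Finset.mem_Ioi.1 hj) (Finset.mem_Iio.1 hj')
  rw [hD, hD, vandermondeProd, vandermondeProd, ← Finset.prod_mul_distrib,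
    ← Finset.prod_mul_distrib]
  refine Finset.prod_congr rfl fun p _ => ?_
  rw [← Finset.prod_mul_distrib, ← Finset.prod_mul_distrib]
  refine Finset.prod_congr rfl fun q hq => ?_
  have hpq : p ≠ q := (Finset.mem_Ioi.1 hq).ne
  by_cases hp : p = i
  · subst hp
    simp [D, hpq.symm, mul_comm]
  · by_cases hq' : q = i
    · subst hq'
      simp only [D, hp, if_false, if_true, Function.update_self, Function.update_of_ne hp]
      ring
    · simp [D, hp, hq']

/-- Derivatives of a product of linear factors. -/
lemma iteratedDeriv_prod_sub {κ : Type*} [DecidableEq κ] (s : Finset κ) (x : κ → ℂ) (a : ℂ)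
    (l : ℕ) : iteratedDeriv l (fun w => ∏ j ∈ s, (w - x j)) a =
      l.factorial * ∑ J ∈ s.powersetCard l, ∏ j ∈ s \ J, (a - x j) := by
  -- Expand in powers of `w - a`; at `a` the `l`-th derivative sees only the terms with `|J| = l`.
  have h1 : (fun w => ∏ j ∈ s, (w - x j)) = fun w =>
      ∑ J ∈ s.powerset, (∏ j ∈ s \ J, (a - x j)) * (w - a) ^ J.card := by
    funext w
    have : ∀ j, w - x j = (w - a) + (a - x j) := fun j => by ring
    simp only [this, Finset.prod_add, Finset.prod_const]
    exact Finset.sum_congr rfl fun J _ => mul_comm _ _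
  have h2 : ∀ d, iteratedDeriv l (fun w : ℂ => (w - a) ^ d) a =
      if l = d then (d.factorial : ℂ) else 0 := by
    intro d
    have := congrFun (iteratedDeriv_comp_sub_const l (fun w : ℂ => w ^ d) a) a
    simp only [sub_self] at this
    rw [this, iteratedDeriv_fun_pow_zero]
    split_ifs <;> simp
  rw [h1, iteratedDeriv_fun_sum fun J _ => by fun_prop]
  simp only [iteratedDeriv_const_mul_field, h2]
  simp only [mul_ite, mul_zero]
  rw [← Finset.sum_filter, Finset.mul_sum]
  refine Finset.sum_congr ?_ fun J hJ => ?_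
  · ext J
    simp [Finset.mem_powersetCard, eq_comm]
  · rw [(Finset.mem_powersetCard.1 hJ).2, mul_comm]

/-- Pairs `(i, J)` with `i ∉ J` correspond to sets `I = J ∪ {i}` with a marked element. This gathers
the Leibniz terms into divided differences over `I`. -/
lemma sum_powersetCard_erase (l : ℕ) (φ : Fin N → Finset (Fin N) → ℂ) :
    ∑ i, ∑ J ∈ (Finset.univ.erase i).powersetCard l, φ i J =
      ∑ I ∈ (Finset.univ : Finset (Fin N)).powersetCard (l + 1), ∑ i ∈ I, φ i (I.erase i) := by
  rw [Finset.sum_sigma', Finset.sum_sigma']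
  refine Finset.sum_bij' (fun x _ => ⟨insert x.1 x.2, x.1⟩) (fun x _ => ⟨x.2, x.1.erase x.2⟩)
    ?_ ?_ ?_ ?_ ?_
  · rintro ⟨i, J⟩ h
    simp only [Finset.mem_sigma, Finset.mem_univ, true_and, Finset.mem_powersetCard] at h ⊢
    have hi : i ∉ J := fun hi => Finset.notMem_erase i _ (h.1 hi)
    exact ⟨⟨Finset.subset_univ _, by rw [Finset.card_insert_of_notMem hi, h.2]⟩,
      Finset.mem_insert_self _ _⟩
  · rintro ⟨I, i⟩ h
    simp only [Finset.mem_sigma, Finset.mem_univ, true_and, Finset.mem_powersetCard] at h ⊢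
    exact ⟨Finset.erase_subset_erase _ (Finset.subset_univ _),
      by rw [Finset.card_erase_of_mem h.2, h.1.2]; rfl⟩
  · rintro ⟨i, J⟩ h
    simp only [Finset.mem_sigma, Finset.mem_univ, true_and, Finset.mem_powersetCard] at h
    have hi : i ∉ J := fun hi => Finset.notMem_erase i _ (h.1 hi)
    simp [Finset.erase_insert hi]
  · rintro ⟨I, i⟩ h
    simp only [Finset.mem_sigma] at h
    simp [Finset.insert_erase h.2]
  · rintro ⟨i, J⟩ h
    simp only [Finset.mem_sigma, Finset.mem_univ, true_and, Finset.mem_powersetCard] at h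
    have hi : i ∉ J := fun hi => Finset.notMem_erase i _ (h.1 hi)
    simp [Finset.erase_insert hi]

/-- The normalized character. -/
def normChar (lam : Signature N) (u : Fin N → ℂ) : ℂ := character lam u / character lam 1

lemma differentiableOn_normChar (lam : Signature N) :
    DifferentiableOn ℂ (normChar lam) (ball 1 1) :=
  ((character_spec lam).1.mul_const (character lam 1)⁻¹).congr fun _ _ => div_eq_mul_inv _ _

lemma normChar_comp_perm (lam : Signature N) (σ : Equiv.Perm (Fin N)) {u : Fin N → ℂ}
    (hu : u ∈ ball 1 1) : normChar lam (u ∘ σ) = normChar lam u := by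
  rw [normChar, character_comp_perm lam σ hu, normChar]

lemma contDiffAt_slice {ι : Type*} [Fintype ι] [DecidableEq ι] {O : Set (ι → ℂ)} (hO : IsOpen O)
    {f : (ι → ℂ) → ℂ} (hf : DifferentiableOn ℂ f O) {u : ι → ℂ} (hu : u ∈ O) (i : ι) (n : ℕ) :
    ContDiffAt ℂ n (fun w => f (Function.update u i w)) (u i) :=
  ((differentiableOn_slice hf u i).analyticAt
    ((isOpen_slice hO u i).mem_nhds (by simpa))).contDiffAt

/-- The action of `V⁻¹ ∑ u_i ^ k ∂_i ^ k V` on characters, off the diagonals. -/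
theorem fallingSum_mul_normChar (lam : Signature N) (k : ℕ) {u : Fin N → ℂ} (hu : u ∈ ball 1 1)
    (hi : Function.Injective u) :
    (fallingSum k lam : ℂ) * normChar lam u =
      ∑ l ∈ Finset.range (k + 1), (k.choose l * l.factorial : ℂ) *
        ∑ I ∈ (Finset.univ : Finset (Fin N)).powersetCard (l + 1),
          divDiff I (derivFamily k (k - l) (normChar lam)) u := by
  obtain ⟨hd, he⟩ := character_spec lam
  -- If the character were to vanish at `1`, this would be `0`, as would `normChar`, so no
  -- nonvanishing is needed here.
  set κ := (character lam 1)⁻¹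
  have hb : ∀ v ∈ ball (1 : Fin N → ℂ) 1,
      κ * alternant lam v = vandermondeProd v * normChar lam v := by
    intro v hv
    rw [he v hv, normChar, div_eq_mul_inv]
    ring
  have hV : vandermondeProd u ≠ 0 := vandermondeProd_ne_zero hi
  have hn : ∀ i, ∏ j ∈ Finset.univ.erase i, (u i - u j) ≠ 0 := fun i =>
    Finset.prod_ne_zero_iff.2 fun j hj =>
      sub_ne_zero.2 fun h => Finset.ne_of_mem_erase hj (hi h).symm
  have hterm : ∀ i, u i ^ k * (κ * (partialDeriv i)^[k] (alternant lam) u) =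
      vandermondeProd u * ∑ l ∈ Finset.range (k + 1), (k.choose l * l.factorial : ℂ) *
        ∑ J ∈ (Finset.univ.erase i).powersetCard l,
          (∏ j ∈ J, (u i - u j)⁻¹) * derivFamily k (k - l) (normChar lam) i u := by
    intro i
    -- As a function of its `i`-th variable, the Vandermonde product is a constant times `∏ (w -
    -- u_j)`. In the Leibniz rule its `l`-th derivative is `l!` times a sum over sets `J` of `l`
    -- omitted factors, which end up in the denominator.
    have e1 : (fun w => κ * alternant lam (Function.update u i w)) =ᶠ[𝓝 (u i)] fun w =>
        (vandermondeProd u * (∏ j ∈ Finset.univ.erase i, (u i - u j))⁻¹) *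
          ((∏ j ∈ Finset.univ.erase i, (w - u j)) * normChar lam (Function.update u i w)) := by
      filter_upwards [(isOpen_slice isOpen_ball u i).mem_nhds
        (show u i ∈ {w | Function.update u i w ∈ ball (1 : Fin N → ℂ) 1} by simpa)] with w hw
      have h2 := vandermondeProd_update u i w
      rw [hb _ hw, eq_div_of_mul_eq (hn i) h2]
      field_simp
    have e2 : κ * (partialDeriv i)^[k] (alternant lam) u =
        iteratedDeriv k (fun w => κ * alternant lam (Function.update u i w)) (u i) := by
      have h1 := iterate_partialDeriv_eq_iteratedDeriv (alternant lam) i k u (u i)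
      rw [Function.update_eq_self] at h1
      rw [h1, iteratedDeriv_const_mul_field]
    rw [e2, e1.iteratedDeriv_eq, iteratedDeriv_const_mul_field, iteratedDeriv_fun_mul
      (by fun_prop) (contDiffAt_slice isOpen_ball (differentiableOn_normChar lam) hu i k)]
    simp only [iteratedDeriv_prod_sub, Finset.mul_sum]
    refine Finset.sum_congr rfl fun l _ => ?_
    rw [Finset.sum_mul, Finset.mul_sum, Finset.mul_sum]
    refine Finset.sum_congr rfl fun J hJ => ?_
    have h1 := iterate_partialDeriv_eq_iteratedDeriv (normChar lam) i (k - l) u (u i)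
    rw [Function.update_eq_self] at h1
    have hJs := (Finset.mem_powersetCard.1 hJ).1
    have h3 := Finset.prod_sdiff hJs (f := fun j => u i - u j)
    have hJ0 : ∏ j ∈ J, (u i - u j) ≠ 0 := fun h => hn i (by rw [← h3, h, mul_zero])
    have hJ1 : ∏ j ∈ Finset.univ.erase i \ J, (u i - u j) ≠ 0 :=
      fun h => hn i (by rw [← h3, h, zero_mul])
    rw [derivFamily, h1, Finset.prod_inv_distrib, ← h3]
    field_simp
  have hsum := sum_pow_mul_iterate_partialDeriv_alternant lam k (apply_ne_zero_of_mem_ball hu)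
  refine mul_left_cancel₀ hV ?_
  calc vandermondeProd u * ((fallingSum k lam : ℂ) * normChar lam u)
      = κ * ((fallingSum k lam : ℂ) * alternant lam u) := by
        rw [mul_left_comm, ← hb u hu]; ring
    _ = ∑ i, u i ^ k * (κ * (partialDeriv i)^[k] (alternant lam) u) := by
        rw [← hsum, Finset.mul_sum]
        exact Finset.sum_congr rfl fun i _ => by ring
    _ = _ := by
        simp only [hterm]
        rw [← Finset.mul_sum, Finset.sum_comm]
        simp only [← Finset.mul_sum, sum_powersetCard_erase]
        rfl

end Characters

/-! ### Specializing all but finitely many variables to `1`. -/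

section FewVariables

open Metric Set

variable {N : ℕ}

lemma padOne_eq_extend {n : ℕ} (h : n ≤ N) (u : Fin n → ℂ) :
    padOne N u = Function.extend (Fin.castLEEmb h) u 1 := by
  funext i
  by_cases hi : (i : ℕ) < n
  · have : i = Fin.castLEEmb h ⟨i, hi⟩ := by ext; simp
    rw [this, (Fin.castLEEmb h).injective.extend_apply]
    simp [padOne, hi]
  · rw [Function.extend_apply']
    · simp [padOne, hi]
    · rintro ⟨a, rfl⟩
      exact hi (by simp)

lemma differentiable_padOne {n : ℕ} : Differentiable ℂ (padOne N : (Fin n → ℂ) → Fin N → ℂ) := by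
  rw [differentiable_pi]
  intro i
  unfold padOne
  split_ifs with h
  · exact differentiable_apply _
  · exact differentiable_const _

lemma padOne_one {n : ℕ} : padOne N (1 : Fin n → ℂ) = 1 := by
  funext i
  simp [padOne]

lemma padOne_mem_ball {n : ℕ} {r : ℝ} {u : Fin n → ℂ} (hu : u ∈ ball 1 r) :
    padOne N u ∈ ball 1 r := by
  have hr := pos_of_mem_ball hu
  rw [mem_ball, dist_pi_lt_iff hr] at hu ⊢
  intro i
  unfold padOne
  split_ifs with h
  · exact hu _
  · simpa using hr

lemma extend_mem_ball {ι κ : Type*} [Fintype ι] [Fintype κ] (e : κ ↪ ι) {r : ℝ} {u : κ → ℂ}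
    (hu : u ∈ ball 1 r) : Function.extend e u 1 ∈ ball (1 : ι → ℂ) r := by
  have hr := pos_of_mem_ball hu
  rw [mem_ball, dist_pi_lt_iff hr] at hu ⊢
  intro i
  by_cases hi : ∃ a, e a = i
  · obtain ⟨a, rfl⟩ := hi
    rw [e.injective.extend_apply]
    exact hu a
  · rw [Function.extend_apply' _ _ _ hi]
    simpa using hr

lemma differentiable_extend {ι κ : Type*} [Fintype ι] [Fintype κ] (e : κ ↪ ι) :
    Differentiable ℂ fun u : κ → ℂ => (Function.extend e u 1 : ι → ℂ) := by
  rw [differentiable_pi]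
  intro i
  by_cases hi : ∃ a, e a = i
  · obtain ⟨a, rfl⟩ := hi
    simp only [e.injective.extend_apply]
    exact differentiable_apply a
  · simp only [Function.extend_apply' _ _ _ hi]
    exact differentiable_const _

lemma extend_update {ι κ : Type*} [DecidableEq ι] [DecidableEq κ] (e : κ ↪ ι) (u : κ → ℂ) (a : κ)
    (w : ℂ) : Function.update (Function.extend e u 1) (e a) w =
      Function.extend e (Function.update u a w) 1 := by
  funext i
  by_cases hi : ∃ b, e b = i
  · obtain ⟨b, rfl⟩ := hi
    rw [e.injective.extend_apply]
    rcases eq_or_ne b a with rfl | h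
    · simp
    · rw [Function.update_of_ne (e.injective.ne h), Function.update_of_ne h,
        e.injective.extend_apply]
  · rw [Function.extend_apply' _ _ _ hi, Function.update_of_ne,
      Function.extend_apply' _ _ _ hi]
    rintro rfl
    exact hi ⟨a, rfl⟩

/-- Two extensions by `1` of the same few variables differ by a permutation. -/
lemma exists_perm_extend {ι κ : Type*} [Finite ι] (e e' : κ ↪ ι) (u : κ → ℂ) :
    ∃ σ : Equiv.Perm ι, Function.extend e u 1 = (Function.extend e' u 1 : ι → ℂ) ∘ σ := by
  classical
  let E : {x // x ∈ range e} ≃ {x // x ∈ range e'} :=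
    (Equiv.ofInjective e e.injective).symm.trans (Equiv.ofInjective e' e'.injective)
  have hE : ∀ a, E.extendSubtype (e a) = e' a := by
    intro a
    rw [Equiv.extendSubtype_apply_of_mem E (e a) (mem_range_self a)]
    simp only [E, Equiv.trans_apply]
    have : (⟨e a, mem_range_self a⟩ : {x // x ∈ range e}) = Equiv.ofInjective e e.injective a :=
      rfl
    rw [this, Equiv.symm_apply_apply]
    rfl
  refine ⟨E.extendSubtype, funext fun i => ?_⟩
  by_cases hi : ∃ a, e a = i
  · obtain ⟨a, rfl⟩ := hi
    rw [e.injective.extend_apply, Function.comp_apply, hE, e'.injective.extend_apply]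
  · rw [Function.extend_apply' _ _ _ hi, Function.comp_apply, Function.extend_apply']
    · rfl
    · exact E.extendSubtype_not_mem i hi

/-- The normalized character in the first `n` variables. -/
def fewChar {n : ℕ} (lam : Signature N) (u : Fin n → ℂ) : ℂ := normChar lam (padOne N u)

lemma differentiableOn_fewChar {n : ℕ} (lam : Signature N) :
    DifferentiableOn ℂ (fewChar (n := n) lam) (ball 1 1) :=
  (differentiableOn_normChar lam).comp differentiable_padOne.differentiableOn
    fun _ hu => padOne_mem_ball hu

/-- By symmetry it does not matter which variables are kept. -/
lemma normChar_extend {n : ℕ} (h : n ≤ N) (lam : Signature N) (e : Fin n ↪ Fin N) {u : Fin n → ℂ}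
    (hu : u ∈ ball 1 1) : normChar lam (Function.extend e u 1) = fewChar lam u := by
  obtain ⟨σ, hσ⟩ := exists_perm_extend e (Fin.castLEEmb h) u
  rw [hσ, normChar_comp_perm lam σ (extend_mem_ball _ hu), fewChar, padOne_eq_extend h]

lemma symmetricOn_normChar (lam : Signature N) : SymmetricOn (normChar lam) (ball 1 1) :=
  fun a b _ hu => normChar_comp_perm lam (Equiv.swap a b) hu

/-- Permuting the `n` variables amounts to placing them by another embedding. -/
lemma symmetricOn_fewChar {n : ℕ} (h : n ≤ N) (lam : Signature N) :
    SymmetricOn (fewChar (n := n) lam) (ball 1 1) := by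
  intro a b u hu
  rw [← normChar_extend h lam ((Equiv.swap a b).toEmbedding.trans (Fin.castLEEmb h)) hu, fewChar,
    padOne_eq_extend h]
  congr 1
  funext i
  by_cases hi : ∃ a, Fin.castLEEmb h a = i
  · obtain ⟨c, rfl⟩ := hi
    rw [(Fin.castLEEmb h).injective.extend_apply]
    have := (((Equiv.swap a b).toEmbedding.trans (Fin.castLEEmb h)).injective.extend_apply u 1
      (Equiv.swap a b c))
    simp only [Function.Embedding.trans_apply, Equiv.coe_toEmbedding,
      Equiv.swap_apply_self] at this
    rw [this]
    rfl
  · rw [Function.extend_apply' _ _ _ hi, Function.extend_apply']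
    rintro ⟨c, hc⟩
    exact hi ⟨_, hc⟩

/-- Restriction of a divided difference extension to fewer variables. -/
lemma IsDivDiffExt.comp_extend {K : ℕ} (hK : K ≤ N) (lam : Signature N) (e : Fin K ↪ Fin N)
    (A : Finset (Fin K)) (k m : ℕ) {E : (Fin N → ℂ) → ℂ}
    (hE : IsDivDiffExt (ball 1 1) (A.map e) (derivFamily k m (normChar lam)) E) :
    IsDivDiffExt (ball 1 1) A (derivFamily k m (fewChar lam))
      (fun y => E (Function.extend e y 1)) := by
  refine ⟨hE.differentiableOn.comp (differentiable_extend e).differentiableOn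
    fun _ hu => extend_mem_ball e hu, fun y hy hi => ?_⟩
  have hye : (Function.extend e y 1 : Fin N → ℂ) ∘ e = y := by
    funext a
    exact e.injective.extend_apply _ _ _
  rw [hE.eq_divDiff _ (extend_mem_ball e hy), divDiff_map, divDiff, hye]
  · refine Finset.sum_congr rfl fun a _ => ?_
    congr 1
    rw [derivFamily, derivFamily, e.injective.extend_apply]
    congr 1
    have h1 := iterate_partialDeriv_eq_iteratedDeriv (normChar lam) (e a) m
      (Function.extend e y 1) (y a)
    have h2 := iterate_partialDeriv_eq_iteratedDeriv (fewChar lam) a m y (y a)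
    have h3 : Function.update (Function.extend e y (1 : Fin N → ℂ)) (e a) (y a) =
        Function.extend e y 1 := by
      rw [extend_update, Function.update_eq_self]
    rw [h3] at h1
    rw [Function.update_eq_self] at h2
    rw [h1, h2]
    refine Filter.EventuallyEq.iteratedDeriv_eq m ?_
    filter_upwards [(isOpen_slice isOpen_ball y a).mem_nhds
      (show y a ∈ {w | Function.update y a w ∈ ball (1 : Fin K → ℂ) 1} by simpa)] with w hw
    rw [extend_update, normChar_extend hK lam e hw]
  · intro i hi' j hj' hij
    simp only [Finset.coe_map, mem_image, Finset.mem_coe] at hi' hj'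
    obtain ⟨a, ha, rfl⟩ := hi'
    obtain ⟨b, hb, rfl⟩ := hj'
    rw [e.injective.extend_apply, e.injective.extend_apply] at hij
    rw [hi ha hb hij]

/-- A set `I` of at most `k + 1` variables is carried by `n + k + 1` variables which include the
first `n` ones. -/
lemma exists_pattern {n k : ℕ} (hN : n + k + 1 ≤ N) {I : Finset (Fin N)} (hI : I.card ≤ k + 1) :
    ∃ (A : Finset (Fin (n + k + 1))) (e : Fin (n + k + 1) ↪ Fin N), A.map e = I ∧
      (∀ a : Fin (n + k + 1), (a : ℕ) < n → (e a : ℕ) = a) ∧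
      ∀ a : Fin (n + k + 1), n ≤ (a : ℕ) → n ≤ (e a : ℕ) := by
  let T : Finset (Fin N) := Finset.univ.filter fun i => n ≤ (i : ℕ)
  have hT : k + 1 ≤ T.card := by
    have h1 : (Finset.univ.filter fun i : Fin N => (i : ℕ) < n).card = n := by
      rw [Fin.card_filter_val_lt]; omega
    have h2 := Finset.card_filter_add_card_filter_not (s := (Finset.univ : Finset (Fin N)))
      (fun i : Fin N => (i : ℕ) < n)
    simp only [not_lt, Finset.card_univ, Fintype.card_fin] at h2
    change k + 1 ≤ (Finset.univ.filter fun i : Fin N => n ≤ (i : ℕ)).card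
    omega
  -- The last `k + 1` slots must host the elements of `I` beyond the first `n`; `T'` completes these
  -- to exactly `k + 1` positions.
  obtain ⟨T', hIT, hTT, hcard⟩ := Finset.exists_subsuperset_card_eq
    (s := I.filter fun i : Fin N => n ≤ (i : ℕ)) (t := T) (n := k + 1)
    (Finset.filter_subset_filter _ (Finset.subset_univ _))
    ((Finset.card_filter_le _ _).trans hI) hT
  have hmem : ∀ b, n ≤ (T'.orderEmbOfFin hcard b : ℕ) := fun b =>
    (Finset.mem_filter.1 (hTT (Finset.orderEmbOfFin_mem T' hcard b))).2
  let f : Fin (n + k + 1) → Fin N := fun a =>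
    if h : (a : ℕ) < n then ⟨a, by omega⟩ else T'.orderEmbOfFin hcard ⟨a - n, by omega⟩
  have hf1 : ∀ a : Fin (n + k + 1), (a : ℕ) < n → (f a : ℕ) = a := fun a h => by simp [f, h]
  have hf2 : ∀ a : Fin (n + k + 1), n ≤ (a : ℕ) → n ≤ (f a : ℕ) := fun a h => by
    simp only [f, not_lt.2 h, dite_false]
    exact hmem _
  have hinj : Function.Injective f := by
    intro a b hab
    by_cases ha : (a : ℕ) < n
    · by_cases hb : (b : ℕ) < n
      · ext
        rw [← hf1 a ha, ← hf1 b hb, hab]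
      · have h1 := hf1 a ha
        have h2 := hf2 b (not_lt.1 hb)
        rw [← hab] at h2
        omega
    · by_cases hb : (b : ℕ) < n
      · have h1 := hf1 b hb
        have h2 := hf2 a (not_lt.1 ha)
        rw [hab] at h2
        omega
      · simp only [f, ha, hb, dite_false, EmbeddingLike.apply_eq_iff_eq, Fin.mk.injEq] at hab
        ext
        omega
  have hrange : ∀ i ∈ I, ∃ a, f a = i := by
    intro i hi
    by_cases h : (i : ℕ) < n
    · refine ⟨⟨i, by omega⟩, ?_⟩
      ext
      rw [hf1 _ h]
    · have hi' : i ∈ T' := hIT (Finset.mem_filter.2 ⟨hi, not_lt.1 h⟩)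
      rw [← Finset.mem_coe, ← Finset.range_orderEmbOfFin T' hcard] at hi'
      obtain ⟨b, hb⟩ := hi'
      refine ⟨⟨n + b, by omega⟩, ?_⟩
      simp [f, hb]
  refine ⟨Finset.univ.filter fun a => f a ∈ I, ⟨f, hinj⟩, ?_, hf1, hf2⟩
  ext i
  simp only [Finset.mem_map, Finset.mem_filter, Finset.mem_univ, true_and,
    Function.Embedding.coeFn_mk]
  constructor
  · rintro ⟨a, ha, rfl⟩
    exact ha
  · intro hi
    obtain ⟨a, rfl⟩ := hrange i hi
    exact ⟨a, hi, rfl⟩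

/-- The set of variables, among `n + k + 1` ones, representing a set `I` of at most `k + 1` out
of `N` variables, relative to the first `n` variables. -/
def pattern (n k : ℕ) (I : Finset (Fin N)) : Finset (Fin (n + k + 1)) :=
  if h : n + k + 1 ≤ N ∧ I.card ≤ k + 1 then (exists_pattern h.1 h.2).choose else ∅

lemma pattern_spec {n k : ℕ} (hN : n + k + 1 ≤ N) {I : Finset (Fin N)} (hI : I.card ≤ k + 1) :
    ∃ e : Fin (n + k + 1) ↪ Fin N, (pattern n k I).map e = I ∧
      (∀ a : Fin (n + k + 1), (a : ℕ) < n → (e a : ℕ) = a) ∧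
      ∀ a : Fin (n + k + 1), n ≤ (a : ℕ) → n ≤ (e a : ℕ) := by
  rw [pattern, dif_pos ⟨hN, hI⟩]
  exact (exists_pattern hN hI).choose_spec

lemma card_pattern {n k : ℕ} (hN : n + k + 1 ≤ N) {I : Finset (Fin N)} (hI : I.card ≤ k + 1) :
    (pattern n k I).card = I.card := by
  obtain ⟨e, he, -⟩ := pattern_spec hN hI
  nth_rewrite 2 [← he]
  rw [Finset.card_map]

/-- A set avoiding the first `n` variables has its pattern in the slots padded by `1`; its divided
difference is thus taken at coinciding points. -/
lemma padOne_eq_one_of_mem_pattern {n k : ℕ} (hN : n + k + 1 ≤ N) {I : Finset (Fin N)}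
    (hI : I.card ≤ k + 1) (hd : ∀ i ∈ I, n ≤ (i : ℕ)) (u : Fin n → ℂ) {a : Fin (n + k + 1)}
    (ha : a ∈ pattern n k I) : padOne (n + k + 1) u a = 1 := by
  obtain ⟨e, he, h1, -⟩ := pattern_spec hN hI
  have h2 : e a ∈ I := by
    rw [← he]
    exact Finset.mem_map_of_mem e ha
  have h3 : ¬ (a : ℕ) < n := fun h => by
    have := hd _ h2
    rw [h1 a h] at this
    omega
  simp [padOne, h3]

/-- The characters in `n` variables as eigenfunctions, in terms of divided differences in
`n + k + 1` variables. -/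
theorem fallingSum_mul_fewChar (lam : Signature N) {n k : ℕ} (hN : n + k + 1 ≤ N)
    {E : ℕ → Finset (Fin (n + k + 1)) → (Fin (n + k + 1) → ℂ) → ℂ}
    (hE : ∀ l A, IsDivDiffExt (ball 1 1) A (derivFamily k (k - l) (fewChar lam)) (E l A))
    {u : Fin n → ℂ} (hu : u ∈ ball 1 1) :
    (fallingSum k lam : ℂ) * fewChar lam u =
      ∑ l ∈ Finset.range (k + 1), (k.choose l * l.factorial : ℂ) *
        ∑ I ∈ (Finset.univ : Finset (Fin N)).powersetCard (l + 1),
          E l (pattern n k I) (padOne (n + k + 1) u) := by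
  choose F hF using fun (l : ℕ) (I : Finset (Fin N)) => exists_isDivDiffExt_derivFamily
    (differentiableOn_normChar lam) (symmetricOn_normChar lam) k (k - l) I
  -- The eigenvalue identity in all `N` variables holds off the diagonals; continuity carries it to
  -- points with many coordinates equal to `1`.
  have h1 : EqOn (fun v => (fallingSum k lam : ℂ) * normChar lam v)
      (fun v => ∑ l ∈ Finset.range (k + 1), (k.choose l * l.factorial : ℂ) *
        ∑ I ∈ (Finset.univ : Finset (Fin N)).powersetCard (l + 1), F l I v) (ball 1 1) := by
    refine eqOn_of_eq_of_injOn isOpen_ball Finset.univ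
      ((differentiableOn_normChar lam).continuousOn.const_mul _) ?_ fun v hv hi => ?_
    · refine continuousOn_finsetSum _ fun l _ => continuousOn_const.mul ?_
      exact continuousOn_finsetSum _ fun I _ => (hF l I).differentiableOn.continuousOn
    · rw [Finset.coe_univ, injOn_univ] at hi
      rw [fallingSum_mul_normChar lam k hv hi]
      refine Finset.sum_congr rfl fun l _ => ?_
      congr 1
      exact Finset.sum_congr rfl fun I _ => ((hF l I).eq_divDiff v hv hi.injOn).symm
  rw [fewChar]
  refine (h1 (padOne_mem_ball hu)).trans ?_
  refine Finset.sum_congr rfl fun l hl => ?_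
  congr 1
  refine Finset.sum_congr rfl fun I hI => ?_
  have hc : I.card ≤ k + 1 := by
    rw [(Finset.mem_powersetCard.1 hI).2]
    exact Finset.mem_range.1 hl
  obtain ⟨e, he, he1, he2⟩ := pattern_spec hN hc
  have hFI := hF l I
  rw [← he] at hFI
  have hpad : padOne N u = Function.extend e (padOne (n + k + 1) u) 1 := by
    funext i
    by_cases hi : ∃ a, e a = i
    · obtain ⟨a, rfl⟩ := hi
      rw [e.injective.extend_apply]
      by_cases ha : (a : ℕ) < n
      · simp only [padOne, he1 a ha]
      · simp [padOne, ha, not_lt.2 (he2 a (not_lt.1 ha))]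
    · rw [Function.extend_apply' _ _ _ hi]
      have : ¬ (i : ℕ) < n := fun h => hi ⟨⟨i, by omega⟩, by ext; rw [he1 _ h]⟩
      simp [padOne, this]
  -- Restricting the extension over `I` gives an extension over the pattern, and extensions are
  -- unique.
  have := (hFI.comp_extend hN lam e (pattern n k I)).eqOn isOpen_ball (hE l (pattern n k I))
    (padOne_mem_ball hu)
  simp only [he, ← hpad] at this
  exact this

end FewVariables

/-! ### Derivatives of functions of exponential size: each `N⁻¹ ∂_i` contributes a factor `Q'(u_i)`.
-/

section Asymptotics

open Metric Set

lemma tendstoUniformlyOn_congr_eventually {α X : Type*} {l : Filter α} {s : Set X}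
    {F G : α → X → ℂ} {f g : X → ℂ} (h : TendstoUniformlyOn F f l s)
    (hFG : ∀ᶠ n in l, EqOn (F n) (G n) s) (hfg : EqOn f g s) : TendstoUniformlyOn G g l s :=
  (h.congr hFG).congr_right hfg

lemma tendstoLocallyUniformlyOn_congr_eventually {α X : Type*} [TopologicalSpace X] {l : Filter α}
    {s : Set X} {F G : α → X → ℂ} {f : X → ℂ} (h : TendstoLocallyUniformlyOn F f l s)
    (hFG : ∀ᶠ n in l, EqOn (F n) (G n) s) : TendstoLocallyUniformlyOn G f l s := by
  rw [Metric.tendstoLocallyUniformlyOn_iff] at h ⊢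
  intro ε hε x hx
  obtain ⟨t, ht, H⟩ := h ε hε x hx
  refine ⟨t ∩ s, inter_mem ht self_mem_nhdsWithin, ?_⟩
  filter_upwards [H, hFG] with n hn hn' y hy
  rw [← hn' hy.2]
  exact hn y hy.1

lemma differentiableOn_div {E : Type*} [NormedAddCommGroup E] [NormedSpace ℂ E] {f g : E → ℂ}
    {s : Set E} (hf : DifferentiableOn ℂ f s) (hg : DifferentiableOn ℂ g s)
    (h0 : ∀ x ∈ s, g x ≠ 0) : DifferentiableOn ℂ (fun x => f x / g x) s := by
  simpa only [div_eq_mul_inv] using hf.fun_mul (hg.fun_inv h0)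

variable {ι : Type*} [Fintype ι]

/-- The functions `S N` have holomorphic logarithms `L N` on the ball of radius `r`, and
`N⁻¹ L N → ∑ Q (u i)` uniformly. -/
structure IsLogRegular (Q : ℂ → ℂ) (r : ℝ) (S : ℕ → (ι → ℂ) → ℂ) (L : ℕ → (ι → ℂ) → ℂ) :
    Prop where
  differentiableOn_Q : DifferentiableOn ℂ Q (ball 1 r)
  differentiableOn_log : ∀ᶠ N in atTop, DifferentiableOn ℂ (L N) (ball 1 r)
  exp_log : ∀ᶠ N in atTop, ∀ u ∈ ball 1 r, Complex.exp (L N u) = S N u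
  log_one : ∀ᶠ N in atTop, L N 1 = 0
  tendsto_log : TendstoUniformlyOn (fun (N : ℕ) u => (1 / (N : ℂ)) * L N u) (fun u => ∑ i, Q (u i)) atTop
    (ball 1 r)

variable {Q : ℂ → ℂ} {r : ℝ} {S L : ℕ → (ι → ℂ) → ℂ}

lemma IsLogRegular.mono (h : IsLogRegular Q r S L) {r' : ℝ} (hr : r' ≤ r) :
    IsLogRegular Q r' S L where
  differentiableOn_Q := h.differentiableOn_Q.mono (ball_subset_ball hr)
  differentiableOn_log := h.differentiableOn_log.mono fun _ hN => hN.mono (ball_subset_ball hr)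
  exp_log := h.exp_log.mono fun _ hN u hu => hN u (ball_subset_ball hr hu)
  log_one := h.log_one
  tendsto_log := h.tendsto_log.mono (ball_subset_ball hr)

lemma apply_mem_ball_one {u : ι → ℂ} (hu : u ∈ ball 1 r) (i : ι) : u i ∈ ball (1 : ℂ) r := by
  have hr := pos_of_mem_ball hu
  rw [mem_ball, dist_pi_lt_iff hr] at hu
  exact hu i

lemma differentiableOn_comp_apply {q : ℂ → ℂ} (hq : DifferentiableOn ℂ q (ball 1 r)) (i : ι) :
    DifferentiableOn ℂ (fun u : ι → ℂ => q (u i)) (ball 1 r) :=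
  hq.comp (differentiable_apply i).differentiableOn fun _ hu => apply_mem_ball_one hu i

variable [DecidableEq ι]

lemma partialDeriv_sum_comp_apply (hQ : DifferentiableOn ℂ Q (ball 1 r)) (i : ι) {u : ι → ℂ}
    (hu : u ∈ ball 1 r) : partialDeriv i (fun u : ι → ℂ => ∑ j, Q (u j)) u = deriv Q (u i) := by
  rw [partialDeriv_sum isOpen_ball _ (fun j _ => differentiableOn_comp_apply hQ j) i hu,
    Finset.sum_eq_single i]
  · simp [partialDeriv]
  · intro j _ hj
    simp [partialDeriv, Function.update_of_ne hj]
  · simp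

/-- If `g N / S N → φ`, then `N⁻¹ ∂ᵢ (g N) / S N → φ Q'(u i)`. -/
theorem IsLogRegular.tendsto_partialDeriv_div (h : IsLogRegular Q r S L)
    {g : ℕ → (ι → ℂ) → ℂ} {φ : (ι → ℂ) → ℂ}
    (hg : ∀ᶠ N in atTop, DifferentiableOn ℂ (g N) (ball 1 r))
    (hφ : DifferentiableOn ℂ φ (ball 1 r))
    (H : TendstoLocallyUniformlyOn (fun (N : ℕ) u => g N u / S N u) φ atTop (ball 1 r)) (i : ι) :
    TendstoLocallyUniformlyOn (fun (N : ℕ) u => ((N : ℂ)⁻¹ * partialDeriv i (g N) u) / S N u)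
      (fun u => φ u * deriv Q (u i)) atTop (ball 1 r) := by
  have hexp : ∀ᶠ N in atTop, DifferentiableOn ℂ (fun u => Complex.exp (L N u)) (ball 1 r) :=
    h.differentiableOn_log.mono fun N hN => hN.cexp
  -- With `g = q exp L`, the quotient to be studied is `N⁻¹ ∂_i q + q ∂_i (N⁻¹ L)`. The first term
  -- tends to `0` because `∂_i q` converges, the second to `φ Q'(u_i)`.
  set q : ℕ → (ι → ℂ) → ℂ := fun (N : ℕ) u => g N u / Complex.exp (L N u)
  have hq : ∀ᶠ N in atTop, DifferentiableOn ℂ (q N) (ball 1 r) := by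
    filter_upwards [hg, hexp] with N h1 h2
    exact differentiableOn_div h1 h2 fun u _ => Complex.exp_ne_zero _
  have Hq : TendstoLocallyUniformlyOn q φ atTop (ball 1 r) := by
    refine tendstoLocallyUniformlyOn_congr_eventually H ?_
    filter_upwards [h.exp_log] with N hN u hu
    simp only [q, hN u hu]
  have hdq := TendstoLocallyUniformlyOn.partialDeriv isOpen_ball Hq hq hφ i
  have hl : TendstoLocallyUniformlyOn (fun (N : ℕ) u => (1 / (N : ℂ)) * L N u)
      (fun u => ∑ i, Q (u i)) atTop (ball 1 r) := h.tendsto_log.tendstoLocallyUniformlyOn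
  have hsum : DifferentiableOn ℂ (fun u : ι → ℂ => ∑ i, Q (u i)) (ball 1 r) :=
    DifferentiableOn.fun_sum fun j _ => differentiableOn_comp_apply h.differentiableOn_Q j
  have hdl := TendstoLocallyUniformlyOn.partialDeriv isOpen_ball hl
    (h.differentiableOn_log.mono fun N hN => (hN.const_mul _)) hsum i
  have hN0 : TendstoLocallyUniformlyOn (fun (N : ℕ) (_ : ι → ℂ) => (N : ℂ)⁻¹) (fun _ => 0) atTop
      (ball 1 r) := by
    refine TendstoUniformlyOn.tendstoLocallyUniformlyOn ?_
    exact Tendsto.tendstoUniformlyOn_const tendsto_inv_atTop_nhds_zero_nat _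
  have h1 := hN0.mul₀ hdq continuousOn_const
    (differentiableOn_partialDeriv isOpen_ball hφ i).continuousOn
  have h2 := Hq.mul₀ hdl hφ.continuousOn
    (differentiableOn_partialDeriv isOpen_ball hsum i).continuousOn
  have h3 := (h1.add h2).congr_right (g := fun u => φ u * deriv Q (u i)) (fun u hu => by
    simp [partialDeriv_sum_comp_apply h.differentiableOn_Q i hu])
  refine tendstoLocallyUniformlyOn_congr_eventually h3 ?_
  filter_upwards [hq, hexp, h.differentiableOn_log, h.exp_log] with N hqN heN hLN hSN u hu
  have e1 : EqOn (g N) (fun u => q N u * Complex.exp (L N u)) (ball 1 r) := fun v _ => by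
    simp only [q]
    rw [div_mul_cancel₀ _ (Complex.exp_ne_zero _)]
  have e2 : partialDeriv i (fun u => Complex.exp (L N u)) u =
      Complex.exp (L N u) * partialDeriv i (L N) u := by
    have := ((differentiableAt_slice isOpen_ball hLN hu i).hasDerivAt.cexp).deriv
    simpa [partialDeriv] using this
  show (N : ℂ)⁻¹ * partialDeriv i (q N) u + q N u * partialDeriv i (fun v => 1 / (N : ℂ) * L N v) u
    = (N : ℂ)⁻¹ * partialDeriv i (g N) u / S N u
  rw [partialDeriv_congr isOpen_ball e1 i hu, partialDeriv_mul isOpen_ball hqN heN i hu, e2,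
    ← hSN u hu]
  simp only [partialDeriv_const_mul]
  have := Complex.exp_ne_zero (L N u)
  field_simp

/-- Induction on `m`: the previous quotient, with its limit `κ Q'(u_i) ^ m`, is the input of the
next differentiation. -/
theorem IsLogRegular.tendsto_iterate_partialDeriv_div (h : IsLogRegular Q r S L)
    {f : ℕ → (ι → ℂ) → ℂ} {κ : ℂ}
    (hf : ∀ᶠ N in atTop, DifferentiableOn ℂ (f N) (ball 1 r))
    (H : TendstoUniformlyOn (fun N u => f N u / S N u) (fun _ => κ) atTop (ball 1 r)) (i : ι)
    (m : ℕ) :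
    TendstoLocallyUniformlyOn (fun (N : ℕ) u => (((N : ℂ) ^ m)⁻¹ * (partialDeriv i)^[m] (f N) u) / S N u)
      (fun u => κ * deriv Q (u i) ^ m) atTop (ball 1 r) := by
  induction m with
  | zero => simpa using H.tendstoLocallyUniformlyOn
  | succ m ih =>
    have hQ' : DifferentiableOn ℂ (deriv Q) (ball 1 r) := h.differentiableOn_Q.deriv isOpen_ball
    have h1 := h.tendsto_partialDeriv_div (hf.mono fun N hN =>
      (differentiableOn_iterate_partialDeriv isOpen_ball hN i m).const_mul (((N : ℂ) ^ m)⁻¹))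
      (((differentiableOn_comp_apply hQ' i).pow m).const_mul κ) ih i
    refine (tendstoLocallyUniformlyOn_congr_eventually h1 (Eventually.of_forall fun N u _ => ?_))
      |>.congr_right fun u _ => ?_
    · simp only [partialDeriv_const_mul, Function.iterate_succ_apply']
      ring
    · simp only [pow_succ, Pi.pow_apply]
      ring

/-- The scaled extended divided differences of `u i ^ k ∂ᵢ ^ m f` converge. -/
theorem IsLogRegular.tendsto_divDiffExt (Q : ℂ → ℂ) (k : ℕ) (hr : 0 < r) :
    ∃ r' : ℝ, 0 < r' ∧ r' ≤ r ∧ ∀ (S L : ℕ → (ι → ℂ) → ℂ), IsLogRegular Q r S L →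
      ∀ (f : ℕ → (ι → ℂ) → ℂ) (κ : ℂ),
      (∀ᶠ N in atTop, DifferentiableOn ℂ (f N) (ball 1 r)) →
      TendstoUniformlyOn (fun N u => f N u / S N u) (fun _ => κ) atTop (ball 1 r) →
      ∀ (m : ℕ) (A : Finset ι) (E : ℕ → (ι → ℂ) → ℂ),
        (∀ᶠ N in atTop, IsDivDiffExt (ball 1 r) A (derivFamily k m (f N)) (E N)) →
        ∃ e : (ι → ℂ) → ℂ, IsDivDiffExt (ball 1 r) A
          (fun i u => κ * (u i ^ k * deriv Q (u i) ^ m)) e ∧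
          (∃ B, ∀ u ∈ ball (1 : ι → ℂ) r', ‖e u‖ ≤ B) ∧
          TendstoUniformlyOn (fun (N : ℕ) u => (((N : ℂ) ^ m)⁻¹ * E N u) / S N u) e atTop
            (ball 1 r') := by
  -- The radius depends on the number of variables and on `r` only, so it serves all `m` and `A` at
  -- once.
  obtain ⟨r', C, hr', hle, hC, HC⟩ := exists_norm_divDiffExt_le ι (half_pos hr)
  refine ⟨r', hr', hle.trans (by linarith), ?_⟩
  intro S L h f κ hf H m A E hE
  have hQ' : DifferentiableOn ℂ (deriv Q) (ball 1 r) := h.differentiableOn_Q.deriv isOpen_ball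
  have hsub : ball (1 : ι → ℂ) (r / 2) ⊆ ball 1 r := ball_subset_ball (by linarith)
  have hcl : closedBall (1 : ι → ℂ) (r / 2) ⊆ ball 1 r := closedBall_subset_ball (by linarith)
  obtain ⟨e, he⟩ := exists_isDivDiffExt (O := ball (1 : ι → ℂ) r) isOpen_ball
    (fun a b _ hu => comp_swap_mem_ball a b hu)
    (g := fun i u => κ * (u i ^ k * deriv Q (u i) ^ m))
    (fun i => (((differentiable_apply i).pow k).differentiableOn.mul
      ((differentiableOn_comp_apply hQ' i).pow m)).const_mul κ)
    (fun a b c u _ => by simp) A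
  refine ⟨e, he, ?_, ?_⟩
  · obtain ⟨B, hB⟩ := (isCompact_closedBall (1 : ι → ℂ) (r / 2)).exists_bound_of_continuousOn
      (he.differentiableOn.continuousOn.mono hcl)
    exact ⟨B, fun u hu => hB u (ball_subset_closedBall (ball_subset_ball hle hu))⟩
  have hunif : ∀ i, TendstoUniformlyOn
      (fun (N : ℕ) u => (u i ^ k * (((N : ℂ) ^ m)⁻¹ * (partialDeriv i)^[m] (f N) u)) / S N u)
      (fun u => κ * (u i ^ k * deriv Q (u i) ^ m)) atTop (ball (1 : ι → ℂ) (r / 2)) := by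
    intro i
    have h1 := h.tendsto_iterate_partialDeriv_div hf H i m
    have h2 : TendstoLocallyUniformlyOn (fun (_ : ℕ) (u : ι → ℂ) => u i ^ k) (fun u => u i ^ k)
        atTop (ball 1 r) := by
      refine TendstoUniformlyOn.tendstoLocallyUniformlyOn ?_
      rw [Metric.tendstoUniformlyOn_iff]
      intro ε hε
      exact Eventually.of_forall fun _ _ _ => by simpa using hε
    have h3 := h2.mul₀ h1 (by fun_prop) ((((differentiableOn_comp_apply hQ' i).pow m).const_mul
      κ).continuousOn)
    rw [tendstoLocallyUniformlyOn_iff_forall_isCompact isOpen_ball] at h3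
    refine tendstoUniformlyOn_congr_eventually
      ((h3 _ hcl (isCompact_closedBall _ _)).mono ball_subset_closedBall)
      (Eventually.of_forall fun N u _ => ?_) fun u _ => ?_
    · simp only [Pi.mul_apply]; ring
    · simp only [Pi.mul_apply]; ring
  rw [Metric.tendstoUniformlyOn_iff]
  intro ε hε
  have hC1 : 0 < C + 1 := by linarith
  have hall : ∀ᶠ N : ℕ in atTop, ∀ i, ∀ u ∈ ball (1 : ι → ℂ) (r / 2),
      dist (κ * (u i ^ k * deriv Q (u i) ^ m))
        ((u i ^ k * (((N : ℂ) ^ m)⁻¹ * (partialDeriv i)^[m] (f N) u)) / S N u) < ε / (C + 1) := by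
    rw [eventually_all]
    exact fun i => Metric.tendstoUniformlyOn_iff.1 (hunif i) _ (by positivity)
  filter_upwards [hall, hE, h.differentiableOn_log, h.exp_log] with N hN hEN hLN hSN u hu
  have hS : DifferentiableOn ℂ (S N) (ball 1 r) := hLN.cexp.congr fun v hv => (hSN v hv).symm
  have hS0 : ∀ v ∈ ball (1 : ι → ℂ) r, S N v ≠ 0 := fun v hv =>
    hSN v hv ▸ Complex.exp_ne_zero _
  -- `S N` does not depend on the index `i`, so dividing by it commutes with divided differences.
  -- The error is then the extended divided difference of a uniformly small family, to which the
  -- norm bound applies.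
  have hext : IsDivDiffExt (ball 1 (r / 2)) A
      (fun i u => κ * (u i ^ k * deriv Q (u i) ^ m) -
        (u i ^ k * (((N : ℂ) ^ m)⁻¹ * (partialDeriv i)^[m] (f N) u)) / S N u)
      (fun u => e u - (((N : ℂ) ^ m)⁻¹ * E N u) / S N u) := by
    refine ⟨(he.differentiableOn.sub
      (differentiableOn_div (hEN.differentiableOn.const_mul _) hS hS0)).mono hsub,
      fun v hv hinj => ?_⟩
    rw [he.eq_divDiff v (hsub hv) hinj, hEN.eq_divDiff v (hsub hv) hinj]
    simp only [divDiff, derivFamily, Finset.mul_sum, Finset.sum_div, ← Finset.sum_sub_distrib]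
    exact Finset.sum_congr rfl fun i _ => by ring
  have h1 := HC A _ _ (ε / (C + 1)) (by positivity) hext
    (fun i _ v hv => by rw [← dist_eq_norm]; exact (hN i v hv).le) u hu
  rw [dist_eq_norm]
  refine h1.trans_lt ?_
  rw [mul_div_assoc', div_lt_iff₀ hC1]
  nlinarith

end Asymptotics

/-! ### Averages over subsets of fixed size are dominated by those avoiding the first `n` indices.
-/

section Averages

open Metric Set

lemma tendsto_choose_div_pow (p n : ℕ) :
    Tendsto (fun N : ℕ => ((N - n).choose p : ℝ) / (N : ℝ) ^ p) atTop
      (𝓝 (1 / p.factorial : ℝ)) := by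
  have h0 : Tendsto (fun N : ℕ => (N.choose p : ℝ) / ((N : ℝ) ^ p / p.factorial)) atTop (𝓝 1) := by
    refine (Asymptotics.isEquivalent_iff_tendsto_one ?_).1 (isEquivalent_choose p)
    filter_upwards [eventually_gt_atTop 0] with N hN
    positivity
  have h1 : Tendsto (fun N : ℕ => ((N - n : ℕ) : ℝ) / N) atTop (𝓝 1) := by
    have h2 : Tendsto (fun N : ℕ => 1 - (n : ℝ) / N) atTop (𝓝 (1 - 0)) :=
      tendsto_const_nhds.sub (tendsto_const_div_atTop_nhds_zero_nat _)
    rw [sub_zero] at h2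
    refine h2.congr' ?_
    filter_upwards [eventually_gt_atTop n] with N hN
    have : (N : ℝ) ≠ 0 := by
      have : 0 < N := by omega
      positivity
    rw [Nat.cast_sub hN.le]
    field_simp
  have h3 := ((h0.comp (tendsto_sub_atTop_nat n)).mul (h1.pow p)).mul_const (1 / p.factorial : ℝ)
  simp only [one_pow, one_mul, mul_one] at h3
  refine h3.congr' ?_
  filter_upwards [eventually_gt_atTop n] with N hN
  have h4 : (0 : ℝ) < ((N - n : ℕ) : ℝ) := by
    have : 0 < N - n := by omega
    positivity
  have h5 : (0 : ℝ) < N := by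
    have : 0 < N := by omega
    positivity
  simp only [Function.comp_apply, div_pow]
  field_simp

lemma card_filter_powersetCard_univ (N n p : ℕ) :
    ((Finset.univ.powersetCard p : Finset (Finset (Fin N))).filter
      fun I : Finset (Fin N) => ∀ i ∈ I, n ≤ (i : ℕ)).card = (N - n).choose p := by
  have h : ((Finset.univ.powersetCard p : Finset (Finset (Fin N))).filter
      fun I : Finset (Fin N) => ∀ i ∈ I, n ≤ (i : ℕ)) =
      (Finset.univ.filter fun i : Fin N => n ≤ (i : ℕ)).powersetCard p := by
    ext I
    simp only [Finset.mem_filter, Finset.mem_powersetCard, Finset.subset_iff, Finset.mem_univ,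
      true_and, implies_true]
    exact and_comm
  rw [h, Finset.card_powersetCard]
  congr 1
  have h2 := Finset.card_filter_add_card_filter_not (s := (Finset.univ : Finset (Fin N)))
    (fun i : Fin N => (i : ℕ) < n)
  simp only [not_lt, Finset.card_univ, Fintype.card_fin] at h2
  have h3 : (Finset.univ.filter fun i : Fin N => (i : ℕ) < n).card = min n N := by
    rw [← Finset.card_map Fin.valEmbedding,
      show (Finset.univ.filter fun i : Fin N => (i : ℕ) < n).map Fin.valEmbedding =
        Finset.range (min n N) from ?_, Finset.card_range]
    ext a
    simp only [Finset.mem_map, Finset.mem_filter, Finset.mem_univ, true_and, Finset.mem_range,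
      lt_min_iff, Fin.valEmbedding_apply]
    exact ⟨by rintro ⟨i, hi, rfl⟩; exact ⟨hi, i.2⟩, fun h => ⟨⟨a, h.2⟩, h.1, rfl⟩⟩
  omega

/-- Averages over subsets `I` of size `p` of quantities that only depend on the pattern of `I`
are governed by the subsets that avoid the first `n` elements. -/
theorem tendsto_average_pattern {X : Type*} {n k p : ℕ} (hp : p ≤ k + 1) {s : Set X}
    {E : ℕ → Finset (Fin (n + k + 1)) → X → ℂ} {e : Finset (Fin (n + k + 1)) → X → ℂ}
    (hE : ∀ A, A.card = p → TendstoUniformlyOn (fun N => E N A) (e A) atTop s) {B : ℝ}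
    (hB : ∀ A, A.card = p → ∀ x ∈ s, ‖e A x‖ ≤ B) {τ : ℂ}
    (hτ : ∀ N, n + k + 1 ≤ N → ∀ I : Finset (Fin N), I.card = p → (∀ i ∈ I, n ≤ (i : ℕ)) →
      ∀ x ∈ s, e (pattern n k I) x = τ) :
    TendstoUniformlyOn (fun (N : ℕ) x => ((N : ℂ) ^ p)⁻¹ *
      ∑ I ∈ (Finset.univ : Finset (Fin N)).powersetCard p, E N (pattern n k I) x)
      (fun _ => τ / p.factorial) atTop s := by
  rw [Metric.tendstoUniformlyOn_iff]
  intro ε hε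
  rcases s.eq_empty_or_nonempty with rfl | ⟨x₀, hx₀⟩
  · simp
  -- Crude bound for the subsets that meet the first `n` indices; their number divided by `N ^ p`
  -- tends to `0`.
  set D := |B| + ‖τ‖
  have hD : 0 ≤ D := by positivity
  have hc := tendsto_choose_div_pow p 0
  have hb := hc.sub (tendsto_choose_div_pow p n)
  have hlim : Tendsto (fun N : ℕ => (((N - 0).choose p : ℝ) / (N : ℝ) ^ p -
      ((N - n).choose p : ℝ) / (N : ℝ) ^ p) * D +
      |((N - 0).choose p : ℝ) / (N : ℝ) ^ p - 1 / p.factorial| * ‖τ‖) atTop (𝓝 0) := by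
    have := (hb.mul_const D).add (((hc.sub_const (1 / p.factorial : ℝ)).abs).mul_const ‖τ‖)
    simpa using this
  have hunif : ∀ᶠ N in atTop, ∀ A : Finset (Fin (n + k + 1)), A.card = p → ∀ x ∈ s,
      dist (e A x) (E N A x) < ε / 2 := by
    rw [eventually_all]
    intro A
    by_cases hA : A.card = p
    · filter_upwards [Metric.tendstoUniformlyOn_iff.1 (hE A hA) _ (half_pos hε)] with N hN _
      exact hN
    · exact Eventually.of_forall fun N h => absurd h hA
  filter_upwards [hunif, hlim.eventually (gt_mem_nhds (half_pos hε)),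
    eventually_ge_atTop (n + k + 1)] with N hN1 hN2 hN x hx
  have hN0 : (0 : ℝ) < N := by
    have : 0 < N := by omega
    positivity
  set P := (Finset.univ : Finset (Fin N)).powersetCard p
  have hP : P.card = N.choose p := by simp [P]
  simp only [Nat.sub_zero] at hN2
  have hterm : ∀ I ∈ P, ‖E N (pattern n k I) x - τ‖ ≤
      ε / 2 + if (∀ i ∈ I, n ≤ (i : ℕ)) then 0 else D := by
    intro I hI
    have hIc : I.card = p := (Finset.mem_powersetCard.1 hI).2
    have hpc : (pattern n k I).card = p := by rw [card_pattern hN (hIc.le.trans hp), hIc]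
    have h1 := (hN1 _ hpc x hx).le
    rw [dist_comm, dist_eq_norm] at h1
    split_ifs with hgood
    · rw [← hτ N hN I hIc hgood x hx]
      simpa using h1
    · calc ‖E N (pattern n k I) x - τ‖
          ≤ ‖E N (pattern n k I) x - e (pattern n k I) x‖ + ‖e (pattern n k I) x - τ‖ :=
            norm_sub_le_norm_sub_add_norm_sub _ _ _
        _ ≤ ε / 2 + D := by
            refine add_le_add h1 ((norm_sub_le _ _).trans ?_)
            exact add_le_add ((hB _ hpc x hx).trans (le_abs_self B)) le_rfl
  have hsum : ‖∑ I ∈ P, (E N (pattern n k I) x - τ)‖ ≤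
      (N.choose p : ℝ) * (ε / 2) + ((N.choose p : ℝ) - (N - n).choose p) * D := by
    refine (norm_sum_le_of_le _ hterm).trans (le_of_eq ?_)
    rw [Finset.sum_add_distrib, Finset.sum_const, hP, nsmul_eq_mul, Finset.sum_ite,
      Finset.sum_const_zero, zero_add, Finset.sum_const, nsmul_eq_mul]
    have h := Finset.card_filter_add_card_filter_not (s := P) (fun I => ∀ i ∈ I, n ≤ (i : ℕ))
    rw [card_filter_powersetCard_univ, hP] at h
    rw [← h]
    push_cast
    ring
  have hc1 : (N.choose p : ℝ) / (N : ℝ) ^ p ≤ 1 := by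
    rw [div_le_one (by positivity)]
    exact_mod_cast Nat.choose_le_pow N p
  -- Separates the deviation of the terms from `τ` and the deviation of `C(N,p) / N ^ p` from `1 /
  -- p!`.
  have hid : ((N : ℂ) ^ p)⁻¹ * ∑ I ∈ P, E N (pattern n k I) x - τ / p.factorial =
      ((N : ℂ) ^ p)⁻¹ * ∑ I ∈ P, (E N (pattern n k I) x - τ) +
        (((N.choose p : ℝ) / (N : ℝ) ^ p - 1 / p.factorial : ℝ) : ℂ) * τ := by
    rw [Finset.sum_sub_distrib, Finset.sum_const, hP, nsmul_eq_mul]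
    push_cast
    ring
  rw [dist_comm, dist_eq_norm, hid]
  refine (norm_add_le _ _).trans_lt ?_
  rw [norm_mul, norm_mul, norm_inv, norm_pow, Complex.norm_natCast, Complex.norm_real,
    Real.norm_eq_abs]
  have h2 : ((N : ℝ) ^ p)⁻¹ * ‖∑ I ∈ P, (E N (pattern n k I) x - τ)‖ ≤
      ((N : ℝ) ^ p)⁻¹ * ((N.choose p : ℝ) * (ε / 2) +
        ((N.choose p : ℝ) - (N - n).choose p) * D) := by gcongr
  have h3 : ((N : ℝ) ^ p)⁻¹ * ((N.choose p : ℝ) * (ε / 2) +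
        ((N.choose p : ℝ) - (N - n).choose p) * D) = (N.choose p : ℝ) / (N : ℝ) ^ p * (ε / 2) +
        ((N.choose p : ℝ) / (N : ℝ) ^ p - ((N - n).choose p : ℝ) / (N : ℝ) ^ p) * D := by
    ring
  have h4 : (N.choose p : ℝ) / (N : ℝ) ^ p * (ε / 2) ≤ 1 * (ε / 2) := by gcongr
  linarith

lemma tendstoUniformlyOn_sum_mul {α β X : Type*} {l : Filter β} {s : Set X} (t : Finset α)
    (c : α → ℂ) {F : α → β → X → ℂ} {f : α → X → ℂ}
    (h : ∀ a ∈ t, TendstoUniformlyOn (F a) (f a) l s) :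
    TendstoUniformlyOn (fun b x => ∑ a ∈ t, c a * F a b x) (fun x => ∑ a ∈ t, c a * f a x) l s := by
  classical
  induction t using Finset.induction_on with
  | empty =>
    simp only [Finset.sum_empty]
    rw [Metric.tendstoUniformlyOn_iff]
    intro ε hε
    simp [hε]
  | insert a t ha ih =>
    simp only [Finset.sum_insert ha]
    have h1 : TendstoUniformlyOn (fun b x => c a * F a b x) (fun x => c a * f a x) l s :=
      (uniformContinuous_const_smul (c a)).comp_tendstoUniformlyOn (h a (Finset.mem_insert_self a t))
    exact h1.add (ih fun b hb => h b (Finset.mem_insert_of_mem hb))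

end Averages

/-! ### Series of characters and divided differences applied term by term. -/

section UniformSums

open Metric Set

variable {N n : ℕ}

/-- `f` is the uniform sum near `1` of `ρ(λ) w(λ) χ_λ(u, 1, …, 1) / χ_λ(1, …, 1)`. -/
def HasUniformSum (ρ : Measure (Signature N)) (w : Signature N → ℝ) (f : (Fin n → ℂ) → ℂ) : Prop :=
  ∃ r : ℝ, 0 < r ∧ TendstoUniformlyOn
    (fun (s : Finset (Signature N)) u => ∑ lam ∈ s, ((ρ.real {lam} * w lam : ℝ) : ℂ) * fewChar lam u)
    f atTop (ball 1 r)

/-- The series gives symmetry only near `1`, on a radius that may depend on `N`; the identity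
theorem spreads it over the whole ball where `f` is holomorphic. -/
lemma HasUniformSum.symmetricOn {ρ : Measure (Signature N)} {w : Signature N → ℝ}
    {f : (Fin n → ℂ) → ℂ} (h : HasUniformSum ρ w f) (hn : n ≤ N) {r : ℝ}
    (hf : DifferentiableOn ℂ f (ball 1 r)) : SymmetricOn f (ball 1 r) := by
  obtain ⟨R, hR, hR'⟩ := h
  intro a b u hu
  refine eqOn_ball_of_eventuallyEq (f := fun u => f (u ∘ Equiv.swap a b)) (hf.comp
    (f := fun u : Fin n → ℂ => u ∘ Equiv.swap a b)
    (by
      refine Differentiable.differentiableOn ?_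
      rw [differentiable_pi]
      exact fun i => differentiable_apply _)
    fun v hv => comp_swap_mem_ball a b hv) hf ?_ hu
  filter_upwards [ball_mem_nhds (1 : Fin n → ℂ) (lt_min hR one_pos)] with v hv
  have hvR := ball_subset_ball (min_le_left R 1) hv
  have hv1 := ball_subset_ball (min_le_right R 1) hv
  refine tendsto_nhds_unique (hR'.tendsto_at (comp_swap_mem_ball a b hvR)) ?_
  simp only [symmetricOn_fewChar hn _ a b v hv1]
  exact hR'.tendsto_at hvR

/-- The bounded operator taking `f` to its extended divided difference is linear, so applied to the
remainders of the series it leaves them uniformly small. -/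
theorem HasUniformSum.divDiffExt {ρ : Measure (Signature N)} {w : Signature N → ℝ}
    {f : (Fin n → ℂ) → ℂ} (h : HasUniformSum ρ w f) {r : ℝ} (hr : 0 < r) (hr1 : r ≤ 1)
    (hf : DifferentiableOn ℂ f (ball 1 r)) (k m : ℕ) :
    ∃ r' : ℝ, 0 < r' ∧ ∀ (A : Finset (Fin n)) (E : (Fin n → ℂ) → ℂ)
      (F : Signature N → (Fin n → ℂ) → ℂ),
      IsDivDiffExt (ball 1 r) A (derivFamily k m f) E →
      (∀ lam, IsDivDiffExt (ball 1 1) A (derivFamily k m (fewChar lam)) (F lam)) →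
      TendstoUniformlyOn (fun (s : Finset (Signature N)) u =>
        ∑ lam ∈ s, ((ρ.real {lam} * w lam : ℝ) : ℂ) * F lam u) E atTop (ball 1 r') := by
  obtain ⟨R, hR, hR'⟩ := h
  set R₁ := min R r
  have hR₁ : 0 < R₁ := lt_min hR hr
  obtain ⟨r', C, hr', hle, hC, H⟩ := exists_norm_divDiffExt_derivFamily_le (Fin n) k m hR₁
  refine ⟨r', hr', fun A E F hE hF => ?_⟩
  have hsr : ball (1 : Fin n → ℂ) R₁ ⊆ ball 1 r := ball_subset_ball (min_le_right _ _)
  have hs1 : ball (1 : Fin n → ℂ) R₁ ⊆ ball 1 1 := hsr.trans (ball_subset_ball hr1)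
  rw [Metric.tendstoUniformlyOn_iff] at hR' ⊢
  intro ε hε
  have hC1 : 0 < C + 1 := by linarith
  filter_upwards [hR' (ε / (C + 1)) (by positivity)] with s hs u hu
  set a : Signature N → ℂ := fun lam => ((ρ.real {lam} * w lam : ℝ) : ℂ)
  have hd : ∀ lam : Signature N, DifferentiableOn ℂ (fewChar (n := n) lam) (ball 1 R₁) := fun lam =>
    (differentiableOn_fewChar lam).mono hs1
  have hda : ∀ lam ∈ s, DifferentiableOn ℂ (fun u => a lam * fewChar (n := n) lam u)
    (ball 1 R₁) := fun lam _ => (hd lam).const_mul _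
  have hsum : DifferentiableOn ℂ (fun u => ∑ lam ∈ s, a lam * fewChar (n := n) lam u)
    (ball 1 R₁) := DifferentiableOn.fun_sum hda
  have hext : IsDivDiffExt (ball 1 R₁) A
      (derivFamily k m fun u => f u - ∑ lam ∈ s, a lam * fewChar lam u)
      (fun u => E u - ∑ lam ∈ s, a lam * F lam u) := by
    refine ⟨(hE.differentiableOn.mono hsr).sub (DifferentiableOn.fun_sum fun lam _ =>
      ((hF lam).differentiableOn.mono hs1).const_mul _), fun v hv hinj => ?_⟩
    have h1 : ∀ i, derivFamily k m (fun u => f u - ∑ lam ∈ s, a lam * fewChar lam u) i v =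
        derivFamily k m f i v - ∑ lam ∈ s, a lam * derivFamily k m (fewChar lam) i v := by
      intro i
      simp only [derivFamily]
      rw [iterate_partialDeriv_sub isOpen_ball (hf.mono hsr) hsum i m hv]
      simp only
      rw [iterate_partialDeriv_sum isOpen_ball s hda i m hv]
      simp only [iterate_partialDeriv_const_mul, mul_sub, Finset.mul_sum]
      congr 1
      exact Finset.sum_congr rfl fun _ _ => by ring
    simp only [divDiff, h1, mul_sub, Finset.sum_sub_distrib, Finset.mul_sum]
    rw [hE.eq_divDiff v (hsr hv) hinj, Finset.sum_comm]
    congr 1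
    refine Finset.sum_congr rfl fun lam _ => ?_
    rw [(hF lam).eq_divDiff v (hs1 hv) hinj, divDiff, Finset.mul_sum]
    exact Finset.sum_congr rfl fun _ _ => by ring
  have h1 := H A _ _ (ε / (C + 1)) (by positivity) ((hf.mono hsr).sub hsum) hext
    (fun v hv => by
      rw [Pi.sub_apply, ← dist_eq_norm]
      exact (hs v (ball_subset_ball (min_le_left _ _) hv)).le) u hu
  rw [dist_eq_norm]
  refine h1.trans_lt ?_
  rw [mul_div_assoc', div_lt_iff₀ hC1]
  nlinarith

end UniformSums

/-! ### The inductive step: multiplying the weight by a scaled `fallingSum`. -/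

section WeightedLimits

open Metric Set

lemma padOne_padOne {n K N : ℕ} (hn : n ≤ K) (u : Fin n → ℂ) :
    padOne N (padOne K u) = padOne N u := by
  funext i
  by_cases h : (i : ℕ) < n
  · simp [padOne, h, h.trans_le hn]
  · simp [padOne, h]

/-- The logarithms of the character generating functions are asymptotically additive. -/
def HasRegularLog (ρ : (N : ℕ) → Measure (Signature N)) (Q : ℂ → ℂ) : Prop :=
  ∀ n : ℕ, 1 ≤ n → ∃ r : ℝ, 0 < r ∧ ∃ L : ℕ → (Fin n → ℂ) → ℂ,
    IsLogRegular Q r (fun N u => charGenFun (ρ N) (padOne N u)) L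

/-- The weighted sums `∑ ρ(λ) w(λ) χ_λ(u, 1, …, 1) / χ_λ(1, …, 1)` are asymptotic to `κ` times the
character generating function. -/
def HasWeightedLimit (ρ : (N : ℕ) → Measure (Signature N)) (w : (N : ℕ) → Signature N → ℝ)
    (κ : ℂ) : Prop :=
  ∀ n : ℕ, 1 ≤ n → ∃ r : ℝ, 0 < r ∧ r ≤ 1 ∧ ∃ f : ℕ → (Fin n → ℂ) → ℂ,
    (∀ᶠ N in atTop, DifferentiableOn ℂ (f N) (ball 1 r)) ∧
    (∀ᶠ N in atTop, HasUniformSum (ρ N) (w N) (f N)) ∧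
    TendstoUniformlyOn (fun N u => f N u / charGenFun (ρ N) (padOne N u)) (fun _ => κ) atTop
      (ball 1 r)

/-- The limit of the scaled expectation of `fallingSum k`. -/
def limitMoment (Q : ℂ → ℂ) (k : ℕ) : ℂ :=
  ∑ l ∈ Finset.range (k + 1), ((k.choose l * l.factorial : ℕ) : ℂ) *
    (iteratedDeriv l (fun u : ℂ => u ^ k * deriv Q u ^ (k - l)) 1 / l.factorial /
      (l + 1).factorial)

lemma analyticAt_pow_mul_deriv_pow {Q : ℂ → ℂ} (hQ : AnalyticAt ℂ Q 1) (k m : ℕ) :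
    AnalyticAt ℂ (fun u : ℂ => u ^ k * deriv Q u ^ m) 1 :=
  (analyticAt_id.pow k).mul (hQ.deriv.pow m)

lemma exists_pos_forall_mem {P : ℕ → ℝ → Prop} (s : Finset ℕ)
    (hP : ∀ l, ∃ r, 0 < r ∧ ∀ r', 0 < r' → r' ≤ r → P l r') : ∃ r, 0 < r ∧ ∀ l ∈ s, P l r := by
  have h : ∀ᶠ r in 𝓝[>] (0 : ℝ), ∀ l ∈ s, P l r := by
    rw [eventually_all_finset]
    intro l _
    obtain ⟨r, hr, H⟩ := hP l
    filter_upwards [Ioc_mem_nhdsGT hr] with x hx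
    exact H x hx.1 hx.2
  obtain ⟨r, hr, h0⟩ := (h.and self_mem_nhdsWithin).exists
  exact ⟨r, h0, hr⟩

/-- Applying the operator to the series multiplies each term by its eigenvalue. This identifies the
function built from divided differences of `f` with the series whose weight carries the extra
factor. -/
theorem HasUniformSum.fallingSum {n k N : ℕ} (hN : n + k + 1 ≤ N) {ρ : Measure (Signature N)}
    {w : Signature N → ℝ} {f : (Fin (n + k + 1) → ℂ) → ℂ} (h : HasUniformSum ρ w f) {r : ℝ}
    (hr : 0 < r) (hr1 : r ≤ 1) (hf : DifferentiableOn ℂ f (ball 1 r))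
    {E : ℕ → Finset (Fin (n + k + 1)) → (Fin (n + k + 1) → ℂ) → ℂ}
    (hE : ∀ l A, IsDivDiffExt (ball 1 r) A (derivFamily k (k - l) f) (E l A)) (a : ℝ) :
    HasUniformSum ρ (fun lam => a * fallingSum k lam * w lam)
      (fun u : Fin n → ℂ => (a : ℂ) * ∑ l ∈ Finset.range (k + 1),
        ((k.choose l * l.factorial : ℕ) : ℂ) *
          ∑ I ∈ (Finset.univ : Finset (Fin N)).powersetCard (l + 1),
            E l (pattern n k I) (padOne (n + k + 1) u)) := by
  have hF : ∀ (lam : Signature N) l (A : Finset (Fin (n + k + 1))),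
      ∃ e, IsDivDiffExt (ball 1 1) A (derivFamily k (k - l) (fewChar lam)) e := fun lam l A =>
    exists_isDivDiffExt_derivFamily (differentiableOn_fewChar lam) (symmetricOn_fewChar hN lam) _ _ A
  choose F hF using hF
  have hunif : ∀ l, ∃ r', 0 < r' ∧ ∀ r'', 0 < r'' → r'' ≤ r' → ∀ A,
      TendstoUniformlyOn (fun (s : Finset (Signature N)) u =>
        ∑ lam ∈ s, ((ρ.real {lam} * w lam : ℝ) : ℂ) * F lam l A u) (E l A) atTop
        (ball 1 r'') := by
    intro l
    obtain ⟨r', hr', H⟩ := h.divDiffExt hr hr1 hf k (k - l)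
    exact ⟨r', hr', fun r'' _ hle A =>
      (H A _ _ (hE l A) fun lam => hF lam l A).mono (ball_subset_ball hle)⟩
  obtain ⟨r', hr', H⟩ := exists_pos_forall_mem (Finset.range (k + 1)) hunif
  refine ⟨min r' 1, lt_min hr' one_pos, ?_⟩
  have hmaps : ball (1 : Fin n → ℂ) (min r' 1) ⊆ padOne (n + k + 1) ⁻¹' ball 1 r' := fun u hu =>
    padOne_mem_ball (ball_subset_ball (min_le_left _ _) hu)
  have h1 := tendstoUniformlyOn_sum_mul (Finset.range (k + 1))
    (fun l => (a : ℂ) * ((k.choose l * l.factorial : ℕ) : ℂ)) fun l hl =>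
      tendstoUniformlyOn_sum_mul ((Finset.univ : Finset (Fin N)).powersetCard (l + 1))
        (fun _ => (1 : ℂ)) fun I _ => ((H l hl (pattern n k I)).comp _).mono hmaps
  refine tendstoUniformlyOn_congr_eventually h1 (Eventually.of_forall fun s u hu => ?_)
    fun u _ => ?_
  · have hu1 : u ∈ ball (1 : Fin n → ℂ) 1 := ball_subset_ball (min_le_right _ _) hu
    have h2 : ∀ lam : Signature N,
        ((ρ.real {lam} * (a * UnitarySignature.fallingSum k lam * w lam) : ℝ) : ℂ) *
          fewChar lam u = ∑ l ∈ Finset.range (k + 1),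
            ∑ I ∈ (Finset.univ : Finset (Fin N)).powersetCard (l + 1),
            ((a : ℂ) * ((k.choose l * l.factorial : ℕ) : ℂ)) * (((ρ.real {lam} * w lam : ℝ) : ℂ) *
              F lam l (pattern n k I) (padOne (n + k + 1) u)) := by
      intro lam
      have h3 := fallingSum_mul_fewChar lam hN (hF lam) hu1
      calc ((ρ.real {lam} * (a * UnitarySignature.fallingSum k lam * w lam) : ℝ) : ℂ) *
            fewChar lam u = (a * (ρ.real {lam} * w lam : ℝ)) *
              ((UnitarySignature.fallingSum k lam : ℂ) * fewChar lam u) := by push_cast; ring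
        _ = _ := by
            rw [h3, Finset.mul_sum]
            refine Finset.sum_congr rfl fun l _ => ?_
            rw [Finset.mul_sum, Finset.mul_sum]
            refine Finset.sum_congr rfl fun I _ => ?_
            push_cast
            ring
    simp only [h2, Function.comp_apply, one_mul]
    rw [Finset.sum_comm]
    refine Finset.sum_congr rfl fun l _ => ?_
    rw [Finset.sum_comm, Finset.mul_sum]
    refine Finset.sum_congr rfl fun I _ => ?_
    rw [Finset.mul_sum]
  · simp only [Function.comp_apply, one_mul, Finset.mul_sum]
    refine Finset.sum_congr rfl fun l _ => Finset.sum_congr rfl fun I _ => ?_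
    ring

/-- Conclusion in `n` variables, hypothesis in `n + k + 1`: for this reason the property is required
for all `n`, and being reproduced it can be iterated. -/
theorem HasWeightedLimit.fallingSum {ρ : (N : ℕ) → Measure (Signature N)} {Q : ℂ → ℂ}
    (hQ : AnalyticAt ℂ Q 1) (hlog : HasRegularLog ρ Q) {w : (N : ℕ) → Signature N → ℝ} {κ : ℂ}
    (h : HasWeightedLimit ρ w κ) (k : ℕ) :
    HasWeightedLimit ρ (fun N lam => ((N : ℝ) ^ (k + 1))⁻¹ * fallingSum k lam * w N lam)
      (κ * limitMoment Q k) := by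
  intro n hn
  obtain ⟨r₁, hr₁, L, hL⟩ := hlog (n + k + 1) (by omega)
  obtain ⟨r₂, hr₂, hr₂1, f, hfd, hfs, hft⟩ := h (n + k + 1) (by omega)
  set r := min r₁ r₂
  have hr : 0 < r := lt_min hr₁ hr₂
  have hr1 : r ≤ 1 := (min_le_right _ _).trans hr₂1
  have hsub₂ : ball (1 : Fin (n + k + 1) → ℂ) r ⊆ ball 1 r₂ := ball_subset_ball (min_le_right _ _)
  replace hL := hL.mono (min_le_left r₁ r₂)
  replace hfd : ∀ᶠ N in atTop, DifferentiableOn ℂ (f N) (ball 1 r) :=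
    hfd.mono fun N hN => hN.mono hsub₂
  replace hft := hft.mono hsub₂
  obtain ⟨r', hr', hle, H⟩ := IsLogRegular.tendsto_divDiffExt (ι := Fin (n + k + 1)) Q k hr
  -- Holomorphy and symmetry are available only for large `N`; otherwise the junk value `0` is
  -- chosen.
  have hexE : ∀ N l (A : Finset (Fin (n + k + 1))), ∃ e, DifferentiableOn ℂ (f N) (ball 1 r) →
      SymmetricOn (f N) (ball 1 r) →
        IsDivDiffExt (ball 1 r) A (derivFamily k (k - l) (f N)) e := by
    intro N l A
    by_cases hd : DifferentiableOn ℂ (f N) (ball 1 r) ∧ SymmetricOn (f N) (ball 1 r)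
    · obtain ⟨e, he⟩ := exists_isDivDiffExt_derivFamily hd.1 hd.2 k (k - l) A
      exact ⟨e, fun _ _ => he⟩
    · exact ⟨0, fun h1 h2 => absurd ⟨h1, h2⟩ hd⟩
  choose E hE using hexE
  have hEN : ∀ᶠ N in atTop, ∀ l A,
      IsDivDiffExt (ball 1 r) A (derivFamily k (k - l) (f N)) (E N l A) := by
    filter_upwards [hfd, hfs, eventually_ge_atTop (n + k + 1)] with N h1 h2 h3 l A
    exact hE N l A h1 (h2.symmetricOn h3 h1)
  have hlim := fun l A => H _ L hL f κ hfd hft (k - l) A (fun N => E N l A)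
    (hEN.mono fun N hN => hN l A)
  choose e he hB ht using hlim
  choose B hB using hB
  have hmaps : ∀ R : ℝ, ball (1 : Fin n → ℂ) R ⊆ padOne (n + k + 1) ⁻¹' ball 1 R := fun R u hu =>
    padOne_mem_ball hu
  -- `N ^ (l+1)` normalizes the number of sets `I` and `N ^ (k-l)` the derivatives; together they
  -- make `N ^ (k+1)` for every `l`.
  have havg : ∀ l ∈ Finset.range (k + 1), TendstoUniformlyOn (fun (N : ℕ) (u : Fin n → ℂ) =>
      ((N : ℂ) ^ (l + 1))⁻¹ * ∑ I ∈ (Finset.univ : Finset (Fin N)).powersetCard (l + 1),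
        (((N : ℂ) ^ (k - l))⁻¹ * E N l (pattern n k I) (padOne (n + k + 1) u)) /
          charGenFun (ρ N) (padOne N (padOne (n + k + 1) u)))
      (fun _ => κ * (iteratedDeriv l (fun u : ℂ => u ^ k * deriv Q u ^ (k - l)) 1 / l.factorial) /
        (l + 1).factorial) atTop (ball 1 r') := by
    intro l hl
    have hlk : l ≤ k := Nat.lt_succ_iff.1 (Finset.mem_range.1 hl)
    refine tendsto_average_pattern (p := l + 1) (by omega)
      (E := fun N A u => (((N : ℂ) ^ (k - l))⁻¹ * E N l A (padOne (n + k + 1) u)) /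
          charGenFun (ρ N) (padOne N (padOne (n + k + 1) u)))
      (e := fun A u => e l A (padOne (n + k + 1) u))
      (fun A _ => ((ht l A).comp (padOne (n + k + 1))).mono (hmaps r'))
      (B := ∑ A, |B l A|) (fun A _ u hu => ?_) fun N hN I hI hgood u hu => ?_
    · refine ((hB l A _ (hmaps _ hu)).trans (le_abs_self _)).trans ?_
      exact Finset.single_le_sum (f := fun A => |B l A|) (fun _ _ => abs_nonneg _)
        (Finset.mem_univ A)
    · have hI' : I.card ≤ k + 1 := by omega
      have h1 := divDiffExt_eq_iteratedDeriv (l := l)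
        (q := fun z : ℂ => κ * (z ^ k * deriv Q z ^ (k - l)))
        (analyticAt_const.mul (analyticAt_pow_mul_deriv_pow hQ k (k - l)))
        (by rw [card_pattern hN hI', hI]) (he l (pattern n k I))
        (ball_subset_ball hle (hmaps _ hu))
        fun a ha => padOne_eq_one_of_mem_pattern hN hI' hgood u ha
      rw [h1, iteratedDeriv_const_mul_field, mul_div_assoc]
  -- The witness is the scaled operator applied to `f N`, extended across the diagonals and
  -- restricted to the first `n` variables.
  refine ⟨r', hr', hle.trans hr1, fun N u => (((N : ℝ) ^ (k + 1))⁻¹ : ℝ) *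
    ∑ l ∈ Finset.range (k + 1), ((k.choose l * l.factorial : ℕ) : ℂ) *
      ∑ I ∈ (Finset.univ : Finset (Fin N)).powersetCard (l + 1),
        E N l (pattern n k I) (padOne (n + k + 1) u), ?_, ?_, ?_⟩
  · filter_upwards [hEN] with N hN
    refine DifferentiableOn.const_mul (DifferentiableOn.fun_sum fun l _ =>
      DifferentiableOn.const_mul (DifferentiableOn.fun_sum fun I _ => ?_) _) _
    exact (hN l _).differentiableOn.comp differentiable_padOne.differentiableOn
      fun u hu => ball_subset_ball hle (hmaps _ hu)
  · filter_upwards [hEN, hfd, hfs, eventually_ge_atTop (n + k + 1)] with N h1 h2 h3 h4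
    exact h3.fallingSum h4 hr hr1 h2 h1 _
  · refine tendstoUniformlyOn_congr_eventually (tendstoUniformlyOn_sum_mul (Finset.range (k + 1))
      (fun l => ((k.choose l * l.factorial : ℕ) : ℂ)) havg) ?_ fun u _ => ?_
    · filter_upwards [eventually_ge_atTop (n + k + 1)] with N hN u hu
      have hN0 : (N : ℂ) ≠ 0 := by
        have : N ≠ 0 := by omega
        exact_mod_cast this
      simp only
      rw [padOne_padOne (by omega : n ≤ n + k + 1), mul_div_assoc, Finset.sum_div, Finset.mul_sum]
      refine Finset.sum_congr rfl fun l hl => ?_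
      have hlk : l ≤ k := Nat.lt_succ_iff.1 (Finset.mem_range.1 hl)
      have hpow : (N : ℂ) ^ (k + 1) = (N : ℂ) ^ (l + 1) * (N : ℂ) ^ (k - l) := by
        rw [← pow_add]; congr 1; omega
      simp only [Finset.sum_div, Finset.mul_sum]
      refine Finset.sum_congr rfl fun I _ => ?_
      push_cast
      rw [hpow]
      ring
    · simp only [limitMoment, Finset.mul_sum]
      refine Finset.sum_congr rfl fun l _ => ?_
      ring

/-- The hypotheses of the theorem yield additive logarithms. -/
theorem hasRegularLog_of_logCharGenTendsto {ρ : (N : ℕ) → Measure (Signature N)} {Q : ℂ → ℂ}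
    (hQ : AnalyticAt ℂ Q 1) (hlim : ∀ k : ℕ, 1 ≤ k → LogCharGenTendsto ρ Q k) :
    HasRegularLog ρ Q := by
  intro n hn
  obtain ⟨U, hU, h1U, L, hL, ht⟩ := hlim n hn
  obtain ⟨r₁, hr₁, hsub⟩ := Metric.isOpen_iff.1 hU 1 h1U
  obtain ⟨V, hV, hQV⟩ := hQ.exists_mem_nhds_analyticOnNhd
  obtain ⟨r₂, hr₂, hsub₂⟩ := Metric.mem_nhds_iff.1 hV
  have hs : ball (1 : Fin n → ℂ) (min r₁ r₂) ⊆ U := (ball_subset_ball (min_le_left _ _)).trans hsub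
  refine ⟨min r₁ r₂, lt_min hr₁ hr₂, L, ?_, ?_, ?_, ?_, ht.mono hs⟩
  · exact (hQV.mono ((ball_subset_ball (min_le_right _ _)).trans hsub₂)).differentiableOn
  · exact hL.mono fun N hN => hN.1.mono hs
  · exact hL.mono fun N hN u hu => hN.2.2 u (hs hu)
  · exact hL.mono fun N hN => hN.2.1

theorem CharGenConverges.hasUniformSum {n N : ℕ} {ρ : Measure (Signature N)}
    (h : CharGenConverges ρ) :
    HasUniformSum ρ (fun _ => 1) fun u : Fin n → ℂ => charGenFun ρ (padOne N u) := by
  obtain ⟨V, hV, h1V, hs⟩ := h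
  obtain ⟨r, hr, hsub⟩ := Metric.isOpen_iff.1 hV 1 h1V
  refine ⟨r, hr, ?_⟩
  have h1 := hasSumUniformlyOn_iff_tendstoUniformlyOn.1 hs.hasSumUniformlyOn
  have h2 := (h1.comp (padOne N : (Fin n → ℂ) → Fin N → ℂ)).mono
    (s' := ball 1 r) fun u hu => hsub (padOne_mem_ball hu)
  refine tendstoUniformlyOn_congr_eventually h2 (Eventually.of_forall fun s u _ => ?_)
    fun u _ => rfl
  simp only [Function.comp_apply, mul_one]
  rfl

/-- Start of the iteration: with weight `1` the function is `S` itself, which is zero-free because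
it is an exponential. -/
theorem HasRegularLog.hasWeightedLimit_one {ρ : (N : ℕ) → Measure (Signature N)} {Q : ℂ → ℂ}
    (hlog : HasRegularLog ρ Q) (hconv : ∀ N : ℕ, 1 ≤ N → CharGenConverges (ρ N)) :
    HasWeightedLimit ρ (fun _ _ => 1) 1 := by
  intro n hn
  obtain ⟨r, hr, L, hL⟩ := hlog n hn
  replace hL := hL.mono (min_le_left r 1)
  refine ⟨min r 1, lt_min hr one_pos, min_le_right _ _,
    fun N u => charGenFun (ρ N) (padOne N u), ?_, ?_, ?_⟩
  · filter_upwards [hL.differentiableOn_log, hL.exp_log] with N h1 h2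
    exact h1.cexp.congr fun u hu => (h2 u hu).symm
  · filter_upwards [eventually_ge_atTop 1] with N hN
    exact (hconv N hN).hasUniformSum
  · rw [Metric.tendstoUniformlyOn_iff]
    intro ε hε
    filter_upwards [hL.exp_log] with N hN u hu
    rw [div_self (hN u hu ▸ Complex.exp_ne_zero _)]
    simpa using hε

end WeightedLimits

/-! ### Chebyshev's inequality and a limit measure from convergent moments. -/

section Moments

open Set

/-- Real summability is absolute, so convergence of the series already gives integrability. -/
lemma integrable_of_hasSum {α : Type*} [Countable α] [MeasurableSpace α]
    [MeasurableSingletonClass α] {μ : Measure α} [IsFiniteMeasure μ] {w : α → ℝ} {s : ℝ}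
    (h : HasSum (fun a => μ.real {a} * w a) s) : Integrable w μ ∧ ∫ a, w a ∂μ = s := by
  have hint : Integrable w μ := by
    refine ⟨(measurable_of_countable w).aestronglyMeasurable, ?_⟩
    rw [hasFiniteIntegral_iff_enorm, lintegral_countable']
    have h1 : ∀ a, ‖w a‖ₑ * μ {a} = ‖μ.real {a} * w a‖ₑ := by
      intro a
      rw [enorm_mul, mul_comm, Real.enorm_of_nonneg measureReal_nonneg, ofReal_measureReal]
    simp only [h1]
    have h2 := h.summable.abs
    calc ∑' a, ‖μ.real {a} * w a‖ₑ = ∑' a, ENNReal.ofReal |μ.real {a} * w a| := by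
          simp only [Real.enorm_eq_ofReal_abs]
      _ = ENNReal.ofReal (∑' a, |μ.real {a} * w a|) :=
          (ENNReal.ofReal_tsum_of_nonneg (fun _ => abs_nonneg _) h2).symm
      _ < ⊤ := ENNReal.ofReal_lt_top
  refine ⟨hint, ?_⟩
  rw [integral_countable hint, ← h.tsum_eq]
  rfl

/-- Chebyshev: convergence of the first two moments to those of a constant implies convergence in
probability. -/
theorem tendsto_measure_of_tendsto_integral_sq {α : ℕ → Type*} [∀ N, MeasurableSpace (α N)]
    {μ : (N : ℕ) → Measure (α N)} (hμ : ∀ᶠ N in atTop, IsProbabilityMeasure (μ N))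
    {X : (N : ℕ) → α N → ℝ} {c : ℝ} (h1 : ∀ᶠ N in atTop, Integrable (X N) (μ N))
    (h2 : ∀ᶠ N in atTop, Integrable (fun a => X N a ^ 2) (μ N))
    (hX : Tendsto (fun N => ∫ a, X N a ∂μ N) atTop (𝓝 c))
    (hX2 : Tendsto (fun N => ∫ a, X N a ^ 2 ∂μ N) atTop (𝓝 (c ^ 2))) {ε : ℝ} (hε : 0 < ε) :
    Tendsto (fun N => μ N {a | ε ≤ |X N a - c|}) atTop (𝓝 0) := by
  have hlim : Tendsto (fun N => ENNReal.ofReal ((∫ a, X N a ^ 2 ∂μ N - 2 * c * ∫ a, X N a ∂μ N +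
      c ^ 2) / ε ^ 2)) atTop (𝓝 0) := by
    have := ((hX2.sub (hX.const_mul (2 * c))).add_const (c ^ 2)).div_const (ε ^ 2)
    rw [show (c ^ 2 - 2 * c * c + c ^ 2) / ε ^ 2 = 0 by ring] at this
    simpa using ENNReal.tendsto_ofReal this
  refine tendsto_of_tendsto_of_tendsto_of_le_of_le' tendsto_const_nhds hlim
    (Eventually.of_forall fun _ => zero_le) ?_
  filter_upwards [hμ, h1, h2] with N hN i1 i2
  have i3 : Integrable (fun a => (X N a - c) ^ 2) (μ N) := by
    refine ((i2.sub (i1.const_mul (2 * c))).add (integrable_const (c ^ 2))).congr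
      (Eventually.of_forall fun a => ?_)
    simp only [Pi.add_apply, Pi.sub_apply]
    ring
  -- The mean square deviation tends to `c ^ 2 - 2 c c + c ^ 2 = 0`.
  have e3 : ∫ a, (X N a - c) ^ 2 ∂μ N =
      ∫ a, X N a ^ 2 ∂μ N - 2 * c * ∫ a, X N a ∂μ N + c ^ 2 := by
    have : ∀ a, (X N a - c) ^ 2 = X N a ^ 2 - 2 * c * X N a + c ^ 2 := fun a => by ring
    simp only [this]
    rw [integral_add (f := fun a => X N a ^ 2 - 2 * c * X N a)
      (i2.sub (i1.const_mul (2 * c))) (integrable_const _), integral_sub i2 (i1.const_mul (2 * c)), integral_const_mul]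
    simp
  have h4 := mul_meas_ge_le_integral_of_nonneg
    (Eventually.of_forall fun a => sq_nonneg (X N a - c)) i3 (ε ^ 2)
  have hset : {a | ε ≤ |X N a - c|} = {a | ε ^ 2 ≤ (X N a - c) ^ 2} := by
    ext a
    simp only [mem_ofPred_eq]
    rw [← sq_abs (X N a - c)]
    exact (sq_le_sq₀ hε.le (abs_nonneg _)).symm
  rw [hset, ← ofReal_measureReal]
  refine ENNReal.ofReal_le_ofReal ?_
  rw [le_div_iff₀ (by positivity), ← e3, mul_comm]
  exact h4

/-- Truncation at height `R`. -/
def clip (R y : ℝ) : ℝ := max (-R) (min y R)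

lemma abs_clip_le {R : ℝ} (hR : 0 ≤ R) (y : ℝ) : |clip R y| ≤ R := by
  rw [abs_le, clip]
  exact ⟨le_max_left _ _, max_le (by linarith) (min_le_right _ _)⟩

/-- Truncation acts only where `|y| > R`, and there `|y| ≤ y ^ 2 / R`. Thus the `2n`-th moment
controls the truncation of the `n`-th. -/
lemma abs_sub_clip_le {R : ℝ} (hR : 0 < R) (y : ℝ) : |y - clip R y| ≤ y ^ 2 / R := by
  rw [le_div_iff₀ hR, clip]
  rcases le_total y R with h1 | h1
  · rw [min_eq_left h1]
    rcases le_total (-R) y with h2 | h2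
    · rw [max_eq_right h2]
      simpa using sq_nonneg y
    · rw [max_eq_left h2, abs_of_nonpos (by linarith)]
      nlinarith
  · rw [min_eq_right h1, max_eq_right (by linarith), abs_of_nonneg (by linarith)]
    nlinarith

/-- The truncated monomial as a bounded continuous function. -/
def clipPow (R : ℝ) (hR : 0 ≤ R) (n : ℕ) : BoundedContinuousFunction ℝ ℝ :=
  BoundedContinuousFunction.ofNormedAddCommGroup (fun x => clip R (x ^ n))
    (by unfold clip; fun_prop) R fun x => abs_clip_le hR _

lemma abs_integral_pow_sub_clipPow_le {μ : Measure ℝ} [IsFiniteMeasure μ] {n : ℕ} {R : ℝ}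
    (hR : 0 < R) (h1 : Integrable (fun x : ℝ => x ^ n) μ)
    (h2 : Integrable (fun x : ℝ => x ^ (2 * n)) μ) :
    |∫ x, x ^ n ∂μ - ∫ x, clipPow R hR.le n x ∂μ| ≤ (∫ x, x ^ (2 * n) ∂μ) / R := by
  rw [← integral_sub h1 ((clipPow R hR.le n).integrable μ), ← integral_div]
  refine (abs_integral_le_integral_abs).trans (integral_mono ?_ (h2.div_const R) fun x => ?_)
  · exact (h1.sub ((clipPow R hR.le n).integrable μ)).abs
  · have := abs_sub_clip_le hR (x ^ n)
    rwa [← pow_mul, mul_comm n 2] at this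

/-- Monotone convergence: an even power is the increasing supremum of its truncations. -/
lemma integrable_pow_of_integral_clipPow_le {μ : Measure ℝ} [IsFiniteMeasure μ] {p : ℕ} {C : ℝ}
    (h : ∀ (R : ℕ), ∫ x, clipPow R R.cast_nonneg (2 * p) x ∂μ ≤ C) :
    Integrable (fun x : ℝ => x ^ (2 * p)) μ := by
  have h0 : ∀ x : ℝ, 0 ≤ x ^ (2 * p) := fun x => by rw [pow_mul]; positivity
  have hclip : ∀ (R : ℕ) (x : ℝ), clipPow R R.cast_nonneg (2 * p) x = min (x ^ (2 * p)) R := by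
    intro R x
    show max (-(R : ℝ)) (min (x ^ (2 * p)) R) = _
    rw [max_eq_right]
    exact le_min ((neg_nonpos.2 R.cast_nonneg).trans (h0 x))
      ((neg_nonpos.2 R.cast_nonneg).trans R.cast_nonneg)
  refine ⟨by fun_prop, ?_⟩
  rw [hasFiniteIntegral_iff_ofReal (Eventually.of_forall h0)]
  have hsup : ∀ x : ℝ, ENNReal.ofReal (x ^ (2 * p)) =
      ⨆ R : ℕ, ENNReal.ofReal (min (x ^ (2 * p)) R) := by
    intro x
    refine le_antisymm ?_ (iSup_le fun R => ENNReal.ofReal_le_ofReal (min_le_left _ _))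
    obtain ⟨R, hR⟩ := exists_nat_ge (x ^ (2 * p))
    refine le_iSup_of_le R ?_
    rw [min_eq_left hR]
  simp only [hsup]
  rw [lintegral_iSup (fun R => by fun_prop)]
  · refine lt_of_le_of_lt (iSup_le fun R => ?_) (ENNReal.ofReal_lt_top (r := C))
    rw [← ofReal_integral_eq_lintegral_ofReal]
    · refine ENNReal.ofReal_le_ofReal ?_
      have := h R
      simp only [hclip] at this
      exact this
    · have := (clipPow R R.cast_nonneg (2 * p)).integrable μ
      refine this.congr (Eventually.of_forall fun x => hclip R x)
    · exact Eventually.of_forall fun x => le_min (h0 x) R.cast_nonneg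
  · intro R R' hRR' x
    exact ENNReal.ofReal_le_ofReal (min_le_min le_rfl (by exact_mod_cast hRR'))

lemma integrable_pow_of_integrable_pow_two_mul {μ : Measure ℝ} [IsFiniteMeasure μ] {n : ℕ}
    (h : Integrable (fun x : ℝ => x ^ (2 * n)) μ) : Integrable (fun x : ℝ => x ^ n) μ := by
  refine Integrable.mono' (h.add (integrable_const 1)) (by fun_prop)
    (Eventually.of_forall fun x => ?_)
  simp only [Pi.add_apply, Real.norm_eq_abs]
  rw [mul_comm, pow_mul, ← sq_abs]
  nlinarith [sq_nonneg (|x ^ n| - 1)]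

lemma measure_abs_gt_le {μ : Measure ℝ} [IsProbabilityMeasure μ]
    (h2 : Integrable (fun x : ℝ => x ^ 2) μ) {C : ℝ} (hC : ∫ x, x ^ 2 ∂μ ≤ C) {r : ℝ}
    (hr : 0 < r) : μ {x | r < ‖x‖} ≤ ENNReal.ofReal (C / r ^ 2) := by
  have h4 := mul_meas_ge_le_integral_of_nonneg
    (Eventually.of_forall fun x : ℝ => sq_nonneg x) h2 (r ^ 2)
  have hsub : {x : ℝ | r < ‖x‖} ⊆ {x | r ^ 2 ≤ x ^ 2} := fun x hx => by
    simp only [mem_ofPred_eq, Real.norm_eq_abs] at hx ⊢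
    rw [← sq_abs x]
    exact pow_le_pow_left₀ hr.le hx.le 2
  refine (measure_mono hsub).trans ?_
  rw [← ofReal_measureReal]
  refine ENNReal.ofReal_le_ofReal ?_
  rw [le_div_iff₀ (by positivity), mul_comm]
  exact h4.trans hC

/-- A sequence of probability measures whose moments all converge has a limit point with the
limiting moments. -/
theorem exists_measure_of_tendsto_moments {ν : ℕ → Measure ℝ} (hν : ∀ J, IsProbabilityMeasure (ν J))
    (hint : ∀ J n, Integrable (fun x : ℝ => x ^ n) (ν J)) {c : ℕ → ℝ}
    (hc : ∀ n, Tendsto (fun J => ∫ x, x ^ n ∂ν J) atTop (𝓝 (c n))) :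
    ∃ m : Measure ℝ, IsProbabilityMeasure m ∧
      ∀ n, Integrable (fun x : ℝ => x ^ n) m ∧ ∫ x, x ^ n ∂m = c n := by
  let P : ℕ → ProbabilityMeasure ℝ := fun J => ⟨ν J, hν J⟩
  obtain ⟨C, hC⟩ := (hc 2).bddAbove_range
  have hC' : ∀ J, ∫ x, x ^ 2 ∂ν J ≤ C := fun J => hC ⟨J, rfl⟩
  -- Bounded second moments give tightness by Chebyshev.
  have htight : IsTightMeasureSet {((μ : ProbabilityMeasure ℝ) : Measure ℝ) | μ ∈ range P} := by
    refine isTightMeasureSet_of_tendsto_measure_norm_gt ?_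
    have hlim : Tendsto (fun r : ℝ => ENNReal.ofReal (C / r ^ 2)) atTop (𝓝 0) := by
      have : Tendsto (fun r : ℝ => C / r ^ 2) atTop (𝓝 0) :=
        tendsto_const_nhds.div_atTop (tendsto_pow_atTop two_ne_zero)
      simpa using ENNReal.tendsto_ofReal this
    refine tendsto_of_tendsto_of_tendsto_of_le_of_le' tendsto_const_nhds hlim
      (Eventually.of_forall fun _ => zero_le) ?_
    filter_upwards [eventually_gt_atTop 0] with r hr
    refine iSup₂_le ?_
    rintro _ ⟨_, ⟨J, rfl⟩, rfl⟩
    have := hν J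
    exact measure_abs_gt_le (hint J 2) (hC' J) hr
  have hcpt := isCompact_closure_of_isTightMeasureSet htight
  -- An ultrafilter finer than `atTop` replaces a weakly convergent subsequence.
  let U : Ultrafilter ℕ := hyperfilter ℕ
  have hU : (U : Filter ℕ) ≤ atTop := Nat.hyperfilter_le_atTop
  obtain ⟨m, -, hm⟩ := hcpt.ultrafilter_le_nhds (U.map P) (by
    rw [le_principal_iff]
    exact (Eventually.of_forall fun J => subset_closure ⟨J, rfl⟩ :
      ∀ᶠ J in (U : Filter ℕ), P J ∈ closure (range P)))
  have hm' : Tendsto P U (𝓝 m) := hm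
  rw [ProbabilityMeasure.tendsto_iff_forall_integral_tendsto] at hm'
  have hcU : ∀ n, Tendsto (fun J => ∫ x, x ^ n ∂ν J) U (𝓝 (c n)) := fun n => (hc n).mono_left hU
  have hclip : ∀ (R : ℝ) (hR : 0 ≤ R) (n : ℕ), Tendsto (fun J => ∫ x, clipPow R hR n x ∂ν J) U
      (𝓝 (∫ x, clipPow R hR n x ∂(m : Measure ℝ))) := fun R hR n => hm' (clipPow R hR n)
  have heven : ∀ p, Integrable (fun x : ℝ => x ^ (2 * p)) (m : Measure ℝ) := by
    intro p
    refine integrable_pow_of_integral_clipPow_le (C := c (2 * p)) fun R => ?_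
    refine le_of_tendsto_of_tendsto' (hclip R R.cast_nonneg (2 * p)) (hcU (2 * p)) fun J => ?_
    have := hν J
    refine integral_mono ((clipPow R R.cast_nonneg (2 * p)).integrable _) (hint J _) fun x => ?_
    show max (-(R : ℝ)) (min (x ^ (2 * p)) R) ≤ x ^ (2 * p)
    refine max_le ?_ (min_le_left _ _)
    have : 0 ≤ x ^ (2 * p) := by rw [pow_mul]; positivity
    exact (neg_nonpos.2 R.cast_nonneg).trans this
  have hall : ∀ n, Integrable (fun x : ℝ => x ^ n) (m : Measure ℝ) := fun n =>
    integrable_pow_of_integrable_pow_two_mul (heven n)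
  refine ⟨m, inferInstance, fun n => ⟨hall n, ?_⟩⟩
  set D := ∫ x, x ^ (2 * n) ∂(m : Measure ℝ)
  -- Compare both moments with the truncated one, which passes to the weak limit; then let `R` grow.
  have hbound : ∀ R : ℝ, 0 < R → |∫ x, x ^ n ∂(m : Measure ℝ) - c n| ≤ (D + c (2 * n)) / R := by
    intro R hR
    have h1 := abs_integral_pow_sub_clipPow_le hR (hall n) (heven n)
    have h2 : |c n - ∫ x, clipPow R hR.le n x ∂(m : Measure ℝ)| ≤ c (2 * n) / R := by
      refine le_of_tendsto_of_tendsto' ((hcU n).sub (hclip R hR.le n)).abs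
        ((hcU (2 * n)).div_const R) fun J => ?_
      have := hν J
      exact abs_integral_pow_sub_clipPow_le hR (hint J n) (hint J (2 * n))
    rw [add_div]
    have h3 := abs_sub_le (∫ x, x ^ n ∂(m : Measure ℝ)) (∫ x, clipPow R hR.le n x ∂(m : Measure ℝ))
      (c n)
    rw [abs_sub_comm (c n)] at h2
    linarith
  have hlim : Tendsto (fun R : ℝ => (D + c (2 * n)) / R) atTop (𝓝 0) :=
    tendsto_const_nhds.div_atTop tendsto_id
  have h0 := ge_of_tendsto hlim ((eventually_gt_atTop 0).mono hbound)
  have := abs_nonpos_iff.1 h0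
  linarith

end Moments

/-! ### Expectations of moments, concentration, and the deterministic limit. -/

section Expectations

open Metric Set

lemma hasSum_measureReal_singleton {α : Type*} [Countable α] [MeasurableSpace α]
    [MeasurableSingletonClass α] (μ : Measure α) [IsProbabilityMeasure μ] :
    HasSum (fun a => μ.real {a}) 1 := by
  have h : ∑' a, μ {a} = 1 := by
    have := lintegral_countable' (μ := μ) fun _ => 1
    simpa using this.symm
  have hne : ∑' a, μ {a} ≠ ⊤ := by rw [h]; exact ENNReal.one_ne_top
  have h2 := ENNReal.hasSum_toReal hne
  rw [← ENNReal.tsum_toReal_eq fun a => ENNReal.ne_top_of_tsum_ne_top hne a, h,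
    ENNReal.toReal_one] at h2
  exact h2

lemma fewChar_one {n N : ℕ} (lam : Signature N) :
    fewChar lam (1 : Fin n → ℂ) = 0 ∨ fewChar lam (1 : Fin n → ℂ) = 1 := by
  rw [fewChar, padOne_one, normChar]
  rcases eq_or_ne (character lam 1) 0 with h | h
  · exact Or.inl (by simp [h])
  · exact Or.inr (div_self h)

/-- Each `fewChar lam 1` is `0` or `1`. The differences between `ρ(λ)` and the terms are nonnegative
and sum to `1 - 1 = 0`, so all vanish. This makes a proof that `χ_λ(1) ≠ 0` unnecessary. -/
lemma measureReal_mul_fewChar_one {n N : ℕ} {ρ : Measure (Signature N)} [IsProbabilityMeasure ρ]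
    (h : HasSum (fun lam => (ρ.real {lam} : ℂ) * fewChar lam (1 : Fin n → ℂ)) 1)
    (lam : Signature N) :
    (ρ.real {lam} : ℂ) * fewChar lam (1 : Fin n → ℂ) = ρ.real {lam} := by
  have hb : ∀ lam : Signature N, ∃ b : ℝ, b ≤ 1 ∧ fewChar lam (1 : Fin n → ℂ) = b := fun lam => by
    rcases fewChar_one (n := n) lam with h | h
    · exact ⟨0, zero_le_one, by rw [h]; simp⟩
    · exact ⟨1, le_rfl, by rw [h]; simp⟩
  choose b hb1 hb using hb
  have h1 : HasSum (fun lam => ρ.real {lam} * b lam) 1 := by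
    refine Complex.hasSum_ofReal.1 ?_
    simpa [hb] using h
  have h2 := (hasSum_measureReal_singleton ρ).sub h1
  rw [sub_self, hasSum_zero_iff_of_nonneg] at h2
  · have h3 := congrFun h2 lam
    simp only [Pi.zero_apply, sub_eq_zero] at h3
    rw [hb]
    exact_mod_cast h3.symm
  · intro lam
    have : ρ.real {lam} * b lam ≤ ρ.real {lam} * 1 :=
      mul_le_mul_of_nonneg_left (hb1 lam) measureReal_nonneg
    show 0 ≤ ρ.real {lam} - ρ.real {lam} * b lam
    linarith

lemma HasUniformSum.hasSum_one {n N : ℕ} {ρ : Measure (Signature N)} {w : Signature N → ℝ}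
    {f : (Fin n → ℂ) → ℂ} (h : HasUniformSum ρ w f) :
    HasSum (fun lam => ((ρ.real {lam} * w lam : ℝ) : ℂ) * fewChar lam (1 : Fin n → ℂ)) (f 1) := by
  obtain ⟨r, hr, H⟩ := h
  exact H.tendsto_at (mem_ball_self hr)

lemma tendsto_re_of_tendsto_ofReal {x : ℕ → ℝ} {κ : ℂ}
    (h : Tendsto (fun N => (x N : ℂ)) atTop (𝓝 κ)) :
    Tendsto x atTop (𝓝 κ.re) ∧ (κ.re : ℂ) = κ := by
  have h1 : Tendsto x atTop (𝓝 κ.re) := by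
    simpa [Function.comp_def] using (Complex.continuous_re.tendsto κ).comp h
  exact ⟨h1, tendsto_nhds_unique ((Complex.continuous_ofReal.tendsto _).comp h1) h⟩

/-- Evaluation at `1`: there `S` equals `1` since its logarithm vanishes, and the weighted series
becomes the expectation of the weight. One variable suffices. The limit of real numbers is real. -/
theorem HasWeightedLimit.tendsto_integral {ρ : (N : ℕ) → Measure (Signature N)} {Q : ℂ → ℂ}
    (hprob : ∀ N : ℕ, 1 ≤ N → IsProbabilityMeasure (ρ N))
    (hconv : ∀ N : ℕ, 1 ≤ N → CharGenConverges (ρ N)) (hlog : HasRegularLog ρ Q)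
    {w : (N : ℕ) → Signature N → ℝ} {κ : ℂ} (h : HasWeightedLimit ρ w κ) :
    (∀ᶠ N in atTop, Integrable (w N) (ρ N)) ∧
      Tendsto (fun N => ∫ lam, w N lam ∂ρ N) atTop (𝓝 κ.re) ∧ (κ.re : ℂ) = κ := by
  obtain ⟨r, hr, -, f, -, hs, ht⟩ := h 1 le_rfl
  obtain ⟨r₁, hr₁, L, hL⟩ := hlog 1 le_rfl
  have hone : ∀ᶠ N in atTop, charGenFun (ρ N) (padOne N (1 : Fin 1 → ℂ)) = 1 := by
    filter_upwards [hL.exp_log, hL.log_one] with N h1 h2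
    rw [← h1 1 (mem_ball_self hr₁), h2, Complex.exp_zero]
  have key : ∀ᶠ N in atTop, Integrable (w N) (ρ N) ∧
      ((∫ lam, w N lam ∂ρ N : ℝ) : ℂ) = f N 1 := by
    filter_upwards [hs, hone, eventually_ge_atTop 1] with N h1 h2 hN
    have := hprob N hN
    have h3 := ((hconv N hN).hasUniformSum (n := 1)).hasSum_one
    simp only [mul_one, h2] at h3
    have h4 := h1.hasSum_one
    have h5 : HasSum (fun lam => (((ρ N).real {lam} * w N lam : ℝ) : ℂ)) (f N 1) := by
      convert! h4 using 2 with lam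
      push_cast
      rw [mul_right_comm, measureReal_mul_fewChar_one h3 lam]
    have h6 : HasSum (fun lam => (ρ N).real {lam} * w N lam) (f N 1).re := by
      simpa using Complex.hasSum_re h5
    obtain ⟨h7, h8⟩ := integrable_of_hasSum h6
    exact ⟨h7, by rw [h8]; exact (Complex.hasSum_ofReal.2 h6).unique h5⟩
  refine ⟨key.mono fun _ h => h.1, ?_⟩
  refine tendsto_re_of_tendsto_ofReal ((ht.tendsto_at (mem_ball_self hr)).congr' ?_)
  filter_upwards [key, hone] with N h1 h2
  rw [h2, div_one, h1.2]

/-- Monomials are combinations of falling factorials. -/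
lemma exists_pow_eq_sum_prod_sub (n : ℕ) : ∃ a : ℕ → ℝ, a n = 1 ∧
    ∀ x : ℝ, x ^ n = ∑ j ∈ Finset.range (n + 1), a j * ∏ t ∈ Finset.range j, (x - t) := by
  induction n with
  | zero => exact ⟨1, rfl, by simp⟩
  | succ n ih =>
    obtain ⟨a, ha, H⟩ := ih
    -- Coefficients obtained from `x (x)_j = (x)_{j+1} + j (x)_j`, where `(x)_j` is the falling
    -- factorial.
    refine ⟨fun j => (if j = 0 then 0 else a (j - 1)) + if j ≤ n then j * a j else 0,
      by simp [ha], fun x => ?_⟩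
    rw [pow_succ, H x, Finset.sum_mul]
    simp only [add_mul, Finset.sum_add_distrib]
    rw [Finset.sum_range_succ' (fun j => (if j = 0 then (0 : ℝ) else a (j - 1)) *
      ∏ t ∈ Finset.range j, (x - t)), Finset.sum_range_succ (fun j =>
      (if j ≤ n then (j : ℝ) * a j else 0) * ∏ t ∈ Finset.range j, (x - t))]
    simp only [if_neg (Nat.succ_ne_zero _), Nat.add_sub_cancel, if_true, zero_mul, add_zero,
      if_neg (Nat.not_succ_le_self n)]
    rw [← Finset.sum_add_distrib]
    refine Finset.sum_congr rfl fun j hj => ?_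
    rw [if_pos (Nat.lt_succ_iff.1 (Finset.mem_range.1 hj)), Finset.prod_range_succ]
    ring

lemma isProbabilityMeasure_countingMeasure {N : ℕ} (hN : 1 ≤ N) (lam : Signature N) :
    IsProbabilityMeasure (countingMeasure lam) := by
  constructor
  have h0 : (N : ENNReal) ≠ 0 := by
    have : N ≠ 0 := by omega
    exact_mod_cast this
  simp [countingMeasure, ENNReal.inv_mul_cancel h0]

lemma integrable_pow_countingMeasure {N : ℕ} (hN : 1 ≤ N) (lam : Signature N) (n : ℕ) :
    Integrable (fun x : ℝ => x ^ n) (countingMeasure lam) := by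
  refine Integrable.smul_measure ?_ (by
    have : N ≠ 0 := by omega
    simpa using this)
  rw [integrable_finsetSum_measure]
  exact fun i _ => integrable_dirac (by simp)

lemma integral_pow_countingMeasure {N : ℕ} (lam : Signature N) (n : ℕ) :
    ∫ x, x ^ n ∂countingMeasure lam =
      (N : ℝ)⁻¹ * ∑ i, ((shifted lam i : ℝ) / (N : ℝ)) ^ n := by
  rw [countingMeasure, integral_smul_measure, integral_finsetSum_measure]
  · simp
  · exact fun i _ => integrable_dirac (by simp)

/-- The scaled power sums as combinations of scaled sums of falling factorials. -/
lemma integral_pow_countingMeasure_eq_sum {N : ℕ} (hN : 1 ≤ N) (lam : Signature N) {n : ℕ}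
    {a : ℕ → ℝ}
    (ha : ∀ x : ℝ, x ^ n = ∑ j ∈ Finset.range (n + 1), a j * ∏ t ∈ Finset.range j, (x - t)) :
    ∫ x, x ^ n ∂countingMeasure lam = ∑ j ∈ Finset.range (n + 1),
      (a j * ((N : ℝ) ^ (n - j))⁻¹) * (((N : ℝ) ^ (j + 1))⁻¹ * fallingSum j lam) := by
  have h0 : (N : ℝ) ≠ 0 := by
    have : N ≠ 0 := by omega
    exact_mod_cast this
  rw [integral_pow_countingMeasure]
  simp only [div_pow, ha (shifted lam _), fallingSum, Finset.sum_div, Finset.mul_sum]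
  rw [Finset.sum_comm]
  refine Finset.sum_congr rfl fun j hj => Finset.sum_congr rfl fun i _ => ?_
  have hj' : j ≤ n := Nat.lt_succ_iff.1 (Finset.mem_range.1 hj)
  have hpow : (N : ℝ) ^ n * N = (N : ℝ) ^ (n - j) * (N : ℝ) ^ (j + 1) := by
    rw [← pow_add, ← pow_succ]; congr 1; omega
  have h1 : (N : ℝ)⁻¹ * ((N : ℝ) ^ n)⁻¹ = ((N : ℝ) ^ (n - j))⁻¹ * ((N : ℝ) ^ (j + 1))⁻¹ := by
    rw [← mul_inv, ← mul_inv, mul_comm (N : ℝ), hpow]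
  rw [div_eq_mul_inv]
  linear_combination (a j * ∏ t ∈ Finset.range j, ((shifted lam i : ℝ) - t)) * h1

lemma tendsto_mul_inv_pow_sub (a : ℝ) (n j : ℕ) (hj : j ≤ n) :
    Tendsto (fun N : ℕ => a * ((N : ℝ) ^ (n - j))⁻¹) atTop (𝓝 (if j = n then a else 0)) := by
  split_ifs with h
  · simp [h]
  · have : Tendsto (fun N : ℕ => ((N : ℝ) ^ (n - j))⁻¹) atTop (𝓝 0) :=
      ((tendsto_pow_atTop (by omega)).comp tendsto_natCast_atTop_atTop).inv_tendsto_atTop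
    simpa using this.const_mul a

variable {ρ : (N : ℕ) → Measure (Signature N)} {Q : ℂ → ℂ}

/-- The moments of the random counting measures have converging expectations and second
moments. -/
theorem tendsto_integral_moment (hprob : ∀ N : ℕ, 1 ≤ N → IsProbabilityMeasure (ρ N))
    (hconv : ∀ N : ℕ, 1 ≤ N → CharGenConverges (ρ N)) (hQ : AnalyticAt ℂ Q 1)
    (hlog : HasRegularLog ρ Q) (n : ℕ) :
    (∀ᶠ N in atTop, Integrable (fun lam => ∫ x, x ^ n ∂countingMeasure lam) (ρ N)) ∧
    (∀ᶠ N in atTop, Integrable (fun lam => (∫ x, x ^ n ∂countingMeasure lam) ^ 2) (ρ N)) ∧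
    Tendsto (fun N => ∫ lam, (∫ x, x ^ n ∂countingMeasure lam) ∂ρ N) atTop
      (𝓝 (limitMoment Q n).re) ∧
    Tendsto (fun N => ∫ lam, (∫ x, x ^ n ∂countingMeasure lam) ^ 2 ∂ρ N) atTop
      (𝓝 ((limitMoment Q n).re ^ 2)) ∧ ((limitMoment Q n).re : ℂ) = limitMoment Q n := by
  -- From weight `1`, one application of the inductive step gives the expectations and two give
  -- those of products, whose limits factor.
  have hw0 := hlog.hasWeightedLimit_one hconv
  have hw1 := fun j => hw0.fallingSum hQ hlog j
  have hw2 := fun j k => (hw1 j).fallingSum hQ hlog k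
  simp only [mul_one, one_mul] at hw1 hw2
  have H1 := fun j => (hw1 j).tendsto_integral hprob hconv hlog
  have H2 := fun j k => (hw2 j k).tendsto_integral hprob hconv hlog
  have hre : ∀ j, ((limitMoment Q j).re : ℂ) = limitMoment Q j := fun j => (H1 j).2.2
  have hre2 : ∀ j k, (limitMoment Q j * limitMoment Q k).re =
      (limitMoment Q j).re * (limitMoment Q k).re := fun j k => by
    rw [← hre j, ← hre k, ← Complex.ofReal_mul, Complex.ofReal_re, Complex.ofReal_re,
      Complex.ofReal_re]
  set Y : ℕ → (N : ℕ) → Signature N → ℝ := fun j N lam =>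
    ((N : ℝ) ^ (j + 1))⁻¹ * fallingSum j lam with hY
  obtain ⟨a, ha, hsum⟩ := exists_pow_eq_sum_prod_sub n
  have hM : ∀ N, 1 ≤ N → ∀ lam : Signature N, ∫ x, x ^ n ∂countingMeasure lam =
      ∑ j ∈ Finset.range (n + 1), (a j * ((N : ℝ) ^ (n - j))⁻¹) * Y j N lam :=
    fun N hN lam => integral_pow_countingMeasure_eq_sum hN lam hsum
  have hM2 : ∀ N, 1 ≤ N → ∀ lam : Signature N, (∫ x, x ^ n ∂countingMeasure lam) ^ 2 =
      ∑ p ∈ Finset.range (n + 1) ×ˢ Finset.range (n + 1),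
        ((a p.1 * ((N : ℝ) ^ (n - p.1))⁻¹) * (a p.2 * ((N : ℝ) ^ (n - p.2))⁻¹)) *
          (Y p.2 N lam * Y p.1 N lam) := by
    intro N hN lam
    rw [hM N hN lam, sq, Finset.sum_mul_sum, Finset.sum_product]
    exact Finset.sum_congr rfl fun _ _ => Finset.sum_congr rfl fun _ _ => by ring
  have I1 : ∀ᶠ N in atTop, ∀ j ∈ Finset.range (n + 1), Integrable (Y j N) (ρ N) := by
    rw [eventually_all_finset]
    exact fun j _ => (H1 j).1
  have I2 : ∀ᶠ N in atTop, ∀ p ∈ Finset.range (n + 1) ×ˢ Finset.range (n + 1),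
      Integrable (fun lam => Y p.2 N lam * Y p.1 N lam) (ρ N) := by
    rw [eventually_all_finset]
    exact fun p _ => (H2 p.1 p.2).1
  -- Lower falling factorials carry negative powers of `N`, so only `j = n`, with coefficient `1`,
  -- survives.
  have hcoef : ∀ j ∈ Finset.range (n + 1), Tendsto (fun N : ℕ => a j * ((N : ℝ) ^ (n - j))⁻¹) atTop
      (𝓝 (if j = n then 1 else 0)) := by
    intro j hj
    have := tendsto_mul_inv_pow_sub (a j) n j (Nat.lt_succ_iff.1 (Finset.mem_range.1 hj))
    convert! this using 3
    rename_i h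
    rw [h, ha]
  refine ⟨?_, ?_, ?_, ?_, hre n⟩
  · filter_upwards [I1, eventually_ge_atTop 1] with N h1 hN
    simp only [hM N hN]
    exact integrable_finsetSum _ fun j hj => (h1 j hj).const_mul _
  · filter_upwards [I2, eventually_ge_atTop 1] with N h1 hN
    simp only [hM2 N hN]
    exact integrable_finsetSum _ fun p hp => (h1 p hp).const_mul _
  · have hlim := tendsto_finsetSum (Finset.range (n + 1)) fun j hj =>
      (hcoef j hj).mul (H1 j).2.1
    simp only [ite_mul, one_mul, zero_mul, Finset.sum_ite_eq', Finset.self_mem_range_succ,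
      if_true] at hlim
    refine hlim.congr' ?_
    filter_upwards [I1, eventually_ge_atTop 1] with N h1 hN
    simp only [hM N hN]
    rw [integral_finsetSum _ fun j hj => (h1 j hj).const_mul _]
    exact Finset.sum_congr rfl fun j _ => (integral_const_mul _ _).symm
  · have hlim := tendsto_finsetSum (Finset.range (n + 1) ×ˢ Finset.range (n + 1)) fun p hp =>
      (((hcoef p.1 (Finset.mem_product.1 hp).1).mul (hcoef p.2 (Finset.mem_product.1 hp).2))).mul
        (H2 p.1 p.2).2.1
    simp only [Finset.sum_product, ite_mul, mul_ite, one_mul, zero_mul, mul_zero,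
      Finset.sum_ite_eq', Finset.self_mem_range_succ, if_true, hre2] at hlim
    rw [← sq] at hlim
    refine hlim.congr' ?_
    filter_upwards [I2, eventually_ge_atTop 1] with N h1 hN
    simp only [hM2 N hN]
    rw [integral_finsetSum _ fun p hp => (h1 p hp).const_mul _, Finset.sum_product]
    exact Finset.sum_congr rfl fun j _ => Finset.sum_congr rfl fun k _ =>
      (integral_const_mul _ _).symm

theorem tendsto_measure_moment (hprob : ∀ N : ℕ, 1 ≤ N → IsProbabilityMeasure (ρ N))
    (hconv : ∀ N : ℕ, 1 ≤ N → CharGenConverges (ρ N)) (hQ : AnalyticAt ℂ Q 1)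
    (hlog : HasRegularLog ρ Q) (n : ℕ) {ε : ℝ} (hε : 0 < ε) :
    Tendsto (fun N : ℕ => ρ N {lam | ε ≤ |∫ x, x ^ n ∂countingMeasure lam -
      (limitMoment Q n).re|}) atTop (𝓝 0) := by
  obtain ⟨h1, h2, h3, h4, -⟩ := tendsto_integral_moment hprob hconv hQ hlog n
  exact tendsto_measure_of_tendsto_integral_sq ((eventually_ge_atTop 1).mono hprob) h1 h2 h3 h4 hε

/-- Some counting measure has its first moments close to the limits. -/
lemma exists_signature_moments_close (hprob : ∀ N : ℕ, 1 ≤ N → IsProbabilityMeasure (ρ N))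
    {c : ℕ → ℝ} (h : ∀ n : ℕ, ∀ ε : ℝ, 0 < ε → Tendsto (fun N : ℕ =>
      ρ N {lam | ε ≤ |∫ x, x ^ n ∂countingMeasure lam - c n|}) atTop (𝓝 0)) (J : ℕ) {ε : ℝ}
    (hε : 0 < ε) : ∃ N, 1 ≤ N ∧ ∃ lam : Signature N,
      ∀ n ≤ J, |∫ x, x ^ n ∂countingMeasure lam - c n| < ε := by
  -- Union bound: once the finitely many bad events have total probability below `1`, some signature
  -- avoids them all.
  have hs := tendsto_finsetSum (Finset.range (J + 1)) fun n _ => h n ε hε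
  rw [Finset.sum_const_zero] at hs
  obtain ⟨N, hN, hN1⟩ := ((hs.eventually (gt_mem_nhds one_pos)).and (eventually_ge_atTop 1)).exists
  refine ⟨N, hN1, ?_⟩
  by_contra! hcon
  have hP := hprob N hN1
  have hcover : (univ : Set (Signature N)) ⊆ ⋃ n ∈ Finset.range (J + 1),
      {lam | ε ≤ |∫ x, x ^ n ∂countingMeasure lam - c n|} := by
    intro lam _
    obtain ⟨n, hn, h1⟩ := hcon lam
    exact mem_iUnion₂.2 ⟨n, Finset.mem_range.2 (Nat.lt_succ_of_le hn), h1⟩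
  have h1 : (1 : ENNReal) ≤ ∑ n ∈ Finset.range (J + 1),
      ρ N {lam | ε ≤ |∫ x, x ^ n ∂countingMeasure lam - c n|} := by
    rw [← hP.measure_univ]
    exact (measure_mono hcover).trans (measure_biUnion_finset_le _ _)
  exact absurd hN (not_lt.2 h1)

/-- Convergence in probability yields deterministic signatures whose first `J` moments are within `1
/ (J + 1)` of the limits; their counting measures then have a limit point with exactly these
moments. -/
theorem exists_measure_of_tendsto_measure_moment
    (hprob : ∀ N : ℕ, 1 ≤ N → IsProbabilityMeasure (ρ N))
    {c : ℕ → ℝ} (h : ∀ n : ℕ, ∀ ε : ℝ, 0 < ε → Tendsto (fun N : ℕ =>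
      ρ N {lam | ε ≤ |∫ x, x ^ n ∂countingMeasure lam - c n|}) atTop (𝓝 0)) :
    ∃ m : Measure ℝ, IsProbabilityMeasure m ∧
      ∀ n, Integrable (fun x : ℝ => x ^ n) m ∧ ∫ x, x ^ n ∂m = c n := by
  have hJ := fun J : ℕ => exists_signature_moments_close hprob h J
    (ε := 1 / ((J : ℝ) + 1)) (by positivity)
  choose N hN lam hlam using hJ
  refine exists_measure_of_tendsto_moments (ν := fun J => countingMeasure (lam J))
    (fun J => isProbabilityMeasure_countingMeasure (hN J) _)
    (fun J n => integrable_pow_countingMeasure (hN J) _ n) fun n => ?_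
  rw [tendsto_iff_norm_sub_tendsto_zero]
  refine squeeze_zero' (Eventually.of_forall fun _ => norm_nonneg _) ?_
    tendsto_one_div_add_atTop_nhds_zero_nat
  filter_upwards [eventually_ge_atTop n] with J hJ
  exact (hlam J n hJ).le

end Expectations

end UnitarySignature

end

/-! ### Conclusion. -/

theorem theorem5p1
    (ρ : (N : ℕ) → MeasureTheory.Measure (UnitarySignature.Signature N))
    (hprob : ∀ N : ℕ, 1 ≤ N → MeasureTheory.IsProbabilityMeasure (ρ N))
    (hconv : ∀ N : ℕ, 1 ≤ N → UnitarySignature.CharGenConverges (ρ N))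
    (Q : ℂ → ℂ) (hQ : AnalyticAt ℂ Q 1)
    (hlim : ∀ k : ℕ, 1 ≤ k → UnitarySignature.LogCharGenTendsto ρ Q k) :
    ∃ m : MeasureTheory.Measure ℝ, MeasureTheory.IsProbabilityMeasure m ∧
      UnitarySignature.TendstoInProbabilityInMoments ρ m ∧
      ∀ k : ℕ,
        ((∫ x : ℝ, x ^ k ∂m : ℝ) : ℂ) =
          ∑ l ∈ Finset.range (k + 1),
            ((k.factorial : ℂ) /
                ((l.factorial : ℂ) * ((l + 1).factorial : ℂ) * ((k - l).factorial : ℂ))) *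
              iteratedDeriv l (fun u : ℂ => u ^ k * (deriv Q u) ^ (k - l)) 1 := by
  have hlog := UnitarySignature.hasRegularLog_of_logCharGenTendsto hQ hlim
  have hconc := fun n (ε : ℝ) (hε : 0 < ε) =>
    UnitarySignature.tendsto_measure_moment hprob hconv hQ hlog n hε
  obtain ⟨m, hm, hmom⟩ := UnitarySignature.exists_measure_of_tendsto_measure_moment hprob
    (c := fun n => (UnitarySignature.limitMoment Q n).re) hconc
  refine ⟨m, hm, fun n => ⟨(hmom n).1, fun ε hε => ?_⟩, fun k => ?_⟩
  · rw [(hmom n).2]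
    exact hconc n ε hε
  · rw [(hmom k).2, (UnitarySignature.tendsto_integral_moment hprob hconv hQ hlog k).2.2.2.2,
      UnitarySignature.limitMoment]
    refine Finset.sum_congr rfl fun l hl => ?_
    have hlk : l ≤ k := Nat.lt_succ_iff.1 (Finset.mem_range.1 hl)
    have h1 : (l.factorial : ℂ) ≠ 0 := by exact_mod_cast l.factorial_ne_zero
    have h2 : ((l + 1).factorial : ℂ) ≠ 0 := by exact_mod_cast (l + 1).factorial_ne_zero
    have h3 : ((k - l).factorial : ℂ) ≠ 0 := by exact_mod_cast (k - l).factorial_ne_zero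
    -- The factor `l!` from the Leibniz rule cancels the one in the Taylor coefficient, leaving
    -- `C(k,l) / (l+1)!`.
    push_cast [Nat.cast_choose ℂ hlk]
    field_simp
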